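/- **Setting.** A *rotor graph* is a finite directed multigraph $(V,\mathcal A)$ without loops, with a nonempty set $S_0\subseteq V$ of *sinks* and, at each non-sink vertex $u$, a *rotor order*: a self-map $\theta_u$ of the set $\mathcal A^+(u)$ of arcs leaving $u$ such that the orbit of every arc of $\mathcal A^+(u)$ is all of $\mathcal A^+(u)$. It is *tree-like* if the simple undirected graph obtained by forgetting directions and multiplicities is a tree and all sinks are leaves of it (vertices with exactly one neighbour), and *stopping* if from every vertex there is a directed path to a sink. A *(partial) configuration* on a set $P\subseteq V\setminus S_0$ selects an arc of $\mathcal A^+(u)$ for each $u\in P$. In the *rotor walk* from $(\rho,u)$, where $\rho$ is a configuration on $V\setminus S_0$, a particle starts at $u$; while it is at a non-sink vertex $w$ it moves along $\rho(w)$, and then $\rho(w)$ is replaced by $\theta_w(\rho(w))$; it stops at a sink. In a *two-player rotor game*, $V\setminus S_0$ is partitioned into $V_{\mathrm{MAX}}$, $V_{\mathrm{MIN}}$ and $V_r$, a configuration $\rho$ on $V_r$ is given, and each sink $s$ has a value $\mathrm{val}(s)\in\mathbb N$. Strategies $\sigma$ of MAX and $\tau$ of MIN are configurations on $V_{\mathrm{MAX}}$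 and $V_{\mathrm{MIN}}$, and $\mathrm{val}_{\sigma,\tau}(u_0)$ is the value of the sink at which the rotor walk from $((\rho,\sigma,\tau),u_0)$ stops ($0$ if it does not stop). The game is *binary* if all values of sinks are $0$ or $1$. **Theorem.** Let $G$ be a stopping tree-like two-player rotor game and $u_0$ a vertex. There are $\mathrm{val}^*\in\mathbb N$ and strategies $\sigma^*,\tau^*$ such that 1. $\mathrm{val}_{\sigma^*,\tau}(u_0)\ge \mathrm{val}^*$ for all strategies $\tau$ of MIN, and $\tau^*$ is optimal for MIN against $\sigma^*$; 2. $\mathrm{val}_{\sigma,\tau^*}(u_0)\le \mathrm{val}^*$ for all strategies $\sigma$ of MAX, and $\sigma^*$ is optimal for MAX against $\tau^*$. ($\mathrm{val}^*$ is the *value of the game* and $(\sigma^*,\tau^*)$ a *pure strategy equilibrium*.) Furthermore, there is a random access machine program that computes $\mathrm{val}^*$ from $(G,u_0)$ with the following running times, with an absolute implied constant. For binary games, it runs * in time $O(|\mathcal A|)$ if arithmetic operations take constant time, and * in time $O(|\mathcal A|\cdot c(r_{\max},|\mathcal A|))$ if arithmetic is charged by its bit complexity. For games with arbitrary values in $\mathbb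 N$, it runs * in time $O(|\mathcal A|\,(1+\lfloor\log_2|S_0|\rfloor))$ if arithmetic operations take constant time, and * in time $O(|\mathcal A|\cdot c(\max(r_{\max},v_{\max}),|\mathcal A|)\,(1+\lfloor\log_2|S_0|\rfloor))$ if arithmetic is charged by its bit complexity. Here $v_{\max}$ is the largest value of a sink, and $c(a,b)$ is the cost charged for dividing (or multiplying) $a$ by $b$: any function that is nondecreasing in both arguments and at least the total number of bits of $a$ and $b$; the other instructions are charged the number of bits of the numbers they handle. The number $r_{\max}$ is the largest finite return flow over all pairs of strategies and all pairs $(u,v)$ joined by an arc from $u$ to $v$. The *return flow* of $(u,v)$ is the number of times that the particle leaves $u$ in the rotor walk from $u$ in the $(u,v)$-subtree, which consists of $u$ and of the component of $v$ after removal of $u$, and in which $u$ keeps a single outgoing arc, leading to $v$ (the return flow is $0$ if $u$ is a sink). -/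

import Mathlib

/-! ## Rotor graphs and rotor walks -/

/-- A rotor multigraph without loops: vertices `V`, arcs `A`, a nonempty set of sinks, and, at every
non-sink vertex `u`, a rotor order, i.e. a self-map of the arcs with tail `u` such that the
orbit of each of these arcs is the set of all of them.  The rotor orders are the restrictions of
the single map `next`; its values at arcs whose tail is a sink play no role. -/
structure RotorGraph (V A : Type*) where
  tail : A → V
  head : A → V
  tail_ne_head : ∀ a, tail a ≠ head a
  sinks : Set V
  sinks_nonempty : sinks.Nonempty
  next : A → A
  tail_next : ∀ a, tail a ∉ sinks → tail (next a) = tail a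
  next_orbit : ∀ a b, tail a ∉ sinks → tail b = tail a → ∃ k : ℕ, next^[k] a = b

namespace RotorGraph

variable {V A : Type*}

/-- A partial rotor configuration on `P`: an outgoing arc at every vertex of `P`. -/
def PartialConfig (G : RotorGraph V A) (P : Set V) : Type _ :=
  (u : P) → {a : A // G.tail a = u}

/-- A rotor configuration: an outgoing arc at every non-sink vertex. -/
abbrev Config (G : RotorGraph V A) : Type _ := G.PartialConfig G.sinksᶜ

open Classical in
/-- Replace the arc at `u` by the next one in the rotor order. -/
noncomputable def turn (G : RotorGraph V A) (ρ : G.Config) (u : (G.sinksᶜ : Set V)) : G.Config :=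
  Function.update (β := fun u : (G.sinksᶜ : Set V) => {a : A // G.tail a = u}) ρ u
    ⟨G.next (ρ u).1, by rw [G.tail_next _ (by rw [(ρ u).2]; exact u.2), (ρ u).2]⟩

open Classical in
/-- One routing of the particle (move along the current arc, then turn the rotor).
A particle on a sink stays there. -/
noncomputable def step (G : RotorGraph V A) (p : G.Config × V) : G.Config × V :=
  if h : p.2 ∈ G.sinks then p
  else (G.turn p.1 ⟨p.2, h⟩, G.head (p.1 ⟨p.2, h⟩).1)

/-- The maximal rotor walk from `(ρ, u)` ends in the sink `s`. -/
def ExitsAt (G : RotorGraph V A) (ρ : G.Config) (u : V) (s : G.sinks) : Prop :=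
  ∃ k : ℕ, (G.step^[k] (ρ, u)).2 = s

theorem step_of_mem (G : RotorGraph V A) (p : G.Config × V) (h : p.2 ∈ G.sinks) :
    G.step p = p := by
  simp [step, h]

/-- The exit sink is unique. -/
theorem ExitsAt.unique {G : RotorGraph V A} {ρ : G.Config} {u : V} {s t : G.sinks}
    (hs : G.ExitsAt ρ u s) (ht : G.ExitsAt ρ u t) : s = t := by
  have key : ∀ (s : G.sinks) (k l : ℕ), k ≤ l → (G.step^[k] (ρ, u)).2 = s →
      (G.step^[l] (ρ, u)).2 = s := by
    intro s k l hkl hk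
    obtain ⟨d, rfl⟩ := Nat.exists_eq_add_of_le' hkl
    rw [Function.iterate_add_apply,
      Function.iterate_fixed (G.step_of_mem _ (by rw [hk]; exact s.2)), hk]
  obtain ⟨k, hk⟩ := hs
  obtain ⟨l, hl⟩ := ht
  apply Subtype.ext
  rw [← key s k (max k l) (le_max_left _ _) hk, ← key t l (max k l) (le_max_right _ _) hl]

/-- There is an arc from `u` to `v`. -/
def HasArc (G : RotorGraph V A) (u v : V) : Prop := ∃ a, G.tail a = u ∧ G.head a = v

/-- The underlying simple undirected graph. -/
def underlying (G : RotorGraph V A) : SimpleGraph V where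
  Adj u v := G.HasArc u v ∨ G.HasArc v u
  symm := ⟨fun _ _ h => h.symm⟩
  loopless := ⟨by
    rintro u (⟨a, h, h'⟩ | ⟨a, h, h'⟩) <;> exact G.tail_ne_head a (h.trans h'.symm)⟩

/-- Tree-like: the underlying graph is a tree, and every sink is one of its leaves. -/
def TreeLike (G : RotorGraph V A) : Prop :=
  G.underlying.IsTree ∧ ∀ s ∈ G.sinks, (G.underlying.neighborSet s).ncard = 1

/-- Stopping: from every vertex there is a directed path to a sink. -/
def Stopping (G : RotorGraph V A) : Prop :=
  ∀ u, ∃ s ∈ G.sinks, Relation.ReflTransGen G.HasArc u s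

open Classical in
/-- One routing in the `(u, v)`-subtree, the part of a tree-like graph that consists of `u` and the
component of `v` after removal of `u`, in which `u` keeps a single outgoing arc, leading to `v`.
All the other rotors are those of `G`, and a particle that starts on `u` never leaves this part,
so that only the routing at `u` is different from the one in `G`. -/
noncomputable def subtreeStep (G : RotorGraph V A) (u v : V) (p : G.Config × V) : G.Config × V :=
  if p.2 = u then (p.1, v) else G.step p

open Classical in
/-- The return flow of `(u, v)`: the number (possibly infinite) of times that a particle starting
on `u` leaves `u` (towards `v`) during the maximal rotor walk in the `(u, v)`-subtree. -/
noncomputable def returnFlow (G : RotorGraph V A) (ρ : G.Config) (u v : V) : ℕ∞ :=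
  if u ∈ G.sinks then 0
  else Set.encard {i : ℕ | ((G.subtreeStep u v)^[i] (ρ, u)).2 = u}

end RotorGraph

/-! ## Two-player rotor games -/

/-- A two-player rotor game.  The non-sink vertices are those of MAX, those of MIN, and the
remaining ones, on which an initial configuration `rho` is given. -/
structure RotorGame (V A : Type*) extends RotorGraph V A where
  maxVerts : Set V
  minVerts : Set V
  disjoint_max_min : Disjoint maxVerts minVerts
  disjoint_max_sinks : Disjoint maxVerts sinks
  disjoint_min_sinks : Disjoint minVerts sinks
  val : sinks → ℕ
  rho : toRotorGraph.PartialConfig (maxVerts ∪ minVerts ∪ sinks)ᶜ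

namespace RotorGame

variable {V A : Type*}

/-- The vertices controlled by no player. -/
abbrev rotorVerts (G : RotorGame V A) : Set V := (G.maxVerts ∪ G.minVerts ∪ G.sinks)ᶜ

/-- Strategies of MAX: initial rotor positions on the vertices of MAX. -/
abbrev MaxStrategy (G : RotorGame V A) : Type _ := G.toRotorGraph.PartialConfig G.maxVerts

/-- Strategies of MIN: initial rotor positions on the vertices of MIN. -/
abbrev MinStrategy (G : RotorGame V A) : Type _ := G.toRotorGraph.PartialConfig G.minVerts

open Classical in
/-- The configuration that agrees with `rho`, `σ` and `τ` on their respective domains. -/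
noncomputable def config (G : RotorGame V A) (σ : G.MaxStrategy) (τ : G.MinStrategy) :
    G.toRotorGraph.Config :=
  fun u =>
    if h : u.1 ∈ G.maxVerts then σ ⟨u.1, h⟩
    else if h' : u.1 ∈ G.minVerts then τ ⟨u.1, h'⟩
    else G.rho ⟨u.1, by
      rintro ((h₁ | h₂) | h₃)
      · exact h h₁
      · exact h' h₂
      · exact u.2 h₃⟩

open Classical in
/-- The value of the game for the strategies `σ`, `τ` and the starting vertex `u₀`: the value of
the sink that the maximal rotor walk reaches if there is one, and `0` otherwise. -/
noncomputable def value (G : RotorGame V A) (u₀ : V) (σ : G.MaxStrategy) (τ : G.MinStrategy) : ℕ :=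
  if h : ∃ s, G.toRotorGraph.ExitsAt (G.config σ τ) u₀ s then G.val h.choose else 0

/-- `(σ, τ)` is a pure strategy equilibrium, and `v` is the value of the game: `σ` guarantees
at least `v`, `τ` guarantees at most `v`, and `σ`, `τ` are optimal in the one-player games obtained
by fixing the strategy of the other player. -/
structure IsPureEquilibrium (G : RotorGame V A) (u₀ : V) (v : ℕ)
    (σ : G.MaxStrategy) (τ : G.MinStrategy) : Prop where
  max_guarantees : ∀ τ', v ≤ G.value u₀ σ τ'
  min_guarantees : ∀ σ', G.value u₀ σ' τ ≤ v
  min_optimal : ∀ τ', G.value u₀ σ τ ≤ G.value u₀ σ τ'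
  max_optimal : ∀ σ', G.value u₀ σ' τ ≤ G.value u₀ σ τ

/-- `v` is the value of the game (there is at most one). -/
def IsValue (G : RotorGame V A) (u₀ : V) (v : ℕ) : Prop :=
  ∃ σ τ, G.IsPureEquilibrium u₀ v σ τ

theorem IsValue.unique {G : RotorGame V A} {u₀ : V} {v w : ℕ}
    (hv : G.IsValue u₀ v) (hw : G.IsValue u₀ w) : v = w := by
  obtain ⟨σ, τ, h⟩ := hv
  obtain ⟨σ', τ', h'⟩ := hw
  exact le_antisymm ((h.max_guarantees τ').trans (h'.min_guarantees σ))
    ((h'.max_guarantees τ).trans (h.min_guarantees σ'))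

/-- All sinks have value `0` or `1`. -/
def IsBinary (G : RotorGame V A) : Prop := ∀ s, G.val s ≤ 1

/-- The largest finite return flow, over all pairs of strategies and all arcs. -/
noncomputable def maxReturnFlow (G : RotorGame V A) : ℕ :=
  sSup {r : ℕ | ∃ σ τ u v, G.toRotorGraph.HasArc u v ∧
    G.toRotorGraph.returnFlow (G.config σ τ) u v = r}

/-- The largest value of a sink. -/
noncomputable def maxSinkValue (G : RotorGame V A) : ℕ := ⨆ s, G.val s

open Classical in
/-- The input that represents a game with its starting vertex: the number of vertices, the number
of arcs and the starting vertex; then, for each vertex, its kind (`0`: no player, `1`: MAX,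
`2`: MIN, `3`: sink), its value if it is a sink, and its initial arc if no player controls it;
then, for each arc, its tail, its head and its successor in the rotor order of its tail.
Entries without a meaning are `0`. -/
noncomputable def encode {n m : ℕ} (G : RotorGame (Fin n) (Fin m)) (u₀ : Fin n) : List ℕ :=
  [n, m, u₀.val] ++
  (List.finRange n).flatMap (fun v =>
    [if v ∈ G.maxVerts then 1 else if v ∈ G.minVerts then 2 else if v ∈ G.sinks then 3 else 0,
     if h : v ∈ G.sinks then G.val ⟨v, h⟩ else 0,
     if h : v ∈ G.rotorVerts then ((G.rho ⟨v, h⟩).1 : Fin m).val else 0]) ++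
  (List.finRange m).flatMap (fun a =>
    [(G.tail a).val, (G.head a).val,
     if G.tail a ∈ G.sinks then 0 else (G.next a).val])

end RotorGame

/-! ## Random access machines with two cost measures -/

namespace RAM

/-- Instructions of a random access machine on natural numbers.  The operands are names of
registers, except for the constant in `const` and the jump targets. -/
inductive Instr where
  | const (d k : ℕ)
  | add (d a b : ℕ)
  | sub (d a b : ℕ)
  | mul (d a b : ℕ)
  | div (d a b : ℕ)
  | load (d a : ℕ)
  | store (a b : ℕ)
  | jump (t : ℕ)
  | jumpIfLt (a b t : ℕ)

/-- A program is a finite list of instructions. -/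
abbrev Program : Type := List Instr

/-- Program counter, registers, memory. -/
structure State where
  pc : ℕ
  reg : ℕ → ℕ
  mem : ℕ → ℕ

/-- Assign a register and go to the next instruction. -/
def State.assign (s : State) (d x : ℕ) : State :=
  { s with pc := s.pc + 1, reg := Function.update s.reg d x }

/-- The effect of an instruction (`sub` is truncated subtraction, `div` is Euclidean division). -/
def Instr.exec (s : State) : Instr → State
  | .const d k => s.assign d k
  | .add d a b => s.assign d (s.reg a + s.reg b)
  | .sub d a b => s.assign d (s.reg a - s.reg b)
  | .mul d a b => s.assign d (s.reg a * s.reg b)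
  | .div d a b => s.assign d (s.reg a / s.reg b)
  | .load d a => s.assign d (s.mem (s.reg a))
  | .store a b => { s with pc := s.pc + 1, mem := Function.update s.mem (s.reg a) (s.reg b) }
  | .jump t => { s with pc := t }
  | .jumpIfLt a b t => { s with pc := if s.reg a < s.reg b then t else s.pc + 1 }

/-- One step; the machine has halted when the program counter is outside of the program. -/
def step (P : Program) (s : State) : State :=
  match P[s.pc]? with
  | some i => i.exec s
  | none => s

/-- The initial state: the input is written in the memory, everything else is `0`. -/
def init (input : List ℕ) : State where
  pc := 0
  reg := fun _ => 0
  mem := fun i => input.getD i 0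

/-- Each instruction costs `1`. -/
def unitCost (_ : Instr) (_ : State) : ℕ := 1

/-- The bit-cost of an instruction: multiplications and divisions of `x` by `y` are charged `c x y`,
and the other instructions the number of bits of the numbers they handle. -/
def bitCost (c : ℕ → ℕ → ℕ) (i : Instr) (s : State) : ℕ :=
  match i with
  | .const _ k => 1 + k.size
  | .add _ a b => 1 + (s.reg a).size + (s.reg b).size
  | .sub _ a b => 1 + (s.reg a).size + (s.reg b).size
  | .mul _ a b => 1 + c (s.reg a) (s.reg b)
  | .div _ a b => 1 + c (s.reg a) (s.reg b)
  | .load _ a => 1 + (s.reg a).size + (s.mem (s.reg a)).size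
  | .store a b => 1 + (s.reg a).size + (s.reg b).size
  | .jump _ => 1
  | .jumpIfLt a b _ => 1 + (s.reg a).size + (s.reg b).size

/-- The cost of the instruction that is executed in the state `s`. -/
def stepCost (cost : Instr → State → ℕ) (P : Program) (s : State) : ℕ :=
  match P[s.pc]? with
  | some i => cost i s
  | none => 0

/-- On the given input, the program halts with the given output in register `0`, and the
total cost of the executed instructions is at most `T`. -/
def ComputesWithin (cost : Instr → State → ℕ) (P : Program) (input : List ℕ) (output T : ℕ) :
    Prop :=
  ∃ k : ℕ, P.length ≤ ((step P)^[k] (init input)).pc ∧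
    ((step P)^[k] (init input)).reg 0 = output ∧
    ∑ i ∈ Finset.range k, stepCost cost P ((step P)^[i] (init input)) ≤ T

/-- `c a b` is an admissible cost for dividing `a` by `b`: it is monotone, and at least the number
of bits needed to read the two numbers. -/
structure IsDivisionCost (c : ℕ → ℕ → ℕ) : Prop where
  mono : ∀ a a' b b', a ≤ a' → b ≤ b' → c a b ≤ c a' b'
  size_le : ∀ a b, a.size + b.size ≤ c a b

end RAM

/-!
Root the tree at the starting vertex. The part of a rotor walk below a vertex `v` depends on the
rest of the tree only through the number of times that the particle enters it. Hence, when every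
sink is declared to be won by MAX or by MIN, it is summarised by an `Outcome`: the number of the
visit during which the particle is captured by a sink below `v` (the return flow; `0` if it always
comes back) and the player who wins there. The outcome of `v` is determined by those of its children
(`nodeOutcome`): let the rotor of `v` run, and stop as soon as some child `w` has received the
particle as often as its flow. Correctness (`RotorGraph.subtreeCorrect`) is an induction from the
leaves, based on the fact that the particle enters a subtree as often as it leaves it, up to one
(`RotorGraph.moves_par_eq`). It is essential that sinks are leaves, and that the graph is stopping,
so that the walk does reach a sink.

A player prefers to win after few visits, and to lose after many. This is a total preorder
(`Outcome.score`), and the outcome of a vertex is monotone in those of its children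
(`score_nodeOutcome_mono`). Therefore each player can choose the best arc at every vertex separately
(`RotorGame.IsOpt`), and these choices are optimal against all strategies
(`RotorGame.exists_optimal_strategies`). If the sinks of value at least `t` are those won by MAX,
then either MAX can guarantee `t` or MIN can guarantee less than `t` (`RotorGame.threshold`); the
largest `t` of the first kind is the value of the game.

To find the best arc of `v` in time linear in the degree `d` of `v`, note that a full turn of the
rotor leads to each child `w` equally often for all starts, say `k` times. So `w` captures the
particle in the turn number `(r - 1) / k + 1`, where `r` is the flow of `w`, whatever the start is;
only the children for which this number is least matter, and for these the capture occurs within `d`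
further departures (`captured_iff`). The departure of the capture moves forward with the start, so
that all starts are handled by two pointers which run through at most `2 d` arcs
(`RotorSolver.spec_slideWindow`). Each arc requires a bounded number of operations, the
multiplications and divisions have operands at most the largest finite return flow and `|A|`, and
thus the outcomes for one threshold are found in linear time (`RotorSolver.spec_solve`). A binary
game needs the threshold `1` only. In general, the values of the sinks are sorted by merging, and
the value of the game is found by a binary search among them (`RotorSolver.spec_main`).

The program is written in a structured language with named registers and arrays, and compiled to the
random access machine; the compiled program simulates the structured one with the same number of
steps (`RAM.Run.simulate`). `RAM.Spec` is a program logic with running times, in which a loop is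
treated by an invariant that bounds the time which is left. The explicit constants in the time
bounds are not optimal.
-/

/-! ### Outcomes of a vertex -/

/-- The number of occurrences of `w` among the first `t` terms of the sequence `h`. -/
def visits {V : Type*} [DecidableEq V] (h : ℕ → V) (w : V) (t : ℕ) : ℕ :=
  Nat.count (fun j => h j = w) t

section Visits

variable {V : Type*} [DecidableEq V] (h : ℕ → V) (w : V)

@[simp] theorem visits_zero : visits h w 0 = 0 := Nat.count_zero _

theorem visits_succ (t : ℕ) : visits h w (t + 1) = visits h w t + if h t = w then 1 else 0 :=
  Nat.count_succ _ _

theorem visits_mono {s t : ℕ} (hst : s ≤ t) : visits h w s ≤ visits h w t :=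
  Nat.count_monotone _ hst

theorem visits_add (s t : ℕ) :
    visits h w (s + t) = visits h w s + visits (fun j => h (s + j)) w t :=
  Nat.count_add _ _ _

variable {h}

theorem visits_add_period {d : ℕ} (hd : ∀ j, h (j + d) = h j) (t : ℕ) :
    visits h w (t + d) = visits h w t + visits h w d := by
  rw [add_comm t d, visits_add, add_comm]
  congr 1
  unfold visits
  congr 1
  funext j
  show (h (d + j) = w) = (h j = w)
  rw [add_comm d j, hd]

theorem visits_add_mul_period {d : ℕ} (hd : ∀ j, h (j + d) = h j) (t q : ℕ) :
    visits h w (t + q * d) = visits h w t + q * visits h w d := by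
  induction q with
  | zero => simp
  | succ q ih => rw [Nat.succ_mul, ← add_assoc, visits_add_period w hd, ih, Nat.succ_mul, add_assoc]

end Visits

/-- The outcome of the rotor walk in a subtree that is entered several times through an arc
`(u, v)`: the particle is captured by a sink in the subtree during the `flow`-th visit, and `win`
tells whether this sink is won by MAX.  A subtree that never captures the particle has flow `0`. -/
@[ext] structure Outcome where
  win : Bool
  flow : ℕ

namespace Outcome

/-- The particle is captured during one of the first `t` visits, and this is a win for MAX if
`β = true` and a win for MIN if `β = false`. -/
def WinBy (β : Bool) (x : Outcome) (t : ℕ) : Prop := x.win = β ∧ 0 < x.flow ∧ x.flow ≤ t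

/-- The preference of MAX (`β = true`) or MIN (`β = false`): to win quickly is best, to lose
quickly is worst, and a subtree without capture lies in between, since `1 / 0 = 0`. -/
def score (β : Bool) (x : Outcome) : ℚ :=
  if x.win = β then 1 / (x.flow : ℚ) else -(1 / (x.flow : ℚ))

theorem score_not (β : Bool) (x : Outcome) : score (!β) x = -score β x := by
  unfold score
  cases x.win <;> cases β <;> simp

theorem one_div_le_one_div_iff_nat {a b : ℕ} (ha : 0 < a) :
    1 / (a : ℚ) ≤ 1 / (b : ℚ) ↔ 0 < b ∧ b ≤ a := by
  rcases Nat.eq_zero_or_pos b with rfl | hb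
  · simp [ha.ne']
  · rw [one_div_le_one_div (by exact_mod_cast ha) (by exact_mod_cast hb)]
    simp [hb]

/-- A better score amounts to winning within every number of visits within which the other
outcome wins, and to losing only within numbers of visits within which the other one loses. -/
theorem score_le_iff {β : Bool} {x y : Outcome} : score β x ≤ score β y ↔
    (∀ t, WinBy β x t → WinBy β y t) ∧ (∀ t, WinBy (!β) y t → WinBy (!β) x t) := by
  have hx0 : 0 ≤ 1 / (x.flow : ℚ) := by positivity
  have hy0 : 0 ≤ 1 / (y.flow : ℚ) := by positivity
  have hpos : ∀ z : Outcome, 0 < z.flow → 0 < 1 / (z.flow : ℚ) := fun z hz => by positivity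
  have hz : ∀ z : Outcome, z.flow = 0 → 1 / (z.flow : ℚ) = 0 := fun z hz => by simp [hz]
  unfold score
  by_cases hx : x.win = β <;> by_cases hy : y.win = β
  · rw [if_pos hx, if_pos hy]
    have h2 : ∀ t, WinBy (!β) y t → WinBy (!β) x t := fun t ht => by
      have := ht.1
      simp [hy] at this
    rcases Nat.eq_zero_or_pos x.flow with h0 | h0
    · rw [hz x h0]
      refine ⟨fun _ => ⟨fun t ht => absurd ht.2.1 (by omega), h2⟩, fun _ => hy0⟩
    · rw [one_div_le_one_div_iff_nat h0]
      refine ⟨fun h => ⟨fun t ht => ⟨hy, h.1, h.2.trans ht.2.2⟩, h2⟩, fun h => ?_⟩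
      exact (h.1 x.flow ⟨hx, h0, le_rfl⟩).2
  · rw [if_pos hx, if_neg hy]
    have hy' : y.win = !β := by cases h : y.win <;> cases h' : β <;> simp_all
    constructor
    · intro h
      have h1 : x.flow = 0 := by
        by_contra hne
        have := hpos x (by omega)
        linarith
      have h2 : y.flow = 0 := by
        by_contra hne
        have := hpos y (by omega)
        linarith
      exact ⟨fun t ht => absurd ht.2.1 (by omega), fun t ht => absurd ht.2.1 (by omega)⟩
    · rintro ⟨h1, h2⟩
      have h1 : x.flow = 0 := by
        by_contra hne
        exact hy (h1 x.flow ⟨hx, by omega, le_rfl⟩).1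
      have h2 : y.flow = 0 := by
        by_contra hne
        have := (h2 y.flow ⟨hy', by omega, le_rfl⟩).1
        simp [hx] at this
      rw [hz x h1, hz y h2]
      simp
  · rw [if_neg hx, if_pos hy]
    refine ⟨fun _ => ⟨fun t ht => absurd ht.1 hx, fun t ht => ?_⟩, fun _ => by linarith⟩
    have := ht.1
    simp [hy] at this
  · rw [if_neg hx, if_neg hy, neg_le_neg_iff]
    have hx' : x.win = !β := by cases h : x.win <;> cases h' : β <;> simp_all
    have hy' : y.win = !β := by cases h : y.win <;> cases h' : β <;> simp_all
    have h2 : ∀ t, WinBy β x t → WinBy β y t := fun t ht => absurd ht.1 hx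
    rcases Nat.eq_zero_or_pos y.flow with h0 | h0
    · rw [hz y h0]
      refine ⟨fun _ => ⟨h2, fun t ht => absurd ht.2.1 (by omega)⟩, fun _ => hx0⟩
    · rw [one_div_le_one_div_iff_nat h0]
      refine ⟨fun h => ⟨h2, fun t ht => ⟨hx', h.1, h.2.trans ht.2.2⟩⟩, fun h => ?_⟩
      exact (h.2 y.flow ⟨hy', h0, le_rfl⟩).2

theorem eq_of_score_eq {β : Bool} {x y : Outcome} (h : score β x = score β y) (hx : 0 < x.flow) :
    x = y := by
  have h1 := score_le_iff.1 h.le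
  have h2 := score_le_iff.1 h.ge
  by_cases hb : x.win = β
  · have h3 := h1.1 x.flow ⟨hb, hx, le_rfl⟩
    have h4 := h2.1 y.flow ⟨h3.1, h3.2.1, le_rfl⟩
    exact Outcome.ext (by rw [hb, h3.1]) (le_antisymm h4.2.2 h3.2.2)
  · have hb : x.win = !β := by cases h : x.win <;> cases h' : β <;> simp_all
    have h3 := h2.2 x.flow ⟨hb, hx, le_rfl⟩
    have h4 := h1.2 y.flow ⟨h3.1, h3.2.1, le_rfl⟩
    exact Outcome.ext (by rw [hb, h3.1]) (le_antisymm h4.2.2 h3.2.2)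

end Outcome

section NodeOutcome

variable {V : Type*} [DecidableEq V]

/-- `h` is the sequence of vertices to which the particle is sent by the successive departures
from a vertex with parent `u`; after `t` departures, some child has received the particle
often enough to keep it, given the outcomes `X` of the children. -/
def Captured (u : V) (h : ℕ → V) (X : V → Outcome) (t : ℕ) : Prop :=
  ∃ w, w ≠ u ∧ 0 < (X w).flow ∧ (X w).flow ≤ visits h w t

variable {u : V} {h : ℕ → V} {X X' : V → Outcome}

theorem not_captured_zero : ¬ Captured u h X 0 := by
  rintro ⟨w, -, h1, h2⟩
  rw [visits_zero] at h2
  omega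

theorem Captured.mono {s t : ℕ} (hst : s ≤ t) (hs : Captured u h X s) : Captured u h X t := by
  obtain ⟨w, h1, h2, h3⟩ := hs
  exact ⟨w, h1, h2, h3.trans (visits_mono h w hst)⟩

/-- The child that captures the particle is the one to which the last departure leads. -/
theorem eq_of_first_capture {t : ℕ} (h0 : ¬ Captured u h X t) {w : V} (hw : w ≠ u)
    (hf : 0 < (X w).flow) (h1 : (X w).flow ≤ visits h w (t + 1)) :
    h t = w ∧ (X w).flow = visits h w t + 1 := by
  have h2 : ¬ (X w).flow ≤ visits h w t := fun h2 => h0 ⟨w, hw, hf, h2⟩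
  rw [visits_succ] at h1
  split_ifs at h1 with h3
  · exact ⟨h3, by omega⟩
  · omega

open Classical in
/-- The outcome of a vertex with parent `u` from the outcomes `X` of its children, if the
successive departures lead to the vertices `h 0`, `h 1`, …: the number of visits is one more than
the number of times that the particle goes back to `u` before some child captures it. -/
noncomputable def nodeOutcome (u : V) (h : ℕ → V) (X : V → Outcome) : Outcome :=
  if H : ∃ t, Captured u h X t then
    ⟨(X (h (Nat.find H - 1))).win, visits h u (Nat.find H) + 1⟩
  else ⟨false, 0⟩

theorem nodeOutcome_of_first {t : ℕ} (h0 : ¬ Captured u h X t) (h1 : Captured u h X (t + 1)) :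
    nodeOutcome u h X = ⟨(X (h t)).win, visits h u (t + 1) + 1⟩ := by
  classical
  have H : ∃ t, Captured u h X t := ⟨_, h1⟩
  have hf : Nat.find H = t + 1 := by
    rw [Nat.find_eq_iff]
    exact ⟨h1, fun n hn hc => h0 (hc.mono (by omega))⟩
  unfold nodeOutcome
  rw [dif_pos H, hf]
  rfl

theorem nodeOutcome_of_not (H : ¬ ∃ t, Captured u h X t) : nodeOutcome u h X = ⟨false, 0⟩ := by
  classical
  unfold nodeOutcome
  rw [dif_neg H]

theorem exists_first_capture {s : ℕ} (hs : Captured u h X s) :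
    ∃ t, t < s ∧ ¬ Captured u h X t ∧ Captured u h X (t + 1) := by
  classical
  have H : ∃ t, Captured u h X t := ⟨_, hs⟩
  have h1 : Nat.find H ≠ 0 := fun h => not_captured_zero (h ▸ Nat.find_spec H)
  refine ⟨Nat.find H - 1, ?_, Nat.find_min H (by omega), ?_⟩
  · have := Nat.find_min' H hs
    omega
  · rw [Nat.sub_add_cancel (by omega)]
    exact Nat.find_spec H

/-- Improving the outcomes of the children for one player improves the outcome of the vertex. The
first capture cannot become later if a child won by this player captures earlier; and a child that
was lost cannot capture earlier than before. -/
theorem winBy_nodeOutcome_mono {β : Bool}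
    (h1 : ∀ j, h j ≠ u → ∀ t, (X (h j)).WinBy β t → (X' (h j)).WinBy β t)
    (h2 : ∀ j, h j ≠ u → ∀ t, (X' (h j)).WinBy (!β) t → (X (h j)).WinBy (!β) t) {t : ℕ}
    (ht : (nodeOutcome u h X).WinBy β t) : (nodeOutcome u h X').WinBy β t := by
  by_cases H : ∃ t, Captured u h X t
  swap
  · rw [nodeOutcome_of_not H] at ht
    exact absurd ht.2.1 (lt_irrefl 0)
  obtain ⟨s, hs⟩ := H
  obtain ⟨T, -, hT0, hT1⟩ := exists_first_capture hs
  rw [nodeOutcome_of_first hT0 hT1] at ht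
  obtain ⟨w, hwu, hw0, hw1⟩ := hT1
  obtain ⟨hw, hw2⟩ := eq_of_first_capture hT0 hwu hw0 hw1
  subst hw
  -- With `X'`, the particle is captured by the departure `T` at the latest.
  have hX := h1 T hwu (visits h (h T) (T + 1)) ⟨ht.1, hw0, hw1⟩
  have hc : Captured u h X' (T + 1) := ⟨h T, hwu, hX.2.1, hX.2.2⟩
  obtain ⟨T', hT', hT0', hT1'⟩ := exists_first_capture hc
  rw [nodeOutcome_of_first hT0' hT1']
  obtain ⟨w', hwu', hw0', hw1'⟩ := hT1'
  obtain ⟨hw', hw2'⟩ := eq_of_first_capture hT0' hwu' hw0' hw1'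
  subst hw'
  refine ⟨?_, Nat.succ_pos _, ?_⟩
  · by_contra hne
    have hb : (X' (h T')).win = !β := by
      cases h : (X' (h T')).win <;> cases h' : β <;> simp_all
    have hY := h2 T' hwu' (visits h (h T') (T' + 1)) ⟨hb, hw0', hw1'⟩
    -- A loss by the departure `T'` would also be one with `X`, whence `T' = T`, which is a win.
    have hTT : T' = T := by
      by_contra hne
      exact hT0 (Captured.mono (s := T' + 1) (by omega) ⟨h T', hwu', hY.2.1, hY.2.2⟩)
    subst hTT
    have := hY.1
    rw [ht.1] at this
    simp at this
  · have h3 : visits h u (T' + 1) ≤ visits h u (T + 1) := visits_mono h u (by omega)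
    have h4 : visits h u (T + 1) + 1 ≤ t := ht.2.2
    show visits h u (T' + 1) + 1 ≤ t
    omega

theorem score_nodeOutcome_mono {β : Bool}
    (hX : ∀ j, h j ≠ u → (X (h j)).score β ≤ (X' (h j)).score β) :
    (nodeOutcome u h X).score β ≤ (nodeOutcome u h X').score β := by
  rw [Outcome.score_le_iff]
  refine ⟨fun t => winBy_nodeOutcome_mono (fun j hj => (Outcome.score_le_iff.1 (hX j hj)).1)
    fun j hj => (Outcome.score_le_iff.1 (hX j hj)).2, fun t => ?_⟩
  refine winBy_nodeOutcome_mono (fun j hj => (Outcome.score_le_iff.1 (hX j hj)).2) ?_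
  simpa using fun j hj => (Outcome.score_le_iff.1 (hX j hj)).1

theorem nodeOutcome_congr (hX : ∀ j, h j ≠ u → X (h j) = X' (h j)) :
    nodeOutcome u h X = nodeOutcome u h X' := by
  have hc : ∀ t, Captured u h X t ↔ Captured u h X' t := by
    intro t
    have key : ∀ w, w ≠ u → 0 < visits h w t → X w = X' w := by
      intro w hw hv
      obtain ⟨j, -, hj⟩ := Nat.count_ne_iff_exists.1 hv.ne'
      rw [← hj] at hw ⊢
      exact hX j hw
    constructor <;> rintro ⟨w, h1, h2, h3⟩ <;> have := key w h1 (by omega)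
    · exact ⟨w, h1, by rwa [← this], by rwa [← this]⟩
    · exact ⟨w, h1, by rwa [this], by rwa [this]⟩
  by_cases H : ∃ t, Captured u h X t
  · obtain ⟨s, hs⟩ := H
    obtain ⟨T, -, hT0, hT1⟩ := exists_first_capture hs
    rw [nodeOutcome_of_first hT0 hT1, nodeOutcome_of_first ((hc _).not.1 hT0) ((hc _).1 hT1)]
    obtain ⟨w, h1, h2, h3⟩ := hT1
    obtain ⟨h4, -⟩ := eq_of_first_capture hT0 h1 h2 h3
    rw [hX T (h4 ▸ h1)]
  · rw [nodeOutcome_of_not H, nodeOutcome_of_not (by simpa only [hc] using H)]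

end NodeOutcome

/-! ### Rotors and rooted trees -/

namespace RotorGraph

variable {V A : Type*}

section Rotors

variable (G : RotorGraph V A)

/-- The vertices to which the successive departures from the tail of `a` lead, if its rotor starts
at `a`. -/
def heads (a : A) (j : ℕ) : V := G.head (G.next^[j] a)

/-- The number of arcs leaving `v`. -/
noncomputable def outDegree (v : V) : ℕ := {a | G.tail a = v}.ncard

variable {G}

theorem tail_iterate {a : A} (ha : G.tail a ∉ G.sinks) (j : ℕ) :
    G.tail (G.next^[j] a) = G.tail a := by
  induction j with
  | zero => rfl
  | succ j ih => rw [Function.iterate_succ_apply', G.tail_next _ (by rwa [ih]), ih]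

theorem hasArc_heads {a : A} (ha : G.tail a ∉ G.sinks) (j : ℕ) :
    G.HasArc (G.tail a) (G.heads a j) :=
  ⟨_, tail_iterate ha j, rfl⟩

/-- The arcs that leave a vertex form a single cycle of the rotor order. -/
theorem minimalPeriod_next [Finite A] {a : A} (ha : G.tail a ∉ G.sinks) :
    Function.minimalPeriod G.next a = G.outDegree (G.tail a) := by
  have h1 : a ∈ Function.periodicPts G.next := by
    obtain ⟨k, hk⟩ := G.next_orbit (G.next a) a (by rwa [G.tail_next a ha]) (G.tail_next a ha).symm
    exact ⟨k + 1, k.succ_pos, hk⟩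
  have hp := Function.minimalPeriod_pos_of_mem_periodicPts h1
  have h2 : {b | G.tail b = G.tail a} =
      (fun j => G.next^[j] a) '' Set.Iio (Function.minimalPeriod G.next a) := by
    ext b
    constructor
    · intro hb
      obtain ⟨k, hk⟩ := G.next_orbit a b ha hb
      refine ⟨k % Function.minimalPeriod G.next a, Nat.mod_lt _ hp, ?_⟩
      show G.next^[k % Function.minimalPeriod G.next a] a = b
      rw [Function.iterate_mod_minimalPeriod_eq, hk]
    · rintro ⟨j, -, rfl⟩
      exact tail_iterate ha j
  unfold outDegree
  rw [h2, Function.iterate_injOn_Iio_minimalPeriod.ncard_image]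
  rw [Set.ncard_eq_toFinset_card', Set.toFinset_Iio, Nat.card_Iio]

theorem iterate_outDegree [Finite A] {a : A} (ha : G.tail a ∉ G.sinks) :
    G.next^[G.outDegree (G.tail a)] a = a := by
  rw [← minimalPeriod_next ha, Function.iterate_minimalPeriod]

theorem outDegree_pos [Finite A] (a : A) : 0 < G.outDegree (G.tail a) :=
  (Set.ncard_pos (Set.toFinite _)).2 ⟨a, rfl⟩

theorem exists_iterate_eq [Finite A] {a b : A} (ha : G.tail a ∉ G.sinks)
    (hb : G.tail b = G.tail a) : ∃ j < G.outDegree (G.tail a), G.next^[j] a = b := by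
  obtain ⟨k, hk⟩ := G.next_orbit a b ha hb
  refine ⟨k % G.outDegree (G.tail a), Nat.mod_lt _ (outDegree_pos a), ?_⟩
  rw [← minimalPeriod_next ha, Function.iterate_mod_minimalPeriod_eq, hk]

theorem heads_add_outDegree [Finite A] {a : A} (ha : G.tail a ∉ G.sinks) (j : ℕ) :
    G.heads a (j + G.outDegree (G.tail a)) = G.heads a j := by
  unfold heads
  rw [Function.iterate_add_apply, iterate_outDegree ha]

theorem heads_iterate (a : A) (s j : ℕ) : G.heads (G.next^[s] a) j = G.heads a (s + j) := by
  unfold heads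
  rw [add_comm, Function.iterate_add_apply]

end Rotors

/-- The underlying tree is rooted at `root`: `par` maps the other vertices to their parents. -/
structure Rooted (G : RotorGraph V A) (root : V) (par : V → V) (depth : V → ℕ) : Prop where
  par_root : par root = root
  adj_par : ∀ v, v ≠ root → G.underlying.Adj v (par v)
  depth_par : ∀ v, v ≠ root → depth v = depth (par v) + 1
  depth_root : depth root = 0
  par_or : ∀ x y, G.underlying.Adj x y → (x ≠ root ∧ par x = y) ∨ (y ≠ root ∧ par y = x)

theorem exists_rooted (G : RotorGraph V A) (hG : G.underlying.IsTree) (root : V) :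
    ∃ par depth, G.Rooted root par depth := by
  classical
  have hpath : ∀ v, ∃ p : G.underlying.Walk root v, p.IsPath ∧ p.length = G.underlying.dist root v :=
    fun v => (hG.connected root v).exists_path_of_dist
  choose p hp hl using hpath
  have hpar : ∀ x y, G.underlying.Adj x y →
      G.underlying.dist root y = G.underlying.dist root x + 1 → (p y).penultimate = x := by
    intro x y hxy hd
    have hy : y ∉ (p x).support := by
      intro hy
      have h1 := SimpleGraph.dist_le ((p x).takeUntil y hy)
      have h2 := (p x).length_takeUntil_le_length hy
      have := hl x
      omega
    have := hG.isAcyclic.subsingleton_path root y |>.elim ⟨p y, hp y⟩ ⟨_, (hp x).concat hy hxy⟩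
    rw [Subtype.mk.inj this, SimpleGraph.Walk.penultimate_concat]
  have hnil : ∀ v, v ≠ root → ¬ (p v).Nil := fun v hv hn => hv hn.eq.symm
  have hadj : ∀ v, v ≠ root → G.underlying.Adj v (p v).penultimate := fun v hv =>
    ((p v).adj_penultimate (hnil v hv)).symm
  refine ⟨fun v => if v = root then root else (p v).penultimate, G.underlying.dist root,
    if_pos rfl, fun v hv => ?_, fun v hv => ?_, SimpleGraph.dist_self, fun x y hxy => ?_⟩
  · simp only [if_neg hv]
    exact hadj v hv
  · simp only [if_neg hv]
    rcases hG.dist_eq_dist_add_one_of_adj root (hadj v hv) with h | h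
    · exact h
    · have h1 := hl v
      have h2 := SimpleGraph.dist_le (p v).dropLast
      rw [SimpleGraph.Walk.length_dropLast] at h2
      omega
  · rcases hG.dist_eq_dist_add_one_of_adj root hxy with h | h
    · have hx : x ≠ root := by
        rintro rfl
        rw [SimpleGraph.dist_self] at h
        omega
      exact Or.inl ⟨hx, by simp only [if_neg hx]; exact hpar y x hxy.symm h⟩
    · have hy : y ≠ root := by
        rintro rfl
        rw [SimpleGraph.dist_self] at h
        omega
      exact Or.inr ⟨hy, by simp only [if_neg hy]; exact hpar x y hxy h⟩

namespace Rooted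

variable {G : RotorGraph V A} {root : V} {par : V → V} {depth : V → ℕ}

/-- `x` is a descendant of `v`. -/
def Below (par : V → V) (v x : V) : Prop := ∃ j, par^[j] x = v

theorem below_self (v : V) : Below par v v := ⟨0, rfl⟩

theorem below_of_par {v x : V} (h : Below par v (par x)) : Below par v x := by
  obtain ⟨j, hj⟩ := h
  exact ⟨j + 1, hj⟩

theorem below_iff {v x : V} : Below par v x ↔ x = v ∨ Below par v (par x) := by
  constructor
  · rintro ⟨j | j, hj⟩
    · exact Or.inl hj
    · exact Or.inr ⟨j, hj⟩
  · rintro (rfl | h)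
    · exact below_self _
    · exact below_of_par h

theorem below_trans {v w x : V} (h1 : Below par v w) (h2 : Below par w x) : Below par v x := by
  obtain ⟨i, rfl⟩ := h1
  obtain ⟨j, rfl⟩ := h2
  exact ⟨i + j, Function.iterate_add_apply _ _ _ _⟩

theorem below_child {v x : V} (h : Below par v x) (hx : x ≠ v) :
    ∃ w, par w = v ∧ w ≠ v ∧ Below par w x := by
  obtain ⟨j, hj⟩ := h
  induction j generalizing x with
  | zero => exact absurd hj hx
  | succ j ih =>
    by_cases hp : par x = v
    · exact ⟨x, hp, hx, below_self _⟩
    · obtain ⟨w, h1, h2, h3⟩ := ih hp hj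
      exact ⟨w, h1, h2, below_of_par h3⟩

/-- Values at the vertices of a rooted tree can be defined from the values at their children. -/
theorem exists_recursive {α : Type*} [Finite V] [Inhabited α] (Φ : V → (V → α) → α)
    (depth : V → ℕ) (hΦ : ∀ v X X', (∀ w, depth w = depth v + 1 → X w = X' w) → Φ v X = Φ v X') :
    ∃ X : V → α, ∀ v, X v = Φ v X := by
  obtain ⟨N, hN⟩ : ∃ N, ∀ v, depth v ≤ N := by
    obtain ⟨N, hN⟩ := (Set.finite_range depth).bddAbove
    exact ⟨N, fun v => hN ⟨v, rfl⟩⟩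
  have key : ∀ k, ∃ X : V → α, ∀ v, N < depth v + k → X v = Φ v X := by
    intro k
    induction k with
    | zero => exact ⟨default, fun v hv => absurd (hN v) (by omega)⟩
    | succ k ih =>
      classical
      obtain ⟨X, hX⟩ := ih
      refine ⟨fun v => if N < depth v + k then X v else Φ v X, fun v hv => ?_⟩
      dsimp only
      have h1 : Φ v X = Φ v (fun v => if N < depth v + k then X v else Φ v X) :=
        hΦ _ _ _ fun w hw => by rw [if_pos (by omega)]
      by_cases h : N < depth v + k
      · rw [if_pos h, hX v h]
        exact h1
      · rw [if_neg h]
        exact h1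
  obtain ⟨X, hX⟩ := key (N + 1)
  exact ⟨X, fun v => hX v (by omega)⟩

variable (hR : G.Rooted root par depth)
include hR

theorem depth_le_of_below {v x : V} (h : Below par v x) : depth v ≤ depth x := by
  obtain ⟨j, rfl⟩ := h
  induction j with
  | zero => exact le_rfl
  | succ j ih =>
    rw [Function.iterate_succ_apply']
    refine le_trans ?_ ih
    by_cases hr : par^[j] x = root
    · rw [hr, hR.par_root]
    · rw [hR.depth_par _ hr]
      omega

theorem below_root (x : V) : Below par root x := by
  induction hd : depth x generalizing x with
  | zero =>
    by_cases hx : x = root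
    · exact hx ▸ below_self _
    · have := hR.depth_par x hx
      omega
  | succ d ih =>
    by_cases hx : x = root
    · exact hx ▸ below_self _
    · have := hR.depth_par x hx
      exact below_of_par (ih _ (by omega))

theorem not_below_par {v : V} (hv : v ≠ root) : ¬ Below par v (par v) := fun h => by
  have h1 := hR.depth_le_of_below h
  have h2 := hR.depth_par v hv
  omega

theorem par_ne {v : V} (hv : v ≠ root) : par v ≠ v := fun h =>
  hR.not_below_par hv (by rw [h]; exact below_self _)

/-- The head of an arc is the parent or a child of its tail. -/
theorem child_of_hasArc {v w : V} (h : G.HasArc v w) (hw : w ≠ par v) : w ≠ root ∧ par w = v := by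
  rcases hR.par_or v w (Or.inl h) with h1 | h1
  · exact absurd h1.2.symm hw
  · exact h1

theorem depth_child {v w : V} (h : G.HasArc v w) (hw : w ≠ par v) : depth w = depth v + 1 := by
  obtain ⟨h1, h2⟩ := hR.child_of_hasArc h hw
  rw [hR.depth_par w h1, h2]

/-- An edge of the tree that enters the set of descendants of `v` leads from the parent of
`v` to `v`. -/
theorem eq_of_enters {v x y : V} (hxy : G.underlying.Adj x y) (hx : ¬ Below par v x)
    (hy : Below par v y) : y = v ∧ x = par v := by
  rcases hR.par_or x y hxy with h | h
  · exact absurd (below_of_par (h.2.symm ▸ hy)) hx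
  · rcases below_iff.1 hy with h1 | h1
    · exact ⟨h1, by rw [← h1, h.2]⟩
    · exact absurd (h.2 ▸ h1) hx

end Rooted

end RotorGraph

/-! ### Traces of rotor walks -/

namespace RotorGraph

variable {V A : Type*} [DecidableEq V]

/-- The sequence of vertices `x` leaves `w` as prescribed by `D w`: the `j`-th departure from
`w` leads to `D w j`. -/
def FollowsAt (D : V → ℕ → V) (x : ℕ → V) (w : V) : Prop :=
  ∀ k, x k = w → x (k + 1) = D w (visits x w k)

/-- The number of moves from `v` to `y` before time `k`. -/
def moves (x : ℕ → V) (v y : V) (k : ℕ) : ℕ := Nat.count (fun i => x i = v ∧ x (i + 1) = y) k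

/-- The sequence `x` stops at sinks, and follows arcs elsewhere. -/
def IsTrace (G : RotorGraph V A) (x : ℕ → V) : Prop :=
  ∀ k, (x k ∈ G.sinks ∧ x (k + 1) = x k) ∨ (x k ∉ G.sinks ∧ G.HasArc (x k) (x (k + 1)))

@[simp] theorem moves_zero (x : ℕ → V) (v y : V) : moves x v y 0 = 0 := Nat.count_zero _

theorem moves_succ (x : ℕ → V) (v y : V) (k : ℕ) :
    moves x v y (k + 1) = moves x v y k + if x k = v ∧ x (k + 1) = y then 1 else 0 :=
  Nat.count_succ _ _

theorem moves_eq_visits {D : V → ℕ → V} {x : ℕ → V} {v : V} (h : FollowsAt D x v) (y : V) (k : ℕ) :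
    moves x v y k = visits (D v) y (visits x v k) := by
  induction k with
  | zero => simp
  | succ k ih =>
    rw [moves_succ, ih, visits_succ x]
    by_cases hk : x k = v
    · rw [if_pos hk, visits_succ, ← h k hk]
      simp [hk]
    · simp [hk]

theorem exists_visit {x : ℕ → V} {v : V} {k n : ℕ} (h : visits x v k = n + 1) :
    ∃ i, x i = v ∧ visits x v i = n := by
  induction k with
  | zero => simp at h
  | succ k ih =>
    rw [visits_succ] at h
    split_ifs at h with hk
    · exact ⟨k, hk, by omega⟩
    · exact ih (by omega)

section Tree

variable {G : RotorGraph V A} {root : V} {par : V → V} {depth : V → ℕ}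
  (hR : G.Rooted root par depth) {x : ℕ → V} (hx : G.IsTrace x)
include hR hx

open Rooted

open Classical in
/-- A particle that starts outside of the subtree of `v` enters it as often as it leaves it,
plus one time if it currently is in this subtree. -/
theorem moves_par_eq {v : V} (hv : v ≠ root) (h0 : ¬ Below par v (x 0)) (k : ℕ) :
    moves x (par v) v k = moves x v (par v) k + if Below par v (x k) then 1 else 0 := by
  induction k with
  | zero => simp [h0]
  | succ k ih =>
    rw [moves_succ, moves_succ, ih]
    have hpv := hR.par_ne hv
    have hvv : Below par v v := below_self v
    have hpp := hR.not_below_par hv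
    rcases hx k with ⟨-, h1⟩ | ⟨-, h1⟩
    · rw [h1]
      have h2 : ¬ (x k = par v ∧ x k = v) := fun h => hpv (h.1.symm.trans h.2)
      have h3 : ¬ (x k = v ∧ x k = par v) := fun h => hpv (h.2.symm.trans h.1)
      simp [h2, h3]
    · by_cases hb : Below par v (x k) <;> by_cases hb' : Below par v (x (k + 1))
      · have h2 : x k ≠ par v := fun h => hpp (h ▸ hb)
        have h3 : x (k + 1) ≠ par v := fun h => hpp (h ▸ hb')
        simp [hb, hb', h2, h3]
      · obtain ⟨h2, h3⟩ := hR.eq_of_enters (Or.inr h1) hb' hb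
        have h4 : x k ≠ par v := fun h => hpp (h ▸ hb)
        simp [h2, h3, hpp, hvv, hpv.symm]
      · obtain ⟨h2, h3⟩ := hR.eq_of_enters (Or.inl h1) hb hb'
        simp [h2, h3, hpp, hvv, hpv]
      · have h2 : x k ≠ v := fun h => hb (h ▸ hvv)
        have h3 : x (k + 1) ≠ v := fun h => hb' (h ▸ hvv)
        simp [hb, hb', h2, h3]

/-- The data that are claimed of a subtree: the particle comes back from it less often than its
flow, and if it is captured there, then during the visit whose number is the flow. -/
def SubtreeCorrect (par : V → V) (sinks : Set V) (x : ℕ → V) (c : V → Bool) (Y : V → Outcome)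
    (v : V) : Prop :=
  ∀ k, (0 < (Y v).flow → moves x v (par v) k < (Y v).flow) ∧
    (x k ∈ sinks → Below par v (x k) →
      0 < (Y v).flow ∧ moves x (par v) v k = (Y v).flow ∧ (Y v).win = c (x k))

variable {D : V → ℕ → V} {c : V → Bool} {Y : V → Outcome} {v : V}
  (hD : ∀ j, G.HasArc v (D v j)) (hf : FollowsAt D x v)
  (h0 : ∀ w, w ≠ root → par w = v → ¬ Below par w (x 0))
  (hc : ∀ w, w ≠ root → par w = v → SubtreeCorrect par G.sinks x c Y w)
include hD hf h0 hc

/-- The rotor of `v` has not led the particle into a capturing subtree as long as the particle comes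
back to `v`. -/
theorem not_captured_of_visit {k : ℕ} (hk : x k = v) :
    ¬ Captured (par v) (D v) Y (visits x v k) := by
  rintro ⟨w, hw, hw0, hw1⟩
  have hpos : 0 < visits (D v) w (visits x v k) := by omega
  obtain ⟨j, -, hj⟩ := Nat.count_ne_iff_exists.1 hpos.ne'
  obtain ⟨hwr, hwv⟩ := hR.child_of_hasArc (hD j) (hj ▸ hw)
  rw [hj] at hwr hwv
  have hm := moves_par_eq hR hx hwr (h0 w hwr hwv) k
  rw [← moves_eq_visits hf] at hw1
  have hb : ¬ Below par w (x k) := by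
    rw [hk, ← hwv]
    exact hR.not_below_par hwr
  rw [if_neg hb, hwv] at hm
  have := (hc w hwr hwv k).1 hw0
  rw [hwv] at this
  omega

theorem not_captured_of_visits_eq {k n : ℕ} (hn : visits x v k = n + 1) :
    ¬ Captured (par v) (D v) Y n := by
  obtain ⟨i, hi, hi'⟩ := exists_visit hn
  rw [← hi']
  exact not_captured_of_visit hR hx hD hf h0 hc hi

variable (hv : v ∉ G.sinks)
include hv

/-- If the walk has ended in a sink below `v`, then the child of `v` above this sink is the first
one to capture the particle according to the rotor of `v`. -/
theorem nodeOutcome_of_sink {k : ℕ} (hk : x k ∈ G.sinks) (hb : Below par v (x k)) :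
    nodeOutcome (par v) (D v) Y = ⟨c (x k), moves x v (par v) k + 1⟩ := by
  obtain ⟨w, hwv, hne, hwb⟩ := below_child hb (fun h => hv (h ▸ hk))
  have hwr : w ≠ root := by
    rintro rfl
    rw [hR.par_root] at hwv
    exact hne hwv
  obtain ⟨h1, h2, h3⟩ := (hc w hwr hwv k).2 hk hwb
  have hwp : w ≠ par v := by
    intro h
    have h4 := hR.depth_par w hwr
    rw [hwv] at h4
    by_cases hvr : v = root
    · rw [hvr, hR.par_root] at h
      exact hwr h
    · have h5 := hR.depth_par v hvr
      rw [← h] at h5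
      omega
  rw [hwv, moves_eq_visits hf] at h2
  obtain ⟨n, hn⟩ : ∃ n, visits x v k = n + 1 := by
    refine Nat.exists_eq_succ_of_ne_zero fun h => ?_
    rw [h, visits_zero] at h2
    omega
  have hnc := not_captured_of_visits_eq hR hx hD hf h0 hc hn
  rw [hn] at h2
  obtain ⟨h4, -⟩ := eq_of_first_capture hnc hwp h1 h2.ge
  rw [nodeOutcome_of_first hnc ⟨w, hwp, h1, h2.ge⟩, h4, h3, moves_eq_visits hf, hn]

/-- The induction step from the children of `v` to `v`. -/
theorem subtreeCorrect_of_children (hvr : v ≠ root) (h0v : ¬ Below par v (x 0))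
    (hY : Y v = nodeOutcome (par v) (D v) Y) : SubtreeCorrect par G.sinks x c Y v := by
  intro k
  constructor
  · intro hpos
    by_cases H : ∃ t, Captured (par v) (D v) Y t
    swap
    · rw [hY, nodeOutcome_of_not H] at hpos
      exact absurd hpos (lt_irrefl 0)
    obtain ⟨s, hs⟩ := H
    obtain ⟨T, -, hT0, hT1⟩ := exists_first_capture hs
    rw [hY, nodeOutcome_of_first hT0 hT1, moves_eq_visits hf]
    show _ < visits (D v) (par v) (T + 1) + 1
    have h1 : visits x v k ≤ T + 1 := by
      by_contra hlt
      obtain ⟨n, hn⟩ : ∃ n, visits x v k = n + 1 := Nat.exists_eq_succ_of_ne_zero (by omega)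
      exact not_captured_of_visits_eq hR hx hD hf h0 hc hn (hT1.mono (by omega))
    have := visits_mono (D v) (par v) h1
    omega
  · intro hk hb
    have h1 := nodeOutcome_of_sink hR hx hD hf h0 hc hv hk hb
    have h2 := moves_par_eq hR hx hvr h0v k
    rw [if_pos hb] at h2
    rw [hY, h1]
    exact ⟨Nat.succ_pos _, h2, rfl⟩

end Tree

section Tree

variable {G : RotorGraph V A} {root : V} {par : V → V} {depth : V → ℕ}
  (hR : G.Rooted root par depth)
include hR

open Rooted

omit [DecidableEq V] in
theorem Rooted.not_child_of_sink [Finite V]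
    (hleaf : ∀ s ∈ G.sinks, (G.underlying.neighborSet s).ncard = 1) {s w : V} (hs : s ∈ G.sinks)
    (hsr : s ≠ root) (hw : w ≠ root) : par w ≠ s := by
  intro h
  obtain ⟨y, hy⟩ := Set.ncard_eq_one.1 (hleaf s hs)
  have h1 : w ∈ G.underlying.neighborSet s := by
    have := hR.adj_par w hw
    rw [h] at this
    exact this.symm
  have h2 : par s ∈ G.underlying.neighborSet s := hR.adj_par s hsr
  rw [hy, Set.mem_singleton_iff] at h1 h2
  have h3 := hR.depth_par w hw
  have h4 := hR.depth_par s hsr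
  rw [h] at h3
  rw [h2, ← h1] at h4
  omega

/-- The system of equations for the outcomes of all vertices if the departures are given by `D` and
`c` tells which sinks are won by MAX. -/
def Solves (G : RotorGraph V A) (par : V → V) (D : V → ℕ → V) (c : V → Bool) (Y : V → Outcome) :
    Prop :=
  ∀ v, (v ∈ G.sinks → Y v = ⟨c v, 1⟩) ∧ (v ∉ G.sinks → Y v = nodeOutcome (par v) (D v) Y)

/-- A solution of the equations describes every walk that starts outside of the subtree of `v` and
follows the rotors in this subtree, by induction from the leaves. -/
theorem subtreeCorrect [Finite V]
    (hleaf : ∀ s ∈ G.sinks, (G.underlying.neighborSet s).ncard = 1)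
    {x : ℕ → V} (hx : G.IsTrace x) {D : V → ℕ → V} (hD : ∀ v ∉ G.sinks, ∀ j, G.HasArc v (D v j))
    {c : V → Bool} {Y : V → Outcome} (hY : G.Solves par D c Y) {v : V} (hvr : v ≠ root)
    (h0 : ¬ Below par v (x 0)) (hf : ∀ w ∉ G.sinks, Below par v w → FollowsAt D x w) :
    SubtreeCorrect par G.sinks x c Y v := by
  obtain ⟨N, hN⟩ : ∃ N, ∀ v, depth v ≤ N := by
    obtain ⟨N, hN⟩ := (Set.finite_range depth).bddAbove
    exact ⟨N, fun v => hN ⟨v, rfl⟩⟩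
  induction hd : N - depth v using Nat.strong_induction_on generalizing v with
  | _ n ih =>
    by_cases hv : v ∈ G.sinks
    · -- a sink is a leaf, and the particle stays there at the first visit
      have hchild : ∀ w, w ≠ root → par w ≠ v := fun w hw => hR.not_child_of_sink hleaf hv hvr hw
      intro k
      have hm : moves x v (par v) k = 0 := by
        refine Nat.count_iff_forall_not.2 fun i _ => ?_
        rintro ⟨h1, h2⟩
        rcases hx i with ⟨-, h⟩ | ⟨h, -⟩
        · exact hR.par_ne hvr (by rw [← h2, h, h1])
        · exact h (h1 ▸ hv)
      rw [(hY v).1 hv, hm]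
      refine ⟨fun h => h, fun hk hb => ⟨Nat.one_pos, ?_, ?_⟩⟩
      · rw [moves_par_eq hR hx hvr h0 k, hm, if_pos hb]
      · have hxv : x k = v := by
          by_contra hne
          obtain ⟨w, hwv, hne', -⟩ := below_child hb hne
          refine hchild w ?_ hwv
          rintro rfl
          exact hne' (hR.par_root.symm.trans hwv)
        show c v = c (x k)
        rw [hxv]
    · have hw0 : ∀ w, w ≠ root → par w = v → ¬ Below par w (x 0) := fun w _ hwv hb =>
        h0 (below_trans (below_of_par (hwv ▸ below_self _)) hb)
      refine subtreeCorrect_of_children hR hx (hD v hv) (hf v hv (below_self v)) hw0 ?_ hv hvr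
        h0 ((hY v).2 hv)
      intro w hw hwv
      have h1 := hR.depth_par w hw
      have h2 := hN w
      rw [hwv] at h1
      exact ih _ (by omega) hw (hw0 w hw hwv)
        (fun y hy hb => hf y hy (below_trans (below_of_par (hwv ▸ below_self _)) hb)) rfl

end Tree

/-- In a stopping graph, a walk that follows its rotors at all vertices that it visits infinitely
often reaches a sink. -/
theorem exists_mem_sinks [Finite V] {G : RotorGraph V A} (hG : G.Stopping) {x : ℕ → V}
    {D : V → ℕ → V} (hD : ∀ v ∉ G.sinks, ∀ w, G.HasArc v w → ∀ n, ∃ j ≥ n, D v j = w)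
    (hf : ∀ v ∉ G.sinks, {k | x k = v}.Infinite → FollowsAt D x v) : ∃ k, x k ∈ G.sinks := by
  obtain ⟨y, hy⟩ : ∃ y, {k | x k = y}.Infinite := by
    obtain ⟨y, hy⟩ := Finite.exists_infinite_fiber x
    exact ⟨y, Set.infinite_coe_iff.1 hy⟩
  obtain ⟨s, hs, hp⟩ := hG y
  -- All heads of the arcs that leave a vertex visited infinitely often are visited infinitely
  -- often.
  induction hp using Relation.ReflTransGen.head_induction_on with
  | refl =>
    obtain ⟨k, hk⟩ := hy.nonempty
    have hk : x k = s := hk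
    exact ⟨k, hk ▸ hs⟩
  | @head v w hvw _ ih =>
    by_cases hv : v ∈ G.sinks
    · obtain ⟨k, hk⟩ := hy.nonempty
      have hk : x k = v := hk
      exact ⟨k, hk ▸ hv⟩
    refine ih (Set.infinite_of_not_bddAbove ?_)
    rintro ⟨B, hB⟩
    obtain ⟨j, hj, hjw⟩ := hD v hv w hvw (visits x v B + 1)
    have h1 : x (Nat.nth (fun k => x k = v) j) = v := Nat.nth_mem_of_infinite hy j
    have h2 : visits x v (Nat.nth (fun k => x k = v) j) = j := Nat.count_nth_of_infinite hy j
    have h3 : x (Nat.nth (fun k => x k = v) j + 1) = w := by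
      rw [hf v hv hy _ h1, h2, hjw]
    have h4 := hB h3
    have h5 := visits_mono x v (show Nat.nth (fun k => x k = v) j ≤ B by omega)
    omega

end RotorGraph

/-! ### Rotor walks and their outcomes -/

namespace RotorGraph

variable {V A : Type*} [DecidableEq V]

open Classical in
/-- The vertices to which the successive departures from `v` lead, if the initial configuration is
`ρ`. -/
noncomputable def departures (G : RotorGraph V A) (ρ : G.Config) (v : V) (j : ℕ) : V :=
  if h : v ∉ G.sinks then G.heads (ρ ⟨v, h⟩).1 j else v

omit [DecidableEq V] in
theorem departures_eq {G : RotorGraph V A} (ρ : G.Config) {v : V} (h : v ∉ G.sinks) :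
    G.departures ρ v = G.heads (ρ ⟨v, h⟩).1 := by
  funext j
  unfold departures
  rw [dif_pos h]

omit [DecidableEq V] in
theorem tail_config {G : RotorGraph V A} (ρ : G.Config) {v : V} (h : v ∉ G.sinks) :
    G.tail (ρ ⟨v, h⟩).1 = v := (ρ ⟨v, h⟩).2

omit [DecidableEq V] in
theorem hasArc_departures {G : RotorGraph V A} (ρ : G.Config) {v : V} (h : v ∉ G.sinks) (j : ℕ) :
    G.HasArc v (G.departures ρ v j) := by
  rw [departures_eq ρ h]
  have := hasArc_heads (G := G) (a := (ρ ⟨v, h⟩).1) (by rwa [tail_config ρ h]) j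
  rwa [tail_config ρ h] at this

omit [DecidableEq V] in
theorem exists_departures_eq [Finite A] {G : RotorGraph V A} (ρ : G.Config) {v w : V}
    (h : v ∉ G.sinks) (hw : G.HasArc v w) (n : ℕ) : ∃ j ≥ n, G.departures ρ v j = w := by
  obtain ⟨b, hb, rfl⟩ := hw
  rw [departures_eq ρ h]
  have ht := tail_config ρ h
  obtain ⟨i, -, hi⟩ := exists_iterate_eq (G := G) (a := (ρ ⟨v, h⟩).1) (by rwa [ht])
    (hb.trans ht.symm)
  have hp := outDegree_pos (G := G) (ρ ⟨v, h⟩).1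
  have hper : ∀ q, G.heads (ρ ⟨v, h⟩).1 (i + q * G.outDegree (G.tail (ρ ⟨v, h⟩).1)) = G.head b := by
    intro q
    induction q with
    | zero => simp [heads, hi]
    | succ q ih => rw [Nat.succ_mul, ← add_assoc, heads_add_outDegree (by rwa [ht]), ih]
  exact ⟨_, le_trans (Nat.le_mul_of_pos_right n hp) (Nat.le_add_left _ i), hper n⟩

open Classical in
omit [DecidableEq V] in
theorem turn_self {G : RotorGraph V A} (ρ : G.Config) (u : (G.sinksᶜ : Set V)) :
    (G.turn ρ u u).1 = G.next (ρ u).1 :=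
  congrArg Subtype.val (Function.update_self (β := fun u : (G.sinksᶜ : Set V) =>
    {a : A // G.tail a = u}) u _ ρ)

open Classical in
omit [DecidableEq V] in
theorem turn_of_ne {G : RotorGraph V A} (ρ : G.Config) {u w : (G.sinksᶜ : Set V)} (h : w ≠ u) :
    G.turn ρ u w = ρ w :=
  Function.update_of_ne (β := fun u : (G.sinksᶜ : Set V) => {a : A // G.tail a = u}) h _ ρ

section Walk

variable {G : RotorGraph V A} {f : G.Config × V → G.Config × V} {E : Set V}
  (hE : ∀ p, p.2 ∈ E → (f p).1 = p.1) (hf : ∀ p, p.2 ∉ E → f p = G.step p)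
include hE hf

theorem iterate_config (p : G.Config × V) {w : V} (hw : w ∉ G.sinks) (hwE : w ∉ E) (k : ℕ) :
    ((f^[k] p).1 ⟨w, hw⟩).1 = G.next^[visits (fun i => (f^[i] p).2) w k] (p.1 ⟨w, hw⟩).1 := by
  induction k with
  | zero => simp
  | succ k ih =>
    rw [Function.iterate_succ_apply', visits_succ]
    by_cases hk : (f^[k] p).2 ∈ E
    · have hne : (f^[k] p).2 ≠ w := fun h => hwE (h ▸ hk)
      rw [hE _ hk, ih, if_neg hne, add_zero]
    rw [hf _ hk]
    by_cases hs : (f^[k] p).2 ∈ G.sinks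
    · have hne : (f^[k] p).2 ≠ w := fun h => hw (h ▸ hs)
      rw [step_of_mem _ _ hs, ih, if_neg hne, add_zero]
    · unfold step
      rw [dif_neg hs]
      by_cases hkw : (f^[k] p).2 = w
      · subst hkw
        rw [if_pos rfl, Function.iterate_succ_apply', ← ih]
        exact turn_self _ _
      · rw [if_neg hkw, add_zero, ← ih]
        exact congrArg Subtype.val (turn_of_ne _ fun h => hkw (congrArg Subtype.val h).symm)

theorem followsAt_iterate (p : G.Config × V) {w : V} (hw : w ∉ G.sinks) (hwE : w ∉ E) :
    FollowsAt (G.departures p.1) (fun i => (f^[i] p).2) w := by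
  intro k hk
  have hk : (f^[k] p).2 = w := hk
  have hkE : (f^[k] p).2 ∉ E := by rwa [hk]
  have hks : (f^[k] p).2 ∉ G.sinks := by rwa [hk]
  show (f^[k + 1] p).2 = _
  rw [Function.iterate_succ_apply', hf _ hkE, departures_eq _ hw]
  unfold step heads
  rw [dif_neg hks, ← iterate_config hE hf p hw hwE]
  subst hk
  rfl

end Walk

section Value

variable [Finite V] [Finite A] {G : RotorGraph V A} {root : V} {par : V → V} {depth : V → ℕ}
  (hR : G.Rooted root par depth)
  (hleaf : ∀ s ∈ G.sinks, (G.underlying.neighborSet s).ncard = 1) (hexit : G.Stopping)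
  {ρ : G.Config} {c : V → Bool} {Y : V → Outcome} (hY : G.Solves par (G.departures ρ) c Y)
include hR hleaf hexit hY

omit [DecidableEq V] [Finite V] [Finite A] hR hleaf hexit hY in
theorem isTrace_step (p : G.Config × V) : G.IsTrace (fun i => (G.step^[i] p).2) := by
  intro k
  simp only [Function.iterate_succ_apply']
  by_cases h : (G.step^[k] p).2 ∈ G.sinks
  · exact Or.inl ⟨h, by rw [step_of_mem _ _ h]⟩
  · refine Or.inr ⟨h, _, tail_config (G.step^[k] p).1 h, ?_⟩
    rw [step, dif_neg h]

/-- The solution of the equations tells in which kind of sink the rotor walk that starts at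
the root ends. -/
theorem exitsAt_of_solves :
    ∃ s, G.ExitsAt ρ root s ∧ (Y root).win = c s ∧ 0 < (Y root).flow := by
  by_cases hr : root ∈ G.sinks
  · refine ⟨⟨root, hr⟩, ⟨0, rfl⟩, ?_, ?_⟩ <;> rw [(hY root).1 hr]
    exact Nat.one_pos
  have hx := isTrace_step (G := G) (ρ, root)
  have hf : ∀ w ∉ G.sinks, FollowsAt (G.departures ρ) (fun i => (G.step^[i] (ρ, root)).2) w :=
    fun w hw => followsAt_iterate (f := G.step) (E := ∅) (fun p hp => absurd hp (by simp))
      (fun p _ => rfl) (ρ, root) hw (by simp)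
  have hD : ∀ v ∉ G.sinks, ∀ j, G.HasArc v (G.departures ρ v j) := fun v hv =>
    hasArc_departures ρ hv
  obtain ⟨k, hk⟩ := exists_mem_sinks hexit (fun v hv w hw => exists_departures_eq ρ hv hw)
    fun v hv _ => hf v hv
  have h0 : ∀ w, w ≠ root → ¬ Rooted.Below par w root := fun w hw hb => by
    have h1 := hR.depth_le_of_below hb
    have h2 := hR.depth_par w hw
    rw [hR.depth_root] at h1
    omega
  have key := nodeOutcome_of_sink hR hx (hD root hr) (hf root hr) (fun w hw _ => h0 w hw)
    (fun w hw _ => subtreeCorrect hR hleaf hx hD hY hw (h0 w hw) fun w' hw' _ => hf w' hw') hr hk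
    (hR.below_root _)
  refine ⟨⟨_, hk⟩, ⟨k, rfl⟩, ?_, ?_⟩ <;> rw [(hY root).2 hr, key]
  exact Nat.succ_pos _

/-- The positive flows are return flows: the particle leaves `par v` once more often than it comes
back from the subtree of `v`, until it is captured there. -/
theorem returnFlow_eq {v : V} (hv : v ≠ root) (hp : par v ∉ G.sinks) (ha : G.HasArc (par v) v)
    (hpos : 0 < (Y v).flow) : G.returnFlow ρ (par v) v = (Y v).flow := by
  set f := G.subtreeStep (par v) v with hfdef
  have hE : ∀ p : G.Config × V, p.2 ∈ ({par v} : Set V) → f p = (p.1, v) := by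
    intro p hp
    have hp : p.2 = par v := hp
    rw [hfdef, subtreeStep, if_pos hp]
  have hE' : ∀ p : G.Config × V, p.2 ∉ ({par v} : Set V) → f p = G.step p := by
    intro p hp
    have hp : p.2 ≠ par v := hp
    rw [hfdef, subtreeStep, if_neg hp]
  set x : ℕ → V := fun i => (f^[i] (ρ, par v)).2 with hxdef
  have hx : G.IsTrace x := by
    intro k
    simp only [hxdef, Function.iterate_succ_apply']
    by_cases h : (f^[k] (ρ, par v)).2 = par v
    · rw [hE _ h, h]
      exact Or.inr ⟨hp, ha⟩
    · rw [hE' _ h]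
      by_cases hs : (f^[k] (ρ, par v)).2 ∈ G.sinks
      · exact Or.inl ⟨hs, by rw [step_of_mem _ _ hs]⟩
      · refine Or.inr ⟨hs, _, tail_config (f^[k] (ρ, par v)).1 hs, ?_⟩
        rw [step, dif_neg hs]
  have hf : ∀ w ∉ G.sinks, w ≠ par v → FollowsAt (G.departures ρ) x w := fun w hw hne =>
    followsAt_iterate (f := f) (E := {par v}) (fun p hp => by rw [hE p hp]) hE' (ρ, par v) hw hne
  have hD : ∀ v ∉ G.sinks, ∀ j, G.HasArc v (G.departures ρ v j) := fun v hv =>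
    hasArc_departures ρ hv
  have h0 : ¬ Rooted.Below par v (x 0) := hR.not_below_par hv
  have hmoves : ∀ k, moves x (par v) v k = visits x (par v) k := by
    intro k
    unfold moves visits
    congr 1
    funext i
    apply propext
    refine ⟨fun h => h.1, fun h => ⟨h, ?_⟩⟩
    simp only [hxdef, Function.iterate_succ_apply'] at h ⊢
    rw [hE _ h]
  have hc := subtreeCorrect hR hleaf hx hD hY hv h0 fun w hw hb =>
    hf w hw fun h => hR.not_below_par hv (h ▸ hb)
  have hbound : ∀ k, visits x (par v) k ≤ (Y v).flow := by
    intro k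
    have h1 := (hc k).1 hpos
    have h2 := moves_par_eq hR hx hv h0 k
    rw [hmoves] at h2
    split_ifs at h2 <;> omega
  have hfin : ¬ {k | x k = par v}.Infinite := by
    intro hinf
    have h1 : visits x (par v) (Nat.nth (fun k => x k = par v) ((Y v).flow + 1)) = _ :=
      Nat.count_nth_of_infinite hinf _
    have h2 := hbound (Nat.nth (fun k => x k = par v) ((Y v).flow + 1))
    omega
  obtain ⟨k, hk⟩ := exists_mem_sinks hexit (fun v hv w hw => exists_departures_eq ρ hv hw)
    (fun w hw hinf => hf w hw fun h => hfin (h ▸ hinf))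
  have hb : Rooted.Below par v (x k) := by
    by_contra hb
    -- outside of the subtree of `v`, the walk only visits the parent of `v`
    have hout : ∀ i, Rooted.Below par v (x i) ∨ x i = par v := by
      intro i
      induction i with
      | zero => exact Or.inr rfl
      | succ i ih =>
        rcases ih with ih | ih
        · by_cases hi : Rooted.Below par v (x (i + 1))
          · exact Or.inl hi
          · rcases hx i with ⟨-, h⟩ | ⟨-, h⟩
            · exact absurd (h ▸ ih) hi
            · exact Or.inr (hR.eq_of_enters (Or.inr h) hi ih).2
        · left
          have : x (i + 1) = v := by
            simp only [hxdef, Function.iterate_succ_apply'] at ih ⊢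
            rw [hE _ ih]
          rw [this]
          exact Rooted.below_self v
    rcases hout k with h | h
    · exact hb h
    · exact hp (h ▸ hk)
  have hflow := ((hc k).2 hk hb).2.1
  rw [hmoves] at hflow
  -- the walk rests on its sink, and hence all departures from the parent of `v` occur before time
  -- `k`
  have hconst : ∀ i, k ≤ i → x i = x k := by
    intro i hi
    induction i, hi using Nat.le_induction with
    | base => rfl
    | succ i _ ih =>
      rcases hx i with ⟨-, h⟩ | ⟨h, -⟩
      · rw [h, ih]
      · exact absurd (ih ▸ hk) h
  have hset : {i : ℕ | (f^[i] (ρ, par v)).2 = par v} =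
      ↑((Finset.range k).filter fun i => x i = par v) := by
    ext i
    simp only [Set.mem_ofPred_eq, Finset.coe_filter, Finset.mem_range]
    refine ⟨fun h => ⟨?_, h⟩, fun h => h.2⟩
    by_contra hlt
    exact hp (by rw [← show x i = par v from h, hconst i (by omega)]; exact hk)
  unfold returnFlow
  rw [if_neg hp, hset, Set.encard_coe_eq_coe_finsetCard, ← Nat.count_eq_card_filter_range]
  exact congrArg Nat.cast hflow

end Value

end RotorGraph

/-! ### Optimal play -/

namespace RotorGame

open RotorGraph

variable {V A : Type*}

/-- The arcs at which the rotor of `v` can be when the walk starts. -/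
def choices (G : RotorGame V A) (v : V) : Set A :=
  {a | G.tail a = v ∧ ∀ h : v ∈ G.rotorVerts, a = (G.rho ⟨v, h⟩).1}

open Classical in
/-- The player who controls `v`: MAX (`true`) or MIN (`false`).  The vertices without player are
attributed to MIN, who then has a single choice. -/
noncomputable def owner (G : RotorGame V A) (v : V) : Bool := decide (v ∈ G.maxVerts)

/-- The sinks whose value is at least `t`. -/
noncomputable def reaches (G : RotorGame V A) (t : ℕ) (v : V) : Bool :=
  open Classical in decide (∃ h : v ∈ G.sinks, t ≤ G.val ⟨v, h⟩)

variable [DecidableEq V]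

/-- The optimality equations: every player chooses the best arc at his vertices, given the outcomes
of the children. -/
def IsOpt (G : RotorGame V A) (par : V → V) (c : V → Bool) (X : V → Outcome) : Prop :=
  ∀ v, (v ∈ G.sinks → X v = ⟨c v, 1⟩) ∧ (v ∉ G.sinks →
    (∃ a ∈ G.choices v, X v = nodeOutcome (par v) (G.heads a) X) ∧
    ∀ a ∈ G.choices v,
      (nodeOutcome (par v) (G.heads a) X).score (G.owner v) ≤ (X v).score (G.owner v))

omit [DecidableEq V] in
theorem exists_tail_eq {G : RotorGame V A} (hexit : G.toRotorGraph.Stopping) {v : V}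
    (hv : v ∉ G.sinks) : ∃ a, G.tail a = v := by
  obtain ⟨s, hs, hp⟩ := hexit v
  rcases Relation.ReflTransGen.cases_head hp with h | ⟨w, ⟨a, ha, -⟩, -⟩
  · exact absurd (h ▸ hs) hv
  · exact ⟨a, ha⟩

omit [DecidableEq V] in
theorem choices_nonempty {G : RotorGame V A} (hexit : G.toRotorGraph.Stopping) {v : V}
    (hv : v ∉ G.sinks) : (G.choices v).Nonempty := by
  by_cases h : v ∈ G.rotorVerts
  · exact ⟨(G.rho ⟨v, h⟩).1, (G.rho ⟨v, h⟩).2, fun _ => rfl⟩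
  · obtain ⟨a, ha⟩ := exists_tail_eq hexit hv
    exact ⟨a, ha, fun h' => absurd h' h⟩

omit [DecidableEq V] in
theorem config_mem_choices (G : RotorGame V A) (σ : G.MaxStrategy) (τ : G.MinStrategy) {v : V}
    (hv : v ∉ G.sinks) : (G.config σ τ ⟨v, hv⟩).1 ∈ G.choices v := by
  refine ⟨(G.config σ τ ⟨v, hv⟩).2, fun h => ?_⟩
  have h1 : v ∉ G.maxVerts := fun h' => h (Or.inl (Or.inl h'))
  have h2 : v ∉ G.minVerts := fun h' => h (Or.inl (Or.inr h'))
  unfold config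
  rw [dif_neg h1, dif_neg h2]

omit [DecidableEq V] in
theorem config_max (G : RotorGame V A) (σ : G.MaxStrategy) (τ : G.MinStrategy) {v : V}
    (hv : v ∉ G.sinks) (h : v ∈ G.maxVerts) : (G.config σ τ ⟨v, hv⟩).1 = (σ ⟨v, h⟩).1 := by
  unfold config
  rw [dif_pos h]

omit [DecidableEq V] in
theorem config_min (G : RotorGame V A) (σ : G.MaxStrategy) (τ : G.MinStrategy) {v : V}
    (hv : v ∉ G.sinks) (h : v ∈ G.minVerts) : (G.config σ τ ⟨v, hv⟩).1 = (τ ⟨v, h⟩).1 := by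
  have h' : v ∉ G.maxVerts := fun h' => Set.disjoint_left.1 G.disjoint_max_min h' h
  unfold config
  rw [dif_neg h', dif_pos h]

omit [DecidableEq V] in
theorem eq_of_mem_choices {G : RotorGame V A} {v : V} (h : v ∈ G.rotorVerts) {a b : A}
    (ha : a ∈ G.choices v) (hb : b ∈ G.choices v) : a = b := by
  rw [ha.2 h, hb.2 h]

section Optimal

variable {G : RotorGame V A} {root : V} {par : V → V} {depth : V → ℕ}
  (hR : G.toRotorGraph.Rooted root par depth)
include hR

omit [DecidableEq V] in
theorem depth_heads {v : V} (hv : v ∉ G.sinks) {a : A} (ha : G.tail a = v) {j : ℕ}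
    (hj : G.heads a j ≠ par v) : depth (G.heads a j) = depth v + 1 := by
  have := hasArc_heads (G := G.toRotorGraph) (a := a) (by rwa [ha]) j
  rw [ha] at this
  exact hR.depth_child this hj

theorem nodeOutcome_congr_depth {v : V} (hv : v ∉ G.sinks) {a : A} (ha : G.tail a = v)
    {X X' : V → Outcome} (h : ∀ w, depth w = depth v + 1 → X w = X' w) :
    nodeOutcome (par v) (G.heads a) X = nodeOutcome (par v) (G.heads a) X' :=
  nodeOutcome_congr fun _ hj => h _ (depth_heads hR hv ha hj)

theorem exists_solves [Finite V] (ρ : G.toRotorGraph.Config) (c : V → Bool) :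
    ∃ Y, G.toRotorGraph.Solves par (G.departures ρ) c Y := by
  classical
  have : Inhabited Outcome := ⟨⟨false, 0⟩⟩
  obtain ⟨Y, hY⟩ := Rooted.exists_recursive (α := Outcome) (fun v X =>
    if v ∈ G.sinks then ⟨c v, 1⟩ else nodeOutcome (par v) (G.departures ρ v) X) depth (by
      intro v X X' h
      split_ifs with hv
      · rfl
      · rw [departures_eq ρ hv]
        exact nodeOutcome_congr_depth hR hv (tail_config ρ hv) h)
  refine ⟨Y, fun v => ⟨fun hv => ?_, fun hv => ?_⟩⟩
  · rw [hY v, if_pos hv]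
  · conv_lhs => rw [hY v]
    rw [if_neg hv]

/-- The optimality equations are solved from the leaves to the root. -/
theorem exists_isOpt [Finite V] [Finite A] (hexit : G.toRotorGraph.Stopping) (c : V → Bool) :
    ∃ X, G.IsOpt par c X := by
  classical
  have : Inhabited Outcome := ⟨⟨false, 0⟩⟩
  obtain ⟨s₀, hs₀⟩ := G.sinks_nonempty
  by_cases hA : IsEmpty A
  · refine ⟨fun v => ⟨c v, 1⟩, fun v => ⟨fun _ => rfl, fun hv => ?_⟩⟩
    obtain ⟨a, -⟩ := choices_nonempty hexit hv
    exact hA.elim a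
  have : Nonempty A := not_isEmpty_iff.1 hA
  let f : V → (V → Outcome) → A → Outcome := fun v X a =>
    if a ∈ G.choices v then nodeOutcome (par v) (G.heads a) X else default
  let best : V → (A → Outcome) → A := fun v g => Classical.epsilon fun a => a ∈ G.choices v ∧
    ∀ a' ∈ G.choices v, (g a').score (G.owner v) ≤ (g a).score (G.owner v)
  have hbest : ∀ v ∉ G.sinks, ∀ g, best v g ∈ G.choices v ∧
      ∀ a' ∈ G.choices v, (g a').score (G.owner v) ≤ (g (best v g)).score (G.owner v) := by
    intro v hv g
    obtain ⟨a, ha, hmax⟩ := Set.exists_max_image (G.choices v) (fun a => (g a).score (G.owner v))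
      (Set.toFinite _) (choices_nonempty hexit hv)
    exact Classical.epsilon_spec (p := fun a => a ∈ G.choices v ∧
      ∀ a' ∈ G.choices v, (g a').score (G.owner v) ≤ (g a).score (G.owner v)) ⟨a, ha, hmax⟩
  obtain ⟨X, hX⟩ := Rooted.exists_recursive (α := Outcome) (fun v X =>
    if v ∈ G.sinks then ⟨c v, 1⟩ else f v X (best v (f v X))) depth (by
      intro v X X' h
      split_ifs with hv
      · rfl
      · have : f v X = f v X' := by
          funext a
          simp only [f]
          split_ifs with ha
          · exact nodeOutcome_congr_depth hR hv ha.1 h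
          · rfl
        rw [this])
  refine ⟨X, fun v => ⟨fun hv => ?_, fun hv => ?_⟩⟩
  · rw [hX v, if_pos hv]
  · obtain ⟨h1, h2⟩ := hbest v hv (f v X)
    have hXv := hX v
    rw [if_neg hv] at hXv
    have hf : ∀ a ∈ G.choices v, f v X a = nodeOutcome (par v) (G.heads a) X := fun a ha => if_pos ha
    refine ⟨⟨_, h1, by rw [hXv, hf _ h1]⟩, fun a ha => ?_⟩
    rw [hXv, ← hf a ha]
    exact h2 a ha

/-- A player who follows an optimal choice at his vertices does at least as well as predicted by
the optimality equations. -/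
theorem score_le_of_isOpt [Finite V] {c : V → Bool} {X Y : V → Outcome} (hX : G.IsOpt par c X)
    {ρ : G.toRotorGraph.Config} (hρ : ∀ v (hv : v ∉ G.sinks), (ρ ⟨v, hv⟩).1 ∈ G.choices v)
    (hY : G.toRotorGraph.Solves par (G.departures ρ) c Y) {β : Bool}
    (hβ : ∀ v ∉ G.sinks, G.owner v = β → X v = nodeOutcome (par v) (G.departures ρ v) X) (v : V) :
    (X v).score β ≤ (Y v).score β := by
  obtain ⟨N, hN⟩ : ∃ N, ∀ v, depth v ≤ N := by
    obtain ⟨N, hN⟩ := (Set.finite_range depth).bddAbove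
    exact ⟨N, fun v => hN ⟨v, rfl⟩⟩
  induction hd : N - depth v using Nat.strong_induction_on generalizing v with
  | _ n ih =>
    by_cases hv : v ∈ G.sinks
    · rw [(hX v).1 hv, (hY v).1 hv]
    · have h1 : (X v).score β ≤ (nodeOutcome (par v) (G.departures ρ v) X).score β := by
        by_cases ho : G.owner v = β
        · rw [← hβ v hv ho]
        · -- the choice of the opponent is at most as good for him as his best one
          have h2 := ((hX v).2 hv).2 _ (hρ v hv)
          have ho : G.owner v = !β := by cases h : G.owner v <;> cases h' : β <;> simp_all
          rw [ho, Outcome.score_not, Outcome.score_not, neg_le_neg_iff] at h2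
          rwa [departures_eq ρ hv]
      refine h1.trans ?_
      rw [(hY v).2 hv]
      refine score_nodeOutcome_mono fun j hj => ih _ ?_ _ rfl
      rw [departures_eq ρ hv] at hj ⊢
      have h2 := depth_heads hR hv (tail_config ρ hv) hj
      have h3 := hN (G.heads (ρ ⟨v, hv⟩).1 j)
      omega

/-- Strategies that make the optimal choices. -/
theorem exists_optimal_strategies [Finite V] {c : V → Bool} {X : V → Outcome}
    (hX : G.IsOpt par c X) : ∃ (σ : G.MaxStrategy) (τ : G.MinStrategy),
      G.toRotorGraph.Solves par (G.departures (G.config σ τ)) c X ∧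
      (∀ τ' Y, G.toRotorGraph.Solves par (G.departures (G.config σ τ')) c Y →
        ∀ v, (X v).score true ≤ (Y v).score true) ∧
      (∀ σ' Y, G.toRotorGraph.Solves par (G.departures (G.config σ' τ)) c Y →
        ∀ v, (X v).score false ≤ (Y v).score false) := by
  have hex : ∀ v : (G.sinksᶜ : Set V), ∃ a ∈ G.choices v,
      X v = nodeOutcome (par v) (G.heads a) X := fun v => ((hX v).2 v.2).1
  choose a ha hXa using hex
  have hmax : ∀ v ∈ G.maxVerts, v ∉ G.sinks := fun v h h' =>
    Set.disjoint_left.1 G.disjoint_max_sinks h h'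
  have hmin : ∀ v ∈ G.minVerts, v ∉ G.sinks := fun v h h' =>
    Set.disjoint_left.1 G.disjoint_min_sinks h h'
  let σ : G.MaxStrategy := fun v => ⟨a ⟨v, hmax v v.2⟩, (ha ⟨v, hmax v v.2⟩).1⟩
  let τ : G.MinStrategy := fun v => ⟨a ⟨v, hmin v v.2⟩, (ha ⟨v, hmin v v.2⟩).1⟩
  have h1 : ∀ τ', ∀ v ∉ G.sinks, G.owner v = true →
      X v = nodeOutcome (par v) (G.departures (G.config σ τ') v) X := by
    intro τ' v hv ho
    have hm : v ∈ G.maxVerts := by simpa [owner] using ho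
    rw [departures_eq _ hv, config_max G σ τ' hv hm]
    exact hXa ⟨v, hv⟩
  have h2 : ∀ σ', ∀ v ∉ G.sinks, G.owner v = false →
      X v = nodeOutcome (par v) (G.departures (G.config σ' τ) v) X := by
    intro σ' v hv ho
    have hm : v ∉ G.maxVerts := by simpa [owner] using ho
    rw [departures_eq _ hv]
    by_cases hm' : v ∈ G.minVerts
    · rw [config_min G σ' τ hv hm']
      exact hXa ⟨v, hv⟩
    · have hr : v ∈ G.rotorVerts := by
        rintro ((h | h) | h)
        · exact hm h
        · exact hm' h
        · exact hv h
      rw [eq_of_mem_choices hr (config_mem_choices G σ' τ hv) (ha ⟨v, hv⟩)]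
      exact hXa ⟨v, hv⟩
  refine ⟨σ, τ, fun v => ⟨(hX v).1, fun hv => ?_⟩, fun τ' Y hY => ?_, fun σ' Y hY => ?_⟩
  · cases ho : G.owner v
    · exact h2 σ v hv ho
    · exact h1 τ v hv ho
  · exact score_le_of_isOpt hR hX (fun v hv => config_mem_choices G _ _ hv) hY (h1 τ')
  · exact score_le_of_isOpt hR hX (fun v hv => config_mem_choices G _ _ hv) hY (h2 σ')

variable [Finite V] [Finite A] (htree : G.toRotorGraph.TreeLike) (hexit : G.toRotorGraph.Stopping)
include htree hexit

theorem win_root_iff {σ : G.MaxStrategy} {τ : G.MinStrategy} {t : ℕ} {Y : V → Outcome}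
    (hY : G.toRotorGraph.Solves par (G.departures (G.config σ τ)) (G.reaches t) Y) :
    0 < (Y root).flow ∧ ((Y root).win = true ↔ t ≤ G.value root σ τ) := by
  obtain ⟨s, hs, hw, hpos⟩ := exitsAt_of_solves hR htree.2 hexit hY
  refine ⟨hpos, ?_⟩
  have hex : ∃ s, G.toRotorGraph.ExitsAt (G.config σ τ) root s := ⟨s, hs⟩
  unfold value
  rw [dif_pos hex, ExitsAt.unique hex.choose_spec hs, hw]
  simp [reaches]

/-- The optimality equations for the threshold `t` tell whether MAX can guarantee `t`. -/
theorem threshold {t : ℕ} {X : V → Outcome} (hX : G.IsOpt par (G.reaches t) X) :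
    ∃ (σ : G.MaxStrategy) (τ : G.MinStrategy),
      ((X root).win = true → ∀ τ', t ≤ G.value root σ τ') ∧
      ((X root).win = false → ∀ σ', G.value root σ' τ < t) := by
  obtain ⟨σ, τ, h, hσ, hτ⟩ := exists_optimal_strategies hR hX
  have hpos := (win_root_iff hR htree hexit h).1
  refine ⟨σ, τ, fun hw τ' => ?_, fun hw σ' => ?_⟩
  · obtain ⟨Y, hY⟩ := exists_solves hR (G.config σ τ') (G.reaches t)
    have h1 := (Outcome.score_le_iff.1 (hσ τ' Y hY root)).1 _ ⟨hw, hpos, le_rfl⟩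
    exact (win_root_iff hR htree hexit hY).2.1 h1.1
  · obtain ⟨Y, hY⟩ := exists_solves hR (G.config σ' τ) (G.reaches t)
    have h1 := (Outcome.score_le_iff.1 (hτ σ' Y hY root)).1 _ ⟨hw, hpos, le_rfl⟩
    by_contra hlt
    have h2 := (win_root_iff hR htree hexit hY).2.2 (by omega)
    rw [h1.1] at h2
    simp at h2

theorem win_root_iff_le_value {t v : ℕ} {X : V → Outcome} (hX : G.IsOpt par (G.reaches t) X)
    (hv : G.IsValue root v) : (X root).win = true ↔ t ≤ v := by
  obtain ⟨σ₀, τ₀, h⟩ := hv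
  obtain ⟨σ, τ, h1, h2⟩ := threshold hR htree hexit hX
  constructor
  · intro hw
    exact (h1 hw τ₀).trans (h.min_guarantees σ)
  · intro ht
    by_contra hw
    have h3 := h2 (by simpa using hw) σ₀
    have h4 := h.max_guarantees τ
    omega

omit [DecidableEq V] htree hR hexit in
theorem bddAbove_returnFlow : BddAbove {r : ℕ | ∃ σ τ u v, G.toRotorGraph.HasArc u v ∧
    G.toRotorGraph.returnFlow (G.config σ τ) u v = r} := by
  have : Finite G.MaxStrategy := by unfold MaxStrategy PartialConfig; infer_instance
  have : Finite G.MinStrategy := by unfold MinStrategy PartialConfig; infer_instance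
  refine Set.Finite.bddAbove ((Set.finite_range fun p : G.MaxStrategy × G.MinStrategy × V × V =>
    (G.toRotorGraph.returnFlow (G.config p.1 p.2.1) p.2.2.1 p.2.2.2).toNat).subset ?_)
  rintro r ⟨σ, τ, u, v, -, h⟩
  refine ⟨(σ, τ, u, v), ?_⟩
  dsimp only
  rw [h, ENat.toNat_natCast]

/-- The flows in a solution of the optimality equations are return flows. -/
theorem flow_le_maxReturnFlow {c : V → Bool} {X : V → Outcome} (hX : G.IsOpt par c X) {v w : V}
    (hv : v ∉ G.sinks) (ha : G.toRotorGraph.HasArc v w) (hw : w ≠ par v) :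
    (X w).flow ≤ G.maxReturnFlow := by
  rcases Nat.eq_zero_or_pos (X w).flow with h0 | hpos
  · omega
  obtain ⟨hwr, hwv⟩ := hR.child_of_hasArc ha hw
  subst hwv
  obtain ⟨σ, τ, h, -, -⟩ := exists_optimal_strategies hR hX
  refine le_csSup bddAbove_returnFlow ⟨σ, τ, par w, w, ha, ?_⟩
  exact returnFlow_eq hR htree.2 hexit h hwr hv ha hpos

end Optimal

/-- The rotor walk stops, so that the default value of games without exit does not occur. -/
theorem value_mem_range [Finite V] [Finite A] {G : RotorGame V A} {root : V}
    (htree : G.toRotorGraph.TreeLike) (hexit : G.toRotorGraph.Stopping) (σ : G.MaxStrategy)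
    (τ : G.MinStrategy) : ∃ s, G.value root σ τ = G.val s := by
  obtain ⟨par, depth, hR⟩ := exists_rooted G.toRotorGraph htree.1 root
  obtain ⟨Y, hY⟩ := exists_solves hR (G.config σ τ) (G.reaches 0)
  obtain ⟨s, hs, -⟩ := exitsAt_of_solves hR htree.2 hexit hY
  refine ⟨s, ?_⟩
  have hex : ∃ s, G.toRotorGraph.ExitsAt (G.config σ τ) root s := ⟨s, hs⟩
  unfold value
  rw [dif_pos hex, ExitsAt.unique hex.choose_spec hs]

omit [DecidableEq V] in
/-- Every stopping tree-like game has a pure strategy equilibrium. -/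
theorem exists_isPureEquilibrium [Finite V] [Finite A] (G : RotorGame V A)
    (htree : G.toRotorGraph.TreeLike) (hexit : G.toRotorGraph.Stopping) (root : V) :
    ∃ (v : ℕ) (σ : G.MaxStrategy) (τ : G.MinStrategy), G.IsPureEquilibrium root v σ τ := by
  classical
  obtain ⟨par, depth, hR⟩ := exists_rooted G.toRotorGraph htree.1 root
  have hth : ∀ t, ∃ (σ : G.MaxStrategy) (τ : G.MinStrategy),
      (∀ τ', t ≤ G.value root σ τ') ∨ (∀ σ', G.value root σ' τ < t) := by
    intro t
    obtain ⟨X, hX⟩ := exists_isOpt hR hexit (G.reaches t)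
    obtain ⟨σ, τ, h1, h2⟩ := threshold hR htree hexit hX
    refine ⟨σ, τ, ?_⟩
    cases hw : (X root).win
    · exact Or.inr (h2 hw)
    · exact Or.inl (h1 hw)
  obtain ⟨B, hB⟩ := (Set.finite_range G.val).bddAbove
  have hle : ∀ σ τ, G.value root σ τ ≤ B := fun σ τ => by
    obtain ⟨s, hs⟩ := value_mem_range (root := root) htree hexit σ τ
    exact hs ▸ hB ⟨s, rfl⟩
  -- the value of the game is the largest number that MAX can guarantee
  let P : ℕ → Prop := fun t => ∃ σ : G.MaxStrategy, ∀ τ', t ≤ G.value root σ τ'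
  obtain ⟨σ₀, τ₀, -⟩ := hth 0
  have hP0 : P 0 := ⟨σ₀, fun _ => Nat.zero_le _⟩
  obtain ⟨σ, hσ⟩ : P (Nat.findGreatest P B) := Nat.findGreatest_spec (Nat.zero_le B) hP0
  have hnot : ¬ P (Nat.findGreatest P B + 1) := by
    intro h
    by_cases hb : Nat.findGreatest P B + 1 ≤ B
    · have := Nat.le_findGreatest hb h
      omega
    · obtain ⟨σ', hσ'⟩ := h
      have h1 := hσ' τ₀
      have h2 := hle σ' τ₀
      omega
  obtain ⟨σ₁, τ, h | h⟩ := hth (Nat.findGreatest P B + 1)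
  · exact absurd ⟨σ₁, h⟩ hnot
  have hτ : ∀ σ', G.value root σ' τ ≤ Nat.findGreatest P B := fun σ' => Nat.lt_succ_iff.1 (h σ')
  exact ⟨Nat.findGreatest P B, σ, τ, hσ, hτ, fun τ' => (hτ σ).trans (hσ τ'),
    fun σ' => (hτ σ').trans (hσ τ)⟩

end RotorGame

/-! ### A structured language for the random access machine -/

namespace RAM

/-- The elementary commands of a structured language with named registers `R` and named
arrays `F`. -/
inductive Op (R F : Type) where
  | const (d : R) (k : ℕ)
  | add (d a b : R)
  | sub (d a b : R)
  | mul (d a b : R)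
  | div (d a b : R)
  | load (d : R) (f : F) (a : R)
  | store (f : F) (a b : R)

/-- Structured programs.  The tests compare two registers: `ite a b c d` executes `c` if `a < b`
and `d` otherwise, and `loop a b c` repeats `c` as long as `a < b`. -/
inductive Code (R F : Type) where
  | skip
  | op (o : Op R F)
  | seq (c d : Code R F)
  | ite (a b : R) (c d : Code R F)
  | loop (a b : R) (c : Code R F)

/-- The contents of the registers and of the arrays. -/
structure Store (R F : Type) where
  reg : R → ℕ
  arr : F → ℕ → ℕ

/-- The bounds that an execution respects: the length of the arrays, a bound for all numbers that
occur, and bounds for the two operands of multiplications and divisions. -/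
structure Limits where
  len : ℕ
  big : ℕ
  fst : ℕ
  snd : ℕ

variable {R F : Type}

/-- The sequential composition of a list of programs. -/
def Code.block : List (Code R F) → Code R F
  | [] => .skip
  | c :: l => .seq c (Code.block l)

variable [DecidableEq R] [DecidableEq F]

/-- The effect of an elementary command. -/
def Op.exec : Op R F → Store R F → Store R F
  | .const d k, s => { s with reg := Function.update s.reg d k }
  | .add d a b, s => { s with reg := Function.update s.reg d (s.reg a + s.reg b) }
  | .sub d a b, s => { s with reg := Function.update s.reg d (s.reg a - s.reg b) }
  | .mul d a b, s => { s with reg := Function.update s.reg d (s.reg a * s.reg b) }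
  | .div d a b, s => { s with reg := Function.update s.reg d (s.reg a / s.reg b) }
  | .load d f a, s => { s with reg := Function.update s.reg d (s.arr f (s.reg a)) }
  | .store f a b, s =>
    { s with arr := Function.update s.arr f (Function.update (s.arr f) (s.reg a) (s.reg b)) }

/-- The command respects the bounds. -/
def Op.Ok (ℓ : Limits) : Op R F → Store R F → Prop
  | .const _ k, _ => k ≤ ℓ.big
  | .add _ a b, s => s.reg a + s.reg b ≤ ℓ.big
  | .sub _ _ _, _ => True
  | .mul _ a b, s => s.reg a ≤ ℓ.fst ∧ s.reg b ≤ ℓ.snd ∧ s.reg a * s.reg b ≤ ℓ.big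
  | .div _ a b, s => s.reg a ≤ ℓ.fst ∧ s.reg b ≤ ℓ.snd
  | .load _ _ a, s => s.reg a < ℓ.len
  | .store _ a _, s => s.reg a < ℓ.len

/-- The number of machine instructions of an elementary command. -/
def Op.time : Op R F → ℕ
  | .load _ _ _ => 2
  | .store _ _ _ => 2
  | _ => 1

/-- `Run ℓ c s s' t`: the program `c` leads from `s` to `s'` with `t` machine instructions,
respecting the bounds `ℓ`. -/
inductive Run (ℓ : Limits) : Code R F → Store R F → Store R F → ℕ → Prop
  | skip {s} : Run ℓ .skip s s 0
  | op {o : Op R F} {s} : o.Ok ℓ s → Run ℓ (.op o) s (o.exec s) o.time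
  | seq {c d : Code R F} {s s₁ s₂ t₁ t₂} :
      Run ℓ c s s₁ t₁ → Run ℓ d s₁ s₂ t₂ → Run ℓ (.seq c d) s s₂ (t₁ + t₂)
  | ite_pos {a b : R} {c d : Code R F} {s s' t} :
      s.reg a < s.reg b → Run ℓ c s s' t → Run ℓ (.ite a b c d) s s' (1 + t)
  | ite_neg {a b : R} {c d : Code R F} {s s' t} :
      ¬ s.reg a < s.reg b → Run ℓ d s s' t → Run ℓ (.ite a b c d) s s' (1 + t + 1)
  | loop_done {a b : R} {c : Code R F} {s} : ¬ s.reg a < s.reg b → Run ℓ (.loop a b c) s s 2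
  | loop_step {a b : R} {c : Code R F} {s s₁ s₂ t₁ t₂} : s.reg a < s.reg b →
      Run ℓ c s s₁ t₁ → Run ℓ (.loop a b c) s₁ s₂ t₂ → Run ℓ (.loop a b c) s s₂ (1 + t₁ + 1 + t₂)

/-! ### Compilation -/

section Compile

variable (ir : R → ℕ) (ia : F → ℕ)

/-- The machine instructions of an elementary command.  The register `r` is register `2 * ir r` of
the machine, register `2 * ia f + 3` holds the address of the array `f`, and register `1`
is used for addresses. -/
def Op.compile : Op R F → List Instr
  | .const d k => [.const (2 * ir d) k]
  | .add d a b => [.add (2 * ir d) (2 * ir a) (2 * ir b)]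
  | .sub d a b => [.sub (2 * ir d) (2 * ir a) (2 * ir b)]
  | .mul d a b => [.mul (2 * ir d) (2 * ir a) (2 * ir b)]
  | .div d a b => [.div (2 * ir d) (2 * ir a) (2 * ir b)]
  | .load d f a => [.add 1 (2 * ia f + 3) (2 * ir a), .load (2 * ir d) 1]
  | .store f a b => [.add 1 (2 * ia f + 3) (2 * ir a), .store 1 (2 * ir b)]

/-- The number of instructions of the compiled program. -/
def Code.length : Code R F → ℕ
  | .skip => 0
  | .op o => o.time
  | .seq c d => c.length + d.length
  | .ite _ _ c d => 1 + d.length + 1 + c.length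
  | .loop _ _ c => 2 + c.length + 1

/-- The machine program, if it starts at the address `k`. -/
def Code.compile : Code R F → ℕ → Program
  | .skip, _ => []
  | .op o, _ => o.compile ir ia
  | .seq c d, k => c.compile k ++ d.compile (k + c.length)
  | .ite a b c d, k =>
    [.jumpIfLt (2 * ir a) (2 * ir b) (k + 1 + d.length + 1)] ++ (d.compile (k + 1) ++
      ([.jump (k + 1 + d.length + 1 + c.length)] ++ c.compile (k + 1 + d.length + 1)))
  | .loop a b c, k =>
    [.jumpIfLt (2 * ir a) (2 * ir b) (k + 2), .jump (k + 2 + c.length + 1)] ++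
      (c.compile (k + 2) ++ [.jump k])

omit [DecidableEq R] [DecidableEq F] in
theorem Op.length_compile (o : Op R F) : (o.compile ir ia).length = o.time := by
  cases o <;> rfl

omit [DecidableEq R] [DecidableEq F] in
theorem Code.length_compile (c : Code R F) (k : ℕ) : (c.compile ir ia k).length = c.length := by
  induction c generalizing k with
  | skip => rfl
  | op o => exact o.length_compile ir ia
  | seq c d hc hd => simp [Code.compile, Code.length, hc, hd]
  | ite a b c d hc hd => simp [Code.compile, Code.length, hc, hd]; omega
  | loop a b c hc => simp [Code.compile, Code.length, hc]; omega

/-- The instructions `l` are in the program `P` from the address `k` on. -/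
def CodeAt (P : Program) (k : ℕ) (l : List Instr) : Prop := ∃ post, P.drop k = l ++ post

theorem CodeAt.left {P : Program} {k : ℕ} {l₁ l₂ : List Instr} (h : CodeAt P k (l₁ ++ l₂)) :
    CodeAt P k l₁ := by
  obtain ⟨post, h⟩ := h
  exact ⟨l₂ ++ post, by rw [h, List.append_assoc]⟩

theorem CodeAt.right {P : Program} {k : ℕ} {l₁ l₂ : List Instr} (h : CodeAt P k (l₁ ++ l₂)) :
    CodeAt P (k + l₁.length) l₂ := by
  obtain ⟨post, h⟩ := h
  exact ⟨post, by rw [← List.drop_drop, h, List.append_assoc, List.drop_left]⟩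

theorem CodeAt.getElem? {P : Program} {k : ℕ} {i : Instr} {l : List Instr}
    (h : CodeAt P k (i :: l)) : P[k]? = some i := by
  obtain ⟨post, h⟩ := h
  have := congrArg (fun l : List Instr => l[0]?) h
  simpa using this

theorem CodeAt.tail {P : Program} {k : ℕ} {i : Instr} {l : List Instr}
    (h : CodeAt P k (i :: l)) : CodeAt P (k + 1) l :=
  CodeAt.right (l₁ := [i]) h

/-- `t` steps lead from `σ` to `σ'`, and each of them costs at most `M`. -/
def Steps (cost : Instr → State → ℕ) (M : ℕ) (P : Program) (σ σ' : State) (t : ℕ) : Prop :=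
  (step P)^[t] σ = σ' ∧ ∀ i < t, stepCost cost P ((step P)^[i] σ) ≤ M

section Steps

variable {cost : Instr → State → ℕ} {M : ℕ} {P : Program} {σ σ₁ σ₂ : State} {t₁ t₂ : ℕ}

theorem Steps.refl : Steps cost M P σ σ 0 := ⟨rfl, fun i hi => absurd hi (Nat.not_lt_zero i)⟩

theorem Steps.trans (h₁ : Steps cost M P σ σ₁ t₁) (h₂ : Steps cost M P σ₁ σ₂ t₂) :
    Steps cost M P σ σ₂ (t₁ + t₂) := by
  refine ⟨by rw [add_comm, Function.iterate_add_apply, h₁.1, h₂.1], fun i hi => ?_⟩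
  by_cases h : i < t₁
  · exact h₁.2 i h
  · obtain ⟨j, rfl⟩ := Nat.exists_eq_add_of_le' (not_lt.1 h)
    rw [Function.iterate_add_apply, h₁.1]
    exact h₂.2 j (by omega)

theorem Steps.single {i : Instr} (hi : P[σ.pc]? = some i) (hM : cost i σ ≤ M) :
    Steps cost M P σ (i.exec σ) 1 := by
  refine ⟨?_, fun j hj => ?_⟩
  · rw [Function.iterate_one, step, hi]
  · obtain rfl : j = 0 := by omega
    rw [Function.iterate_zero, id, stepCost, hi]
    exact hM

theorem Steps.sum_le (h : Steps cost M P σ σ₁ t₁) :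
    ∑ i ∈ Finset.range t₁, stepCost cost P ((step P)^[i] σ) ≤ t₁ * M := by
  calc _ ≤ ∑ _i ∈ Finset.range t₁, M := Finset.sum_le_sum fun i hi => h.2 i (Finset.mem_range.1 hi)
    _ = t₁ * M := by simp

end Steps

/-- The machine state represents the contents of the named registers and arrays. -/
structure Represents (ℓ : Limits) (s : Store R F) (σ : State) : Prop where
  reg : ∀ r, σ.reg (2 * ir r) = s.reg r
  base : ∀ f, σ.reg (2 * ia f + 3) = ia f * ℓ.len
  mem : ∀ f i, i < ℓ.len → σ.mem (ia f * ℓ.len + i) = s.arr f i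
  reg_le : ∀ r, s.reg r ≤ ℓ.big
  arr_le : ∀ f i, i < ℓ.len → s.arr f i ≤ ℓ.big

/-- A bound for the bit cost of the machine instructions of an execution within the bounds `ℓ`. -/
def Limits.cost (ℓ : Limits) (c : ℕ → ℕ → ℕ) : ℕ := 1 + 2 * ℓ.big.size + c ℓ.fst ℓ.snd

variable {ir ia} {ℓ : Limits} {c : ℕ → ℕ → ℕ} {P : Program}
  (hir : Function.Injective ir) (hia : Function.Injective ia) (hbig : ∀ f, (ia f + 1) * ℓ.len ≤ ℓ.big)
  (hc : IsDivisionCost c)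

omit [DecidableEq F] in
include hir in
theorem Represents.assign {s : Store R F} {σ : State} (h : Represents ir ia ℓ s σ) (d : R) {x : ℕ}
    (hx : x ≤ ℓ.big) :
    Represents ir ia ℓ { s with reg := Function.update s.reg d x } (σ.assign (2 * ir d) x) where
  reg r := by
    by_cases hr : r = d
    · subst hr
      simp [State.assign]
    · have : 2 * ir r ≠ 2 * ir d := fun h => hr (hir (by omega))
      simp [State.assign, hr, this, h.reg]
  base f := by
    have : 2 * ia f + 3 ≠ 2 * ir d := by omega
    simp [State.assign, this, h.base]
  mem f i hi := h.mem f i hi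
  reg_le r := by
    by_cases hr : r = d
    · subst hr
      simpa using hx
    · simpa [hr] using h.reg_le r
  arr_le := h.arr_le

omit [DecidableEq R] [DecidableEq F] in
theorem Represents.assign_address {s : Store R F} {σ : State} (h : Represents ir ia ℓ s σ) (x : ℕ) :
    Represents ir ia ℓ s (σ.assign 1 x) where
  reg r := by
    have : 2 * ir r ≠ 1 := by omega
    simp [State.assign, this, h.reg]
  base f := by simp [State.assign, h.base]
  mem := h.mem
  reg_le := h.reg_le
  arr_le := h.arr_le

omit [DecidableEq R] [DecidableEq F] in
theorem Represents.jump {s : Store R F} {σ : State} (h : Represents ir ia ℓ s σ) (k : ℕ) :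
    Represents ir ia ℓ s { σ with pc := k } :=
  ⟨h.reg, h.base, h.mem, h.reg_le, h.arr_le⟩

omit [DecidableEq R] in
include hia in
theorem Represents.store {s : Store R F} {σ : State} (h : Represents ir ia ℓ s σ) (f : F) {i x : ℕ}
    (hi : i < ℓ.len) (hx : x ≤ ℓ.big) :
    Represents ir ia ℓ { s with arr := Function.update s.arr f (Function.update (s.arr f) i x) }
      { σ with pc := σ.pc + 1, mem := Function.update σ.mem (ia f * ℓ.len + i) x } where
  reg := h.reg
  base := h.base
  mem g j hj := by
    by_cases hg : g = f
    · subst hg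
      by_cases hij : j = i
      · subst hij
        simp
      · simp [hij, h.mem g j hj]
    · have : ia g * ℓ.len + j ≠ ia f * ℓ.len + i := by
        intro heq
        apply hg
        apply hia
        have h1 := congrArg (· / ℓ.len) heq
        have h2 : ∀ k l : ℕ, l < ℓ.len → (k * ℓ.len + l) / ℓ.len = k := fun k l hl => by
          rw [add_comm, Nat.add_mul_div_right _ _ (by omega), Nat.div_eq_of_lt hl, zero_add]
        simpa only [h2 _ _ hj, h2 _ _ hi] using h1
      simp [hg, this, h.mem g j hj]
  reg_le := h.reg_le
  arr_le g j hj := by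
    by_cases hg : g = f
    · subst hg
      by_cases hij : j = i
      · subst hij
        simpa using hx
      · simpa [hij] using h.arr_le g j hj
    · simpa [hg] using h.arr_le g j hj

include hir hia hbig hc in
theorem Op.simulate {o : Op R F} {s : Store R F} (ho : o.Ok ℓ s) {k : ℕ}
    (hP : CodeAt P k (o.compile ir ia)) {σ : State} (hσ : Represents ir ia ℓ s σ) (hpc : σ.pc = k) :
    ∃ σ', Steps (bitCost c) (ℓ.cost c) P σ σ' o.time ∧ Represents ir ia ℓ (o.exec s) σ' ∧
      σ'.pc = k + o.time := by
  have hsize : ∀ x ≤ ℓ.big, x.size ≤ ℓ.big.size := fun x hx => Nat.size_le_size hx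
  have hr : ∀ r, (σ.reg (2 * ir r)).size ≤ ℓ.big.size := fun r => by
    rw [hσ.reg]
    exact hsize _ (hσ.reg_le r)
  have hb : ∀ f, (σ.reg (2 * ia f + 3)).size ≤ ℓ.big.size := fun f => by
    rw [hσ.base]
    exact hsize _ (le_trans (Nat.mul_le_mul_right _ (Nat.le_succ _)) (hbig f))
  have haddr : ∀ f i, i < ℓ.len → ia f * ℓ.len + i ≤ ℓ.big := fun f i hi => by
    have := hbig f
    rw [Nat.succ_mul] at this
    omega
  subst hpc
  unfold Limits.cost
  cases o with
  | const d x =>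
    refine ⟨_, Steps.single hP.getElem? ?_, hσ.assign hir d ho, rfl⟩
    have := hsize x ho
    simp only [bitCost]
    omega
  | add d a b =>
    refine ⟨_, Steps.single hP.getElem? ?_, ?_, rfl⟩
    · have := hr a
      have := hr b
      simp only [bitCost]
      omega
    · simp only [Instr.exec, hσ.reg]
      exact hσ.assign hir d ho
  | sub d a b =>
    refine ⟨_, Steps.single hP.getElem? ?_, ?_, rfl⟩
    · have := hr a
      have := hr b
      simp only [bitCost]
      omega
    · simp only [Instr.exec, hσ.reg]
      exact hσ.assign hir d ((Nat.sub_le _ _).trans (hσ.reg_le a))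
  | mul d a b =>
    refine ⟨_, Steps.single hP.getElem? ?_, ?_, rfl⟩
    · have := hc.mono _ _ _ _ ho.1 ho.2.1
      simp only [bitCost, hσ.reg]
      omega
    · simp only [Instr.exec, hσ.reg]
      exact hσ.assign hir d ho.2.2
  | div d a b =>
    refine ⟨_, Steps.single hP.getElem? ?_, ?_, rfl⟩
    · have := hc.mono _ _ _ _ ho.1 ho.2
      simp only [bitCost, hσ.reg]
      omega
    · simp only [Instr.exec, hσ.reg]
      exact hσ.assign hir d ((Nat.div_le_self _ _).trans (hσ.reg_le a))
  | load d f a =>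
    have ho : s.reg a < ℓ.len := ho
    have h1 := hσ.assign_address (ia f * ℓ.len + s.reg a)
    refine ⟨_, Steps.trans (t₁ := 1) (t₂ := 1) (Steps.single hP.getElem? ?_)
      (Steps.single hP.tail.getElem? ?_), ?_, rfl⟩
    · have := hr a
      have := hb f
      simp only [bitCost]
      omega
    · have := hsize _ (haddr f _ ho)
      have := hsize _ (h1.arr_le f _ ho)
      simp only [Instr.exec, bitCost, hσ.base, hσ.reg]
      simp only [State.assign, Function.update_self, hσ.mem f _ ho]
      omega
    · simp only [Instr.exec, hσ.base, hσ.reg]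
      have h2 := h1.assign hir d (h1.arr_le f _ ho)
      have h3 : (σ.assign 1 (ia f * ℓ.len + s.reg a)).mem
          ((σ.assign 1 (ia f * ℓ.len + s.reg a)).reg 1) = s.arr f (s.reg a) := by
        simp only [State.assign, Function.update_self, hσ.mem f _ ho]
      rw [h3]
      exact h2
  | store f a b =>
    have ho : s.reg a < ℓ.len := ho
    have h1 := hσ.assign_address (ia f * ℓ.len + s.reg a)
    have hb1 : (σ.assign 1 (ia f * ℓ.len + s.reg a)).reg (2 * ir b) = s.reg b := h1.reg b
    have ha1 : (σ.assign 1 (ia f * ℓ.len + s.reg a)).reg 1 = ia f * ℓ.len + s.reg a := by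
      simp [State.assign]
    refine ⟨_, Steps.trans (t₁ := 1) (t₂ := 1) (Steps.single hP.getElem? ?_)
      (Steps.single hP.tail.getElem? ?_), ?_, rfl⟩
    · have := hr a
      have := hb f
      simp only [bitCost]
      omega
    · have := hsize _ (haddr f _ ho)
      have := hsize _ (h1.reg_le b)
      simp only [Instr.exec, hσ.base, hσ.reg]
      simp only [bitCost, ha1, hb1]
      omega
    · simp only [Instr.exec, hσ.base, hσ.reg]
      rw [ha1, hb1]
      exact h1.store hia f ho (h1.reg_le b)

include hir hia hbig hc in
/-- The compiled program simulates the structured program. -/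
theorem Run.simulate {p : Code R F} {s s' : Store R F} {t : ℕ} (h : Run ℓ p s s' t) :
    ∀ {k : ℕ} {σ : State}, CodeAt P k (p.compile ir ia k) → Represents ir ia ℓ s σ → σ.pc = k →
    ∃ σ', Steps (bitCost c) (ℓ.cost c) P σ σ' t ∧ Represents ir ia ℓ s' σ' ∧
      σ'.pc = k + p.length := by
  have htest : ∀ {s : Store R F} {σ : State} {a b : R} {k : ℕ}, Represents ir ia ℓ s σ →
      bitCost c (.jumpIfLt (2 * ir a) (2 * ir b) k) σ ≤ ℓ.cost c := by
    intro s σ a b k hσ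
    have h1 := Nat.size_le_size (hσ.reg_le a)
    have h2 := Nat.size_le_size (hσ.reg_le b)
    simp only [bitCost, Limits.cost, hσ.reg]
    omega
  have hjump : ∀ {σ : State} {k : ℕ}, bitCost c (.jump k) σ ≤ ℓ.cost c := by
    intro σ k
    simp only [bitCost, Limits.cost]
    omega
  induction h with
  | skip => exact fun _ hσ hpc => ⟨_, Steps.refl, hσ, hpc⟩
  | op ho => exact fun hP hσ hpc => Op.simulate hir hia hbig hc ho hP hσ hpc
  | @seq c d _ _ _ _ _ _ _ ih₁ ih₂ =>
    intro k σ hP hσ hpc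
    obtain ⟨σ₁, h1, h2, h3⟩ := ih₁ hP.left hσ hpc
    have hP2 := hP.right
    rw [Code.length_compile] at hP2
    obtain ⟨σ₂, h4, h5, h6⟩ := ih₂ hP2 h2 h3
    exact ⟨σ₂, h1.trans h4, h5, by rw [h6, Code.length, add_assoc]⟩
  | @ite_pos a b c d s _ _ hlt _ ih =>
    intro k σ hP hσ hpc
    subst hpc
    have hP2 := hP.right.right.right
    simp only [Code.length_compile, List.length_singleton] at hP2
    obtain ⟨σ₁, h1, h2, h3⟩ := ih hP2 (hσ.jump _) rfl
    refine ⟨σ₁, (Steps.single hP.getElem? (htest hσ)).trans ?_, h2, ?_⟩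
    · simp only [Instr.exec, hσ.reg]
      rw [if_pos hlt]
      exact h1
    · rw [h3, Code.length]
      omega
  | @ite_neg a b c d s _ _ hlt _ ih =>
    intro k σ hP hσ hpc
    subst hpc
    obtain ⟨σ₁, h1, h2, h3⟩ := ih hP.right.left (hσ.jump (σ.pc + 1)) rfl
    have hP2 := hP.right.right
    simp only [Code.length_compile, List.length_singleton] at hP2
    have h3 : σ₁.pc = σ.pc + 1 + d.length := h3
    rw [← h3] at hP2
    refine ⟨_, ((Steps.single hP.getElem? (htest hσ)).trans ?_).trans
      (Steps.single hP2.getElem? hjump), h2.jump _, ?_⟩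
    · simp only [Instr.exec, hσ.reg]
      rw [if_neg hlt]
      exact h1
    · simp only [Instr.exec, Code.length]
      omega
  | @loop_done a b c s hlt =>
    intro k σ hP hσ hpc
    subst hpc
    refine ⟨_, (Steps.single hP.getElem? (htest hσ)).trans (t₂ := 1) ?_,
      hσ.jump (σ.pc + 2 + c.length + 1), ?_⟩
    · simp only [Instr.exec, hσ.reg]
      rw [if_neg hlt]
      exact Steps.single (σ := { σ with pc := σ.pc + 1 }) hP.tail.getElem? hjump
    · simp only [Code.length]
      omega
  | @loop_step a b c s _ _ _ _ hlt _ _ ih₁ ih₂ =>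
    intro k σ hP hσ hpc
    subst hpc
    obtain ⟨σ₁, h1, h2, h3⟩ := ih₁ hP.right.left (hσ.jump _) rfl
    have hP2 := hP.right.right
    rw [Code.length_compile] at hP2
    have hpc1 : σ₁.pc = σ.pc + [Instr.jumpIfLt (2 * ir a) (2 * ir b) (σ.pc + 2),
        Instr.jump (σ.pc + 2 + c.length + 1)].length + c.length := h3
    rw [← hpc1] at hP2
    obtain ⟨σ₂, h4, h5, h6⟩ := ih₂ hP (h2.jump σ.pc) rfl
    refine ⟨σ₂, (((Steps.single hP.getElem? (htest hσ)).trans ?_).trans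
      (Steps.single hP2.getElem? hjump)).trans h4, h5, h6⟩
    simp only [Instr.exec, hσ.reg]
    rw [if_pos hlt]
    exact h1

end Compile

end RAM

/-! ### Reasoning about structured programs -/

namespace RAM

variable {R F : Type} [DecidableEq R] [DecidableEq F]

/-- From `s`, the program `c` halts after at most `T` machine instructions, in a state that
satisfies `Q`. -/
def Spec (ℓ : Limits) (c : Code R F) (s : Store R F) (T : ℕ) (Q : Store R F → Prop) : Prop :=
  ∃ s' t, Run ℓ c s s' t ∧ t ≤ T ∧ Q s'

/-- The program assigns to the register `r`. -/
def Code.writes (r : R) : Code R F → Bool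
  | .skip => false
  | .op (.const d _) => d = r
  | .op (.add d _ _) => d = r
  | .op (.sub d _ _) => d = r
  | .op (.mul d _ _) => d = r
  | .op (.div d _ _) => d = r
  | .op (.load d _ _) => d = r
  | .op (.store _ _ _) => false
  | .seq c d => c.writes r || d.writes r
  | .ite _ _ c d => c.writes r || d.writes r
  | .loop _ _ c => c.writes r

/-- The program writes to the array `f`. -/
def Code.stores (f : F) : Code R F → Bool
  | .skip => false
  | .op (.store g _ _) => g = f
  | .op _ => false
  | .seq c d => c.stores f || d.stores f
  | .ite _ _ c d => c.stores f || d.stores f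
  | .loop _ _ c => c.stores f

/-- `s` and `s'` differ only in registers and arrays to which the program `c` writes. -/
def Frame (c : Code R F) (s s' : Store R F) : Prop :=
  (∀ r, c.writes r = false → s'.reg r = s.reg r) ∧ (∀ f, c.stores f = false → s'.arr f = s.arr f)

theorem Frame.refl (c : Code R F) (s : Store R F) : Frame c s s := ⟨fun _ _ => rfl, fun _ _ => rfl⟩

theorem Frame.trans {c : Code R F} {s s₁ s₂ : Store R F} (h₁ : Frame c s s₁) (h₂ : Frame c s₁ s₂) :
    Frame c s s₂ :=
  ⟨fun r hr => (h₂.1 r hr).trans (h₁.1 r hr), fun f hf => (h₂.2 f hf).trans (h₁.2 f hf)⟩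

theorem Frame.mono {c d : Code R F} {s s' : Store R F} (h : Frame c s s')
    (hr : ∀ r, d.writes r = false → c.writes r = false)
    (hf : ∀ f, d.stores f = false → c.stores f = false) : Frame d s s' :=
  ⟨fun r h' => h.1 r (hr r h'), fun f h' => h.2 f (hf f h')⟩

variable {ℓ : Limits}

theorem Op.frame (o : Op R F) (s : Store R F) : Frame (.op o) s (o.exec s) := by
  constructor
  · intro r hr
    cases o <;> simp only [Code.writes, decide_eq_false_iff_not] at hr <;> simp only [Op.exec]
    all_goals exact Function.update_of_ne (Ne.symm hr) _ _
  · intro f hf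
    cases o <;> simp only [Code.stores, decide_eq_false_iff_not] at hf <;> simp only [Op.exec]
    exact Function.update_of_ne (Ne.symm hf) _ _

theorem Run.frame {c : Code R F} {s s' : Store R F} {t : ℕ} (h : Run ℓ c s s' t) :
    Frame c s s' := by
  induction h with
  | skip => exact Frame.refl _ _
  | op ho => exact Op.frame _ _
  | seq _ _ ih₁ ih₂ =>
    refine (ih₁.mono ?_ ?_).trans (ih₂.mono ?_ ?_) <;> intro x hx <;>
      simp only [Code.writes, Code.stores, Bool.or_eq_false_iff] at hx
    exacts [hx.1, hx.1, hx.2, hx.2]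
  | ite_pos _ _ ih =>
    refine ih.mono ?_ ?_ <;> intro x hx <;>
      simp only [Code.writes, Code.stores, Bool.or_eq_false_iff] at hx
    exacts [hx.1, hx.1]
  | ite_neg _ _ ih =>
    refine ih.mono ?_ ?_ <;> intro x hx <;>
      simp only [Code.writes, Code.stores, Bool.or_eq_false_iff] at hx
    exacts [hx.2, hx.2]
  | loop_done _ => exact Frame.refl _ _
  | loop_step _ _ _ ih₁ ih₂ => exact (ih₁.mono (fun _ h => h) (fun _ h => h)).trans ih₂

theorem Spec.mono {c : Code R F} {s : Store R F} {T T' : ℕ} {Q Q' : Store R F → Prop}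
    (h : Spec ℓ c s T Q) (hT : T ≤ T') (hQ : ∀ s', Frame c s s' → Q s' → Q' s') :
    Spec ℓ c s T' Q' := by
  obtain ⟨s', t, h1, h2, h3⟩ := h
  exact ⟨s', t, h1, h2.trans hT, hQ s' h1.frame h3⟩

theorem Spec.seq {c d : Code R F} {s : Store R F} {T₁ T₂ : ℕ} {P Q : Store R F → Prop}
    (h₁ : Spec ℓ c s T₁ P) (h₂ : ∀ s', Frame c s s' → P s' → Spec ℓ d s' T₂ Q) :
    Spec ℓ (.seq c d) s (T₁ + T₂) Q := by
  obtain ⟨s₁, t₁, h1, h2, h3⟩ := h₁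
  obtain ⟨s₂, t₂, h4, h5, h6⟩ := h₂ s₁ h1.frame h3
  exact ⟨s₂, t₁ + t₂, h1.seq h4, by omega, h6⟩

/-- The sequential composition in a list, with the time of the first program subtracted from the
time that is left. -/
theorem Spec.cons {c : Code R F} {l : List (Code R F)} {s : Store R F} {T T₁ : ℕ}
    {P Q : Store R F → Prop} (h₁ : Spec ℓ c s T₁ P) (hT : T₁ ≤ T)
    (h₂ : ∀ s', Frame c s s' → P s' → Spec ℓ (Code.block l) s' (T - T₁) Q) :
    Spec ℓ (Code.block (c :: l)) s T Q := by
  have := h₁.seq h₂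
  rwa [Nat.add_sub_cancel' hT] at this

theorem Spec.nil {s : Store R F} {T : ℕ} {Q : Store R F → Prop} (h : Q s) :
    Spec ℓ (Code.block []) s T Q := ⟨s, 0, .skip, Nat.zero_le _, h⟩

theorem Spec.ite {a b : R} {c d : Code R F} {s : Store R F} {T : ℕ} {Q : Store R F → Prop}
    (h₁ : s.reg a < s.reg b → Spec ℓ c s T Q) (h₂ : ¬ s.reg a < s.reg b → Spec ℓ d s T Q) :
    Spec ℓ (.ite a b c d) s (T + 2) Q := by
  by_cases h : s.reg a < s.reg b
  · obtain ⟨s', t, h1, h2, h3⟩ := h₁ h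
    exact ⟨s', _, .ite_pos h h1, by omega, h3⟩
  · obtain ⟨s', t, h1, h2, h3⟩ := h₂ h
    exact ⟨s', _, .ite_neg h h1, by omega, h3⟩

/-- Loops, with an invariant `I` that includes the amount of time that is left for the loop. -/
theorem Spec.loop {a b : R} {c : Code R F} {s : Store R F} {Q : Store R F → Prop}
    (I : ℕ → Store R F → Prop) (n : ℕ) (h0 : I n s)
    (hstep : ∀ n s', Frame c s s' → I n s' → s'.reg a < s'.reg b →
      ∃ T, Spec ℓ c s' T (fun s'' => ∃ n', I n' s'' ∧ n' + T + 2 ≤ n))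
    (hdone : ∀ n s', Frame c s s' → I n s' → ¬ s'.reg a < s'.reg b → Q s') {T : ℕ}
    (hT : n + 2 ≤ T) : Spec ℓ (.loop a b c) s T Q := by
  have key : ∀ n s', Frame c s s' → I n s' → Spec ℓ (.loop a b c) s' (n + 2) Q := by
    intro n
    induction n using Nat.strong_induction_on with
    | _ n ih =>
      intro s' hF hI
      by_cases h : s'.reg a < s'.reg b
      · obtain ⟨T, s₁, t, h1, h2, n', h3, h4⟩ := hstep n s' hF hI h
        obtain ⟨s₂, t₂, h5, h6, h7⟩ := ih n' (by omega) s₁ (hF.trans h1.frame) h3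
        exact ⟨s₂, _, .loop_step h h1 h5, by omega, h7⟩
      · exact ⟨s', 2, .loop_done h, by omega, hdone n s' hF hI h⟩
  exact (key _ s (Frame.refl _ _) h0).mono hT fun _ _ h => h

/-- The weakest precondition of a program without loops. -/
def Code.wp (ℓ : Limits) : Code R F → (Store R F → Prop) → Store R F → Prop
  | .skip, Q, s => Q s
  | .op o, Q, s => o.Ok ℓ s ∧ Q (o.exec s)
  | .seq c d, Q, s => c.wp ℓ (fun s => d.wp ℓ Q s) s
  | .ite a b c d, Q, s => (s.reg a < s.reg b → c.wp ℓ Q s) ∧ (¬ s.reg a < s.reg b → d.wp ℓ Q s)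
  | .loop _ _ _, _, _ => False

theorem Spec.of_wp {c : Code R F} {s : Store R F} {Q : Store R F → Prop} {T : ℕ}
    (h : c.wp ℓ Q s) (hT : c.length ≤ T) : Spec ℓ c s T Q := by
  refine Spec.mono (T := c.length) ?_ hT fun _ _ h => h
  clear hT
  induction c generalizing s Q with
  | skip => exact ⟨s, 0, .skip, le_rfl, h⟩
  | op o => exact ⟨_, _, .op h.1, le_rfl, h.2⟩
  | seq c d hc hd => exact (hc h).seq fun s' _ h' => hd h'
  | ite a b c d hc hd =>
    by_cases hlt : s.reg a < s.reg b
    · obtain ⟨s', t, h1, h2, h3⟩ := hc (h.1 hlt)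
      exact ⟨s', _, .ite_pos hlt h1, by simp only [Code.length]; omega, h3⟩
    · obtain ⟨s', t, h1, h2, h3⟩ := hd (h.2 hlt)
      exact ⟨s', _, .ite_neg hlt h1, by simp only [Code.length]; omega, h3⟩
  | loop a b c _ => exact h.elim

/-! ### The machine program -/

/-- Compute `L = 3 + 3 (n + m)` from the first two input numbers, and the addresses `j * L`, `j ≤
k`, of the arrays. -/
def prologue (k : ℕ) : Program :=
  [.load 5 1, .const 1 1, .load 7 1, .add 5 5 7, .add 7 5 5, .add 5 7 5, .const 1 3, .add 5 5 1] ++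
    (List.range k).map fun j => .add (2 * j + 5) (2 * j + 3) 5

/-- The machine program of a structured program. -/
def Code.program (ir : R → ℕ) (ia : F → ℕ) (k : ℕ) (c : Code R F) : Program :=
  prologue k ++ c.compile ir ia (prologue k).length

/-- The state at the start of a structured program: the input is in the array `f₀`. -/
def Store.initial (f₀ : F) (input : List ℕ) : Store R F where
  reg := fun _ => 0
  arr := fun f i => if f = f₀ then input.getD i 0 else 0

/-- The state of the machine after the prologue, up to register `1`. -/
theorem steps_prologue {c : ℕ → ℕ → ℕ} {M : ℕ} {P : Program} {input : List ℕ} {k : ℕ} {B L : ℕ}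
    (hP : CodeAt P 0 (prologue k)) (hL : L = 3 + 3 * (input.getD 0 0 + input.getD 1 0))
    (hB : k * L + L ≤ B) (hM : 1 + 2 * B.size ≤ M) :
    ∃ σ, Steps (bitCost c) M P (init input) σ (prologue k).length ∧ σ.pc = (prologue k).length ∧
      σ.mem = (init input).mem ∧ (∀ r, σ.reg (2 * r) = 0) ∧ (∀ j ≤ k, σ.reg (2 * j + 3) = j * L) := by
  have hLB : L ≤ B := (Nat.le_add_left _ _).trans hB
  have hs : ∀ x ≤ B, x.size ≤ B.size := fun x hx => Nat.size_le_size hx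
  have hsteps : ∀ {σ : State} {i : Instr}, P[σ.pc]? = some i → bitCost c i σ ≤ 1 + 2 * B.size →
      Steps (bitCost c) M P σ (i.exec σ) 1 := fun h h' => Steps.single h (h'.trans hM)
  have hbound : ∀ x y, x ≤ B → y ≤ B → 1 + x.size + y.size ≤ 1 + 2 * B.size := fun x y hx hy => by
    have := hs x hx
    have := hs y hy
    omega
  set n := input.getD 0 0 with hn
  set m := input.getD 1 0 with hm
  have hget : ∀ (j : ℕ) (i : Instr), (prologue k)[j]? = some i → P[j]? = some i := by
    intro j i h
    obtain ⟨post, hpost⟩ := hP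
    rw [List.drop_zero] at hpost
    rw [hpost, List.getElem?_append_left]
    · exact h
    · exact (List.getElem?_eq_some_iff.1 h).1
  have h8 : ∃ σ, Steps (bitCost c) M P (init input) σ 8 ∧ σ.pc = 8 ∧ σ.mem = (init input).mem ∧
      (∀ r, σ.reg (2 * r) = 0) ∧ σ.reg 3 = 0 ∧ σ.reg 5 = L := by
    have e0 : (0 : ℕ) ≤ B := Nat.zero_le _
    have hst : ∀ {σ : State} (j : ℕ) (i : Instr), σ.pc = j → (prologue k)[j]? = some i →
        bitCost c i σ ≤ 1 + 2 * B.size → Steps (bitCost c) M P σ (i.exec σ) 1 :=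
      fun j i h h' => hsteps (hget _ i (h ▸ h'))
    refine ⟨_, (((((((hst 0 (.load 5 1) rfl rfl ?_).trans (hst 1 (.const 1 1) rfl rfl ?_)).trans
      (hst 2 (.load 7 1) rfl rfl ?_)).trans (hst 3 (.add 5 5 7) rfl rfl ?_)).trans
      (hst 4 (.add 7 5 5) rfl rfl ?_)).trans (hst 5 (.add 5 7 5) rfl rfl ?_)).trans
      (hst 6 (.const 1 3) rfl rfl ?_)).trans (hst 7 (.add 5 5 1) rfl rfl ?_), rfl, rfl,
      ?_, ?_, ?_⟩ <;>
      simp only [Instr.exec, State.assign, init, bitCost, Function.update_apply,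
        Nat.reduceEqDiff, if_true, if_false, ← hn, ← hm]
    · exact hbound _ _ e0 (by omega)
    · exact (Nat.le_add_right _ _).trans (hbound 1 0 (by omega) e0)
    · exact hbound _ _ (by omega) (by omega)
    · exact hbound _ _ (by omega) (by omega)
    · exact hbound _ _ (by omega) (by omega)
    · exact hbound _ _ (by omega) (by omega)
    · exact (Nat.le_add_right _ _).trans (hbound 3 0 (by omega) e0)
    · exact hbound _ _ (by omega) (by omega)
    · intro r
      have h1 : 2 * r ≠ 1 := by omega
      have h2 : 2 * r ≠ 5 := by omega
      have h3 : 2 * r ≠ 7 := by omega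
      simp [h1, h2, h3]
    · omega
  have hk : ∀ j ≤ k, ∃ σ, Steps (bitCost c) M P (init input) σ (8 + j) ∧ σ.pc = 8 + j ∧
      σ.mem = (init input).mem ∧ (∀ r, σ.reg (2 * r) = 0) ∧ (∀ i ≤ j, σ.reg (2 * i + 3) = i * L) ∧
      σ.reg 5 = L := by
    intro j
    induction j with
    | zero =>
      intro _
      obtain ⟨σ, h1, h2, h3, h4, h5, h6⟩ := h8
      refine ⟨σ, h1, h2, h3, h4, fun i hi => ?_, h6⟩
      obtain rfl : i = 0 := by omega
      rw [zero_mul]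
      exact h5
    | succ j ih =>
      intro hj
      obtain ⟨σ, h1, h2, h3, h4, h5, h6⟩ := ih (by omega)
      have hi : (prologue k)[8 + j]? = some (.add (2 * j + 5) (2 * j + 3) 5) := by
        unfold prologue
        rw [List.getElem?_append_right (by simp), List.getElem?_map]
        simp [show j < k from hj]
      have hjL : j * L + L ≤ B := by
        have := Nat.mul_le_mul_right L (show j ≤ k by omega)
        omega
      refine ⟨_, h1.trans (hsteps (hget _ _ (h2 ▸ hi)) ?_), ?_, ?_, ?_, ?_, ?_⟩
      · simp only [bitCost, h5 j le_rfl, h6]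
        exact hbound _ _ (by omega) hLB
      · simp only [Instr.exec, State.assign, h2]
        omega
      · exact h3
      · intro r
        have : 2 * r ≠ 2 * j + 5 := by omega
        simp only [Instr.exec, State.assign, Function.update_of_ne this, h4]
      · intro i hi
        by_cases hij : i = j + 1
        · subst hij
          simp only [Instr.exec, State.assign, h5 j le_rfl, h6]
          rw [show 2 * (j + 1) + 3 = 2 * j + 5 by ring, Function.update_self, Nat.succ_mul]
        · have : 2 * i + 3 ≠ 2 * j + 5 := by omega
          simp only [Instr.exec, State.assign, Function.update_of_ne this, h5 i (by omega)]
      · by_cases hj0 : j = 0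
        · subst hj0
          simp only [Instr.exec, State.assign, mul_zero, zero_add, Function.update_self, h6]
          have := h5 0 le_rfl
          simp only [mul_zero, zero_add, zero_mul] at this
          rw [this, zero_add]
        · have : 5 ≠ 2 * j + 5 := by omega
          simp only [Instr.exec, State.assign, Function.update_of_ne this, h6]
  have hlen : (prologue k).length = 8 + k := by simp [prologue]; omega
  obtain ⟨σ, h1, h2, h3, h4, h5, -⟩ := hk k le_rfl
  rw [hlen]
  exact ⟨σ, h1, h2, h3, h4, h5⟩

/-- The machine program computes what the structured program computes, within the same time up
to a constant. -/
theorem Spec.computesWithin {ir : R → ℕ} {ia : F → ℕ} (hir : Function.Injective ir)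
    (hia : Function.Injective ia) {k : ℕ} (hk : ∀ f, ia f ≤ k) {f₀ : F} (hf₀ : ia f₀ = 0) {r₀ : R}
    (hr₀ : ir r₀ = 0) {p : Code R F} {input : List ℕ} {T output : ℕ} {ℓ : Limits}
    (hlen : ℓ.len = 3 + 3 * (input.getD 0 0 + input.getD 1 0)) (hinput : input.length ≤ ℓ.len)
    (hin : ∀ x ∈ input, x ≤ ℓ.big) (hbig : (k + 1) * ℓ.len ≤ ℓ.big)
    (h : Spec ℓ p (Store.initial f₀ input) T fun s => s.reg r₀ = output) :
    ComputesWithin unitCost (p.program ir ia k) input output (8 + k + T) ∧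
    ∀ c, IsDivisionCost c →
      ComputesWithin (bitCost c) (p.program ir ia k) input output ((8 + k + T) * ℓ.cost c) := by
  obtain ⟨s', t, hrun, ht, hout⟩ := h
  have hplen : (prologue k).length = 8 + k := by simp [prologue]; omega
  have key : ∀ c, IsDivisionCost c → ∃ σ, Steps (bitCost c) (ℓ.cost c) (p.program ir ia k)
      (init input) σ (8 + k + t) ∧ (p.program ir ia k).length ≤ σ.pc ∧ σ.reg 0 = output := by
    intro c hc
    have hP : CodeAt (p.program ir ia k) 0
        (prologue k ++ p.compile ir ia (prologue k).length) := ⟨[], by simp [Code.program]⟩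
    obtain ⟨σ, h1, h2, h3, h4, h5⟩ := steps_prologue (c := c) (M := ℓ.cost c) (B := ℓ.big) hP.left
      hlen (by rw [Nat.succ_mul] at hbig; exact hbig) (Nat.le_add_right _ _)
    have hrep : Represents ir ia ℓ (Store.initial f₀ input) σ := by
      refine ⟨fun r => h4 _, fun f => h5 _ (hk f), fun f i hi => ?_, fun r => Nat.zero_le _,
        fun f i hi => ?_⟩
      · rw [h3]
        show input.getD (ia f * ℓ.len + i) 0 = if f = f₀ then input.getD i 0 else 0
        split_ifs with hf
        · rw [hf, hf₀, zero_mul, zero_add]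
        · have hpos : 1 ≤ ia f := Nat.one_le_iff_ne_zero.2 fun h => hf (hia (h.trans hf₀.symm))
          have := Nat.mul_le_mul_right ℓ.len hpos
          rw [List.getD_eq_default _ _ (by omega)]
      · show (if f = f₀ then input.getD i 0 else 0) ≤ _
        split_ifs
        · rw [List.getD_eq_getElem?_getD]
          rcases hx : input[i]? with _ | x
          · exact Nat.zero_le _
          · exact hin _ (List.mem_of_getElem? hx)
        · exact Nat.zero_le _
    have hP2 := hP.right
    rw [zero_add] at hP2
    obtain ⟨σ', h6, h7, h8⟩ := hrun.simulate hir hia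
      (fun f => le_trans (Nat.mul_le_mul_right _ (Nat.succ_le_succ (hk f))) hbig) hc hP2 hrep h2
    refine ⟨σ', ?_, ?_, ?_⟩
    · rw [hplen] at h1
      exact h1.trans h6
    · rw [h8, Code.program, List.length_append, Code.length_compile]
    · rw [← hout, ← h7.reg, hr₀]
  constructor
  · obtain ⟨σ, h1, h2, h3⟩ := key (fun a b => a.size + b.size)
      ⟨fun a a' b b' h h' => Nat.add_le_add (Nat.size_le_size h) (Nat.size_le_size h'),
        fun _ _ => le_rfl⟩
    refine ⟨8 + k + t, ?_, ?_, ?_⟩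
    · rw [h1.1]
      exact h2
    · rw [h1.1]
      exact h3
    · calc _ ≤ ∑ _i ∈ Finset.range (8 + k + t), 1 := Finset.sum_le_sum fun i _ => by
            unfold stepCost unitCost
            split <;> omega
        _ ≤ 8 + k + T := by simp; omega
  · intro c hc
    obtain ⟨σ, h1, h2, h3⟩ := key c hc
    refine ⟨8 + k + t, ?_, ?_, h1.sum_le.trans (Nat.mul_le_mul_right _ (by omega))⟩
    · rw [h1.1]
      exact h2
    · rw [h1.1]
      exact h3

end RAM

/-! ### The program -/

namespace RAM.Code

variable {R F : Type}

/-- `d := k`. -/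
abbrev set (d : R) (k : ℕ) : Code R F := .op (.const d k)
/-- `d := a + b`. -/
abbrev add (d a b : R) : Code R F := .op (.add d a b)
/-- `d := a - b`. -/
abbrev sub (d a b : R) : Code R F := .op (.sub d a b)
/-- `d := a * b`. -/
abbrev mul (d a b : R) : Code R F := .op (.mul d a b)
/-- `d := a / b`. -/
abbrev div (d a b : R) : Code R F := .op (.div d a b)
/-- `d := f[a]`. -/
abbrev load (d : R) (f : F) (a : R) : Code R F := .op (.load d f a)
/-- `f[a] := b`. -/
abbrev store (f : F) (a b : R) : Code R F := .op (.store f a b)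

end RAM.Code

namespace RotorSolver

open RAM RAM.Code

/-- The registers of the program. -/
inductive Reg where
  -- the output, constants, and the header of the input
  | out | zero | one | two | three | n | m | root
  -- auxiliary registers
  | i | p | x | y | z | f
  -- a vertex, its parent, its first arc and its degree; a child, an arc, a counter
  | v | u | a | d | w | e | k
  -- the number of vertices found, the number of them that are not yet evaluated, the threshold
  | len | rest | t
  -- the least number of full turns, the number of returns in these turns
  | q | qs | base
  -- the window: the number of starts that are left, its two ends, the last vertex in it
  | c | es | ep | lw
  -- the owner of the vertex, the best outcome, the current outcome
  | own | br | bb | cb | cr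
  -- sorting and searching
  | num | flag | wd | lo | mid | hi | ia | ja | ka | kt
deriving DecidableEq

/-- The arrays of the program. -/
inductive Arr where
  -- the input, and its parts
  | input | kind | val | hd | nx | st | deg
  -- the tree: marks of the vertices found, their parents, the list of these vertices
  | vis | par | que
  -- the outcomes
  | flow | win
  -- for the neighbours of a vertex: the number of arcs that lead there, the number of those in the
  -- window, and quotient and remainder of the flow
  | cnt | rcv | quo | rem
  -- sorting
  | srt | tmp | pow
deriving DecidableEq

open Reg Arr

/-- Copy the data of the vertices into separate arrays. -/
def loadVertices : Code Reg Arr :=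
  loop i n (block [
    load x input p, store kind i x, add p p one,
    load x input p, store val i x, add p p one,
    load x input p, store st i x, add p p one,
    add i i one])

/-- Copy the data of the arcs into separate arrays, compute the outdegrees, and choose an arc at
each vertex of a player. -/
def loadArcs : Code Reg Arr :=
  loop i m (block [
    load v input p, add p p one,
    load x input p, store hd i x, add p p one,
    load x input p, store nx i x, add p p one,
    load x deg v, add x x one, store deg v x,
    load x kind v, ite zero x (store st v i) skip,
    add i i one])

/-- Read the input. -/
def loadGame : Code Reg Arr :=
  block [
    block [set zero 0, set one 1, set two 2, set three 3,
      load n input zero, load m input one, load root input two, set p 3, set i 0],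
    loadVertices, set i 0, loadArcs]

/-- Find the heads of the arcs that leave the current vertex; the rotor order serves as the list of
these arcs. -/
def expand : Code Reg Arr :=
  loop zero k (block [
    load w hd e, load x vis w,
    ite zero x skip (block [store vis w one, store par w v, store que len w, add len len one]),
    load e nx e, sub k k one])

/-- Find the vertices that can be reached from the root, and their parents, in breadth-first
order.  Vertices that can only be reached against the direction of an arc are not visited by the
particle, and need not be found. -/
def search : Code Reg Arr :=
  block [
    block [set i 0, store vis root one, store par root root, store que i root, add len zero one],
    loop i len (block [
      block [load v que i, load x kind v],
      ite x three (block [block [load e st v, load k deg v], expand]) skip,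
      add i i one])]

/-- Visit the arcs of the current vertex, from its chosen arc on. -/
def cycle (body : Code Reg Arr) : Code Reg Arr :=
  block [block [add e a zero, add k d zero],
    loop zero k (block [load w hd e, body, load e nx e, sub k k one])]

/-- Count the arcs that lead to each neighbour. -/
def countArcs : Code Reg Arr :=
  block [
    block [store cnt u zero, store rcv u zero, store quo u zero],
    cycle (block [store cnt w zero, store rcv w zero, store quo w zero]),
    cycle (block [load x cnt w, add x x one, store cnt w x])]

/-- For each child with a positive flow: the number of full turns before its capture (plus one), and
the position of the capture within the next turn. -/
def divideFlows : Code Reg Arr :=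
  block [set qs 0,
    cycle (block [
      load x flow w, sub y w u, sub z u w, add y y z,
      ite zero y
        (ite zero x
          (block [sub x x one, load y cnt w, div q x y, mul z q y, sub x x z, store rem w x,
            add q q one, store quo w q,
            ite zero qs (ite q qs (add qs q zero) skip) (add qs q zero)])
          skip)
        skip])]

/-- Is the last vertex in the window a child that captures the particle? -/
def testWindow : Code Reg Arr :=
  block [load x quo lw, set f 0,
    ite zero x (ite qs x skip
      (block [load y rem lw, load z rcv lw, ite y z (set f 1) skip])) skip]

/-- Compare the outcome for the current start with the best one. -/
def recordOutcome : Code Reg Arr :=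
  block [load cb win lw, load x rcv u, add x base x, add cr x one, set f 0,
    ite zero br
      (ite bb cb (add f own zero)
        (ite cb bb (sub f one own)
          (block [sub y cb own, sub z own cb, add y y z,
            ite zero y (ite br cr (set f 1) skip) (ite cr br (set f 1) skip)])))
      (set f 1),
    ite zero f (block [add bb cb zero, add br cr zero]) skip]

/-- Remove the first arc of the window. -/
def shrinkWindow : Code Reg Arr :=
  block [load w hd es, load x rcv w, sub x x one, store rcv w x, load es nx es, sub c c one]

/-- Add an arc to the window. -/
def growWindow : Code Reg Arr :=
  block [load lw hd ep, load x rcv lw, add x x one, store rcv lw x, load ep nx ep]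

/-- The best outcome over all possible starts of the rotor. For the start `i`, the particle is
captured within the turn number `qs` by the first arc that completes a window from `i`; the end of
this window moves forward with `i`, so that two runs through the arcs are enough. -/
def slideWindow : Code Reg Arr :=
  block [
    block [sub q qs one, load x cnt u, mul base q x, load own kind v,
      ite zero own (add c d zero) (add c one zero),
      ite own two skip (set own 0),
      set br 0, set bb 0, add es a zero, add ep a zero, add lw u zero],
    loop zero c (block [testWindow,
      ite zero f (block [recordOutcome, shrinkWindow]) growWindow]),
    block [store flow v br, store win v bb]]

/-- Compute the outcome of a vertex that is not a sink. -/
def evalNode : Code Reg Arr :=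
  block [
    block [load u par v, load a st v, load d deg v],
    countArcs, divideFlows,
    ite zero qs slideWindow (block [store flow v zero, store win v zero])]

/-- Compute the outcomes for the threshold `t`, from the leaves to the root. -/
def solve : Code Reg Arr :=
  block [add rest len zero,
    loop zero rest (block [
      block [sub rest rest one, load v que rest, load x kind v],
      ite x three evalNode
        (block [store flow v one, load x val v, ite x t (store win v zero) (store win v one)])])]

/-- List the values of the sinks, and test whether they are at most `1`. -/
def collect : Code Reg Arr :=
  block [
    block [set i 0, set num 0, set flag 0],
    loop i n (block [load x kind i,
      ite x three skip (block [load x val i, store srt num x, add num num one,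
        ite one x (set flag 1) skip]),
      add i i one])]

/-- Merge the two blocks that start at `ia = lo` and `ja = mid` and end at `mid` and `hi`. -/
def mergeBlocks : Code Reg Arr :=
  loop ka hi (block [set f 0,
    ite ia mid (ite ja hi (block [load x srt ia, load y srt ja, ite y x skip (set f 1)])
      (set f 1)) skip,
    ite zero f (block [load x srt ia, add ia ia one]) (block [load x srt ja, add ja ja one]),
    store tmp ka x, add ka ka one])

/-- Merge all pairs of neighbouring blocks of length `wd`. -/
def mergePass : Code Reg Arr :=
  block [
    set lo 0,
    loop lo num (block [
      block [add mid lo wd, ite num mid (add mid num zero) skip,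
        add hi mid wd, ite num hi (add hi num zero) skip,
        add ia lo zero, add ja mid zero, add ka lo zero],
      mergeBlocks, add lo hi zero]),
    set i 0,
    loop i num (block [load x tmp i, store srt i x, add i i one])]

/-- Merge sort, with a table of the powers of two that are used. -/
def sort : Code Reg Arr :=
  block [
    block [set wd 1, set kt 0],
    loop wd num (block [block [store pow kt wd, add kt kt one], mergePass, add wd wd wd])]

/-- Binary search for the value of the game among the sorted values of the sinks.  The step is taken
from the table of powers of two: a division by two could be charged more than the cost of
dividing the flows. -/
def binarySearch : Code Reg Arr :=
  block [
    set lo 0,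
    loop zero kt (block [
      block [sub kt kt one, load x pow kt, add hi lo x],
      ite hi num (block [load t srt hi, solve,
        block [load x win root, ite zero x (add lo hi zero) skip]]) skip]),
    load out srt lo]

/-- The whole program. In a binary game, the value is the outcome of the root for the threshold `1`.
-/
def main : Code Reg Arr :=
  block [loadGame, search, collect,
    ite zero flag (block [sort, binarySearch])
      (block [add t one zero, solve, load out win root])]

end RotorSolver

/-! ### Reading the input -/

namespace RotorSolver

open RAM RAM.Code

variable {ℓ : Limits}

theorem spec_loadVertices {s : Store Reg Arr} {n m : ℕ} (hlen : ℓ.len = 3 + 3 * (n + m))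
    (hbig : 20 * ℓ.len ≤ ℓ.big) (h1 : s.reg .one = 1) (hn : s.reg .n = n) (hp : s.reg .p = 3)
    (hi : s.reg .i = 0) :
    Spec ℓ loadVertices s (25 * n + 2) fun s' => s'.reg .p = 3 + 3 * n ∧
      ∀ v < n, s'.arr .kind v = s.arr .input (3 + 3 * v) ∧
        s'.arr .val v = s.arr .input (3 + 3 * v + 1) ∧
        s'.arr .st v = s.arr .input (3 + 3 * v + 2) := by
  refine Spec.loop (fun k s' => ∃ j ≤ n, s'.reg .i = j ∧ s'.reg .p = 3 + 3 * j ∧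
    (∀ v < j, s'.arr .kind v = s.arr .input (3 + 3 * v) ∧
        s'.arr .val v = s.arr .input (3 + 3 * v + 1) ∧
        s'.arr .st v = s.arr .input (3 + 3 * v + 2)) ∧ k = 25 * (n - j)) (25 * n)
    ⟨0, Nat.zero_le _, hi, hp, fun v hv => absurd hv (Nat.not_lt_zero v), rfl⟩ ?_ ?_ le_rfl
  · rintro k s' hF ⟨j, hj, hi', hp', hinv, rfl⟩ hlt
    have e1 : s'.reg .one = 1 := (hF.1 _ rfl).trans h1
    have en : s'.reg .n = n := (hF.1 _ rfl).trans hn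
    have ein : s'.arr .input = s.arr .input := hF.2 _ rfl
    rw [hi', en] at hlt
    refine ⟨23, Spec.of_wp ?_ (by decide)⟩
    simp only [block, Code.wp, Op.Ok, Op.exec, Function.update_apply, reduceCtorEq, if_true, if_false,
      hp', hi', e1, ein]
    refine ⟨by omega, by omega, by omega, by omega, by omega, by omega, by omega, by omega, by omega,
      by omega, 25 * (n - (j + 1)), ⟨j + 1, by omega, rfl, by omega, fun v hv => ?_, rfl⟩, by omega⟩
    by_cases hvj : v = j
    · subst hvj
      simp
    · simp only [hvj, if_false]
      exact hinv v (by omega)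
  · rintro k s' hF ⟨j, hj, hi', hp', hinv, rfl⟩ hlt
    rw [hi', (hF.1 _ rfl).trans hn] at hlt
    obtain rfl : j = n := by omega
    exact ⟨hp', hinv⟩

theorem spec_loadArcs {s : Store Reg Arr} {n m : ℕ} (hlen : ℓ.len = 3 + 3 * (n + m))
    (hbig : 20 * ℓ.len ≤ ℓ.big) (h0 : s.reg .zero = 0) (h1 : s.reg .one = 1) (hm : s.reg .m = m)
    (hp : s.reg .p = 3 + 3 * n) (hi : s.reg .i = 0) (hdeg : ∀ v, s.arr .deg v = 0)
    (htail : ∀ a < m, s.arr .input (3 + 3 * n + 3 * a) < n) :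
    Spec ℓ loadArcs s (32 * m + 2) fun s' =>
      (∀ a < m, s'.arr .hd a = s.arr .input (3 + 3 * n + 3 * a + 1) ∧
        s'.arr .nx a = s.arr .input (3 + 3 * n + 3 * a + 2)) ∧
      ∀ v, s'.arr .deg v = Nat.count (fun a => s.arr .input (3 + 3 * n + 3 * a) = v) m ∧
        (s.arr .kind v = 0 → s'.arr .st v = s.arr .st v) ∧
        (0 < s.arr .kind v → (∃ a < m, s.arr .input (3 + 3 * n + 3 * a) = v) →
          ∃ a < m, s.arr .input (3 + 3 * n + 3 * a) = v ∧ s'.arr .st v = a) := by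
  refine Spec.loop (fun k s' => ∃ j ≤ m, s'.reg .i = j ∧ s'.reg .p = 3 + 3 * n + 3 * j ∧
    (∀ a < j, s'.arr .hd a = s.arr .input (3 + 3 * n + 3 * a + 1) ∧
        s'.arr .nx a = s.arr .input (3 + 3 * n + 3 * a + 2)) ∧
    (∀ v, s'.arr .deg v = Nat.count (fun a => s.arr .input (3 + 3 * n + 3 * a) = v) j ∧
        (s.arr .kind v = 0 → s'.arr .st v = s.arr .st v) ∧
        (0 < s.arr .kind v → (∃ a < j, s.arr .input (3 + 3 * n + 3 * a) = v) →
          ∃ a < j, s.arr .input (3 + 3 * n + 3 * a) = v ∧ s'.arr .st v = a)) ∧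
    k = 32 * (m - j)) (32 * m) ⟨0, Nat.zero_le _, hi, hp, fun v hv => absurd hv (Nat.not_lt_zero v),
      fun v => ⟨by simp [hdeg], fun _ => rfl, fun _ ⟨a, ha, _⟩ => absurd ha (Nat.not_lt_zero a)⟩,
      rfl⟩ ?_ ?_ le_rfl
  · rintro k s' hF ⟨j, hj, hi', hp', hinv, hinv', rfl⟩ hlt
    have e0 : s'.reg .zero = 0 := (hF.1 _ rfl).trans h0
    have e1 : s'.reg .one = 1 := (hF.1 _ rfl).trans h1
    have em : s'.reg .m = m := (hF.1 _ rfl).trans hm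
    have ein : s'.arr .input = s.arr .input := hF.2 _ rfl
    have ekind : s'.arr .kind = s.arr .kind := hF.2 _ rfl
    rw [hi', em] at hlt
    have ht := htail j hlt
    have hcount := (hinv' (s.arr .input (3 + 3 * n + 3 * j))).1
    have hle : Nat.count (fun a => s.arr .input (3 + 3 * n + 3 * a) =
      s.arr .input (3 + 3 * n + 3 * j)) j ≤ j := Nat.count_le _
    refine ⟨30, Spec.of_wp ?_ (by decide)⟩
    simp only [block, Code.wp, Op.Ok, Op.exec, Function.update_apply, reduceCtorEq, if_true, if_false,
      hp', hi', e0, e1, ein, ekind, hcount]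
    refine ⟨by omega, by omega, by omega, by omega, by omega, by omega, by omega, by omega, by omega,
      by omega, by omega, by omega, fun hk => ⟨by omega, by omega, 32 * (m - (j + 1)),
        ⟨j + 1, by omega, rfl, by omega, fun a ha => ?_, fun v => ⟨?_, fun hv => ?_, fun hv hex => ?_⟩,
          rfl⟩, by omega⟩,
      fun hk => ⟨by omega, 32 * (m - (j + 1)),
        ⟨j + 1, by omega, rfl, by omega, fun a ha => ?_, fun v => ⟨?_, fun hv => ?_, fun hv hex => ?_⟩,
          rfl⟩, by omega⟩⟩
    · by_cases haj : a = j
      · subst haj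
        simp
      · simp only [haj, if_false]
        exact hinv a (by omega)
    · rw [Nat.count_succ]
      by_cases hv : v = s.arr .input (3 + 3 * n + 3 * j)
      · simp [← hv]
      · simp only [hv, if_false, Ne.symm hv, add_zero]
        exact (hinv' v).1
    · have hne : v ≠ s.arr .input (3 + 3 * n + 3 * j) := by
        rintro rfl
        omega
      simp only [hne, if_false]
      exact (hinv' v).2.1 hv
    · by_cases hvj : v = s.arr .input (3 + 3 * n + 3 * j)
      · exact ⟨j, by omega, hvj.symm, by rw [if_pos hvj]⟩
      · obtain ⟨a, ha, hav⟩ := hex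
        have haj : a ≠ j := by
          rintro rfl
          exact hvj hav.symm
        obtain ⟨b, hb, hbv, hst⟩ := (hinv' v).2.2 hv ⟨a, by omega, hav⟩
        exact ⟨b, by omega, hbv, by rw [if_neg hvj, hst]⟩
    · by_cases haj : a = j
      · subst haj
        simp
      · simp only [haj, if_false]
        exact hinv a (by omega)
    · rw [Nat.count_succ]
      by_cases hv : v = s.arr .input (3 + 3 * n + 3 * j)
      · simp [← hv]
      · simp only [hv, if_false, Ne.symm hv, add_zero]
        exact (hinv' v).1
    · exact (hinv' v).2.1 hv
    · obtain ⟨a, ha, hav⟩ := hex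
      have haj : a ≠ j := by
        rintro rfl
        rw [hav] at hk
        exact hk hv
      obtain ⟨b, hb, hbv, hst⟩ := (hinv' v).2.2 hv ⟨a, by omega, hav⟩
      exact ⟨b, by omega, hbv, hst⟩
  · rintro k s' hF ⟨j, hj, hi', hp', hinv, hinv', rfl⟩ hlt
    rw [hi', (hF.1 _ rfl).trans hm] at hlt
    obtain rfl : j = m := by omega
    exact ⟨hinv, hinv'⟩

end RotorSolver

namespace RotorGame

theorem getElem?_flatMap_three {α : Type*} (f : α → List ℕ) (hf : ∀ x, (f x).length = 3) (l : List α)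
    {i j : ℕ} (hi : i < l.length) (hj : j < 3) : (l.flatMap f)[3 * i + j]? = (f l[i])[j]? := by
  induction l generalizing i with
  | nil => exact absurd hi (Nat.not_lt_zero i)
  | cons x l ih =>
    rw [List.flatMap_cons]
    cases i with
    | zero =>
      rw [List.getElem?_append_left (by rw [hf]; omega)]
      simp
    | succ i =>
      rw [List.getElem?_append_right (by rw [hf]; omega), hf,
        show 3 * (i + 1) + j - 3 = 3 * i + j by omega]
      exact ih (by simpa using hi)

theorem length_flatMap_three {α : Type*} (f : α → List ℕ) (hf : ∀ x, (f x).length = 3) (l : List α) :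
    (l.flatMap f).length = 3 * l.length := by
  induction l with
  | nil => rfl
  | cons x l ih =>
    rw [List.flatMap_cons, List.length_append, hf, ih, List.length_cons]
    omega

variable {n m : ℕ} (G : RotorGame (Fin n) (Fin m)) (u₀ : Fin n)

open Classical in
/-- The three numbers that describe a vertex in the input. -/
noncomputable def vertexCode (v : Fin n) : List ℕ :=
  [if v ∈ G.maxVerts then 1 else if v ∈ G.minVerts then 2 else if v ∈ G.sinks then 3 else 0,
   if h : v ∈ G.sinks then G.val ⟨v, h⟩ else 0,
   if h : v ∈ G.rotorVerts then ((G.rho ⟨v, h⟩).1 : Fin m).val else 0]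

open Classical in
/-- The three numbers that describe an arc in the input. -/
noncomputable def arcCode (a : Fin m) : List ℕ :=
  [(G.tail a).val, (G.head a).val, if G.tail a ∈ G.sinks then 0 else (G.next a).val]

theorem encode_eq : G.encode u₀ = [n, m, u₀.val] ++
    ((List.finRange n).flatMap G.vertexCode ++ (List.finRange m).flatMap G.arcCode) := by
  rw [← List.append_assoc]
  rfl

theorem length_encode : (G.encode u₀).length = 3 + 3 * (n + m) := by
  rw [encode_eq, List.length_append, List.length_append, length_flatMap_three _ fun _ => rfl,
    length_flatMap_three _ fun _ => rfl, List.length_finRange, List.length_finRange]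
  simp only [List.length_cons, List.length_nil]
  omega

theorem encode_vertex (v : Fin n) {j : ℕ} (hj : j < 3) :
    (G.encode u₀).getD (3 + 3 * v + j) 0 = (G.vertexCode v).getD j 0 := by
  rw [encode_eq, List.getD_eq_getElem?_getD, List.getD_eq_getElem?_getD,
    List.getElem?_append_right (by simp only [List.length_cons, List.length_nil]; omega),
    List.getElem?_append_left, show 3 + 3 * v.val + j - [n, m, u₀.val].length = 3 * v.val + j by
      simp only [List.length_cons, List.length_nil]; omega,
    getElem?_flatMap_three _ (fun _ => rfl) _ (by simp) hj]
  · simp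
  · rw [length_flatMap_three _ fun _ => rfl, List.length_finRange]
    simp only [List.length_cons, List.length_nil]
    omega

theorem encode_arc (a : Fin m) {j : ℕ} (hj : j < 3) :
    (G.encode u₀).getD (3 + 3 * n + 3 * a + j) 0 = (G.arcCode a).getD j 0 := by
  rw [encode_eq, List.getD_eq_getElem?_getD, List.getD_eq_getElem?_getD,
    List.getElem?_append_right (by simp only [List.length_cons, List.length_nil]; omega),
    List.getElem?_append_right]
  · rw [length_flatMap_three _ fun _ => rfl, List.length_finRange,
      show 3 + 3 * n + 3 * a.val + j - [n, m, u₀.val].length - 3 * n = 3 * a.val + j by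
        simp only [List.length_cons, List.length_nil]; omega,
      getElem?_flatMap_three _ (fun _ => rfl) _ (by simp) hj]
    simp
  · rw [length_flatMap_three _ fun _ => rfl, List.length_finRange]
    simp only [List.length_cons, List.length_nil]
    omega

/-- All numbers in the input are at most `n + m + 3` or values of sinks. -/
theorem le_of_mem_encode {B : ℕ} (hB : n + m + 3 ≤ B) (hval : ∀ s, G.val s ≤ B) {x : ℕ}
    (hx : x ∈ G.encode u₀) : x ≤ B := by
  have hfin : ∀ {k : ℕ} (i : Fin k), i.val < k := fun i => i.2
  rw [encode_eq] at hx
  simp only [List.mem_append, List.mem_cons, List.not_mem_nil, or_false, List.mem_flatMap,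
    List.mem_finRange, true_and, vertexCode, arcCode] at hx
  rcases hx with (rfl | rfl | rfl) | ⟨v, rfl | rfl | rfl⟩ | ⟨a, rfl | rfl | rfl⟩
  · omega
  · omega
  · have := u₀.2
    omega
  · split_ifs <;> omega
  · split_ifs with h
    · exact hval _
    · omega
  · split_ifs with h
    · have := ((G.rho ⟨v, h⟩).1 : Fin m).2
      omega
    · omega
  · have := (G.tail a).2
    omega
  · have := (G.head a).2
    omega
  · split_ifs with h
    · omega
    · have := (G.next a).2
      omega

end RotorGame

namespace RotorSolver

open RAM RAM.Code RotorGraph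

variable {n m : ℕ} {G : RotorGame (Fin n) (Fin m)} {root : Fin n}

/-- The registers and arrays contain the game. -/
structure Loaded (G : RotorGame (Fin n) (Fin m)) (root : Fin n) (s : Store Reg Arr) : Prop where
  zero : s.reg .zero = 0
  one : s.reg .one = 1
  two : s.reg .two = 2
  three : s.reg .three = 3
  reg_n : s.reg .n = n
  reg_root : s.reg .root = root
  kind_sink : ∀ v : Fin n, s.arr .kind v < 3 ↔ v ∉ G.sinks
  kind_max : ∀ v : Fin n, v ∉ G.sinks → (s.arr .kind v = 1 ↔ G.owner v = true)
  kind_rotor : ∀ v : Fin n, v ∉ G.sinks → (s.arr .kind v = 0 ↔ v ∈ G.rotorVerts)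
  val : ∀ (v : Fin n) (h : v ∈ G.sinks), s.arr .val v = G.val ⟨v, h⟩
  head : ∀ a : Fin m, s.arr .hd a = G.head a
  next : ∀ a : Fin m, G.tail a ∉ G.sinks → s.arr .nx a = G.next a
  start : ∀ v : Fin n, v ∉ G.sinks → ∃ a : Fin m, a ∈ G.choices v ∧ s.arr .st v = a
  deg : ∀ v : Fin n, s.arr .deg v = G.outDegree v

theorem Loaded.frame {c : Code Reg Arr} {s s' : Store Reg Arr} (h : Loaded G root s)
    (hF : Frame c s s')
    (hr : ∀ r ∈ [Reg.zero, .one, .two, .three, .n, .root], c.writes r = false)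
    (hf : ∀ f ∈ [Arr.kind, .val, .hd, .nx, .st, .deg], c.stores f = false) : Loaded G root s' := by
  simp only [List.forall_mem_cons, List.not_mem_nil, false_implies, implies_true, and_true] at hr hf
  obtain ⟨r1, r2, r3, r4, r5, r6⟩ := hr
  obtain ⟨f1, f2, f3, f4, f5, f6⟩ := hf
  constructor
  · rw [hF.1 _ r1, h.zero]
  · rw [hF.1 _ r2, h.one]
  · rw [hF.1 _ r3, h.two]
  · rw [hF.1 _ r4, h.three]
  · rw [hF.1 _ r5, h.reg_n]
  · rw [hF.1 _ r6, h.reg_root]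
  · rw [hF.2 _ f1]; exact h.kind_sink
  · rw [hF.2 _ f1]; exact h.kind_max
  · rw [hF.2 _ f1]; exact h.kind_rotor
  · rw [hF.2 _ f2]; exact h.val
  · rw [hF.2 _ f3]; exact h.head
  · rw [hF.2 _ f4]; exact h.next
  · rw [hF.2 _ f5]; exact h.start
  · rw [hF.2 _ f6]; exact h.deg

theorem outDegree_eq_count {f : ℕ → ℕ} (hf : ∀ a : Fin m, f a = G.tail a) (v : Fin n) :
    G.outDegree v = Nat.count (fun a => f a = v) m := by
  classical
  unfold outDegree
  rw [Nat.count_eq_card_filter_range, Set.ncard_eq_toFinset_card',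
    ← Finset.card_map Fin.valEmbedding]
  congr 1
  ext a
  simp only [Finset.mem_map, Set.mem_toFinset, Set.mem_ofPred_eq, Fin.valEmbedding_apply,
    Finset.mem_filter, Finset.mem_range]
  constructor
  · rintro ⟨b, rfl, rfl⟩
    exact ⟨b.2, hf b⟩
  · rintro ⟨ha, hav⟩
    exact ⟨⟨a, ha⟩, Fin.ext ((hf ⟨a, ha⟩).symm.trans hav), rfl⟩

variable {ℓ : Limits}

theorem spec_loadGame (hexit : G.toRotorGraph.Stopping) (hlen : ℓ.len = 3 + 3 * (n + m))
    (hbig : 20 * ℓ.len ≤ ℓ.big) :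
    Spec ℓ loadGame (Store.initial .input (G.encode root)) (32 * (n + m) + 40) fun s =>
      Loaded G root s ∧ ∀ i, s.arr .vis i = 0 := by
  have g0 : (G.encode root).getD 0 0 = n := rfl
  have g1 : (G.encode root).getD 1 0 = m := rfl
  have g2 : (G.encode root).getD 2 0 = root := rfl
  refine Spec.cons (T₁ := 14) (P := fun s => s.reg .zero = 0 ∧ s.reg .one = 1 ∧ s.reg .two = 2 ∧
    s.reg .three = 3 ∧ s.reg .n = n ∧ s.reg .m = m ∧ s.reg .root = root ∧ s.reg .p = 3 ∧
    s.reg .i = 0) (Spec.of_wp ?_ (by decide)) (by omega) ?_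
  · simp only [block, Code.wp, Op.Ok, Op.exec, Function.update_apply, reduceCtorEq, if_true, if_false,
      Store.initial, g0, g1, g2]
    refine ⟨?_, ?_, ?_, ?_, ?_, ?_, ?_, ?_, ?_, trivial, trivial, trivial, trivial, trivial, trivial,
      trivial, trivial, trivial⟩ <;> omega
  rintro s₁ hF₁ ⟨h0, h1, h2, h3, hn, hm, hroot, hp, hi⟩
  refine Spec.cons (spec_loadVertices hlen hbig h1 hn hp hi) (by omega) ?_
  rintro s₂ hF₂ ⟨hp₂, hv₂⟩
  refine Spec.cons (T₁ := 1) (P := fun s => s.reg .i = 0) (Spec.of_wp ?_ (by decide)) (by omega) ?_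
  · simp only [Code.wp, Op.Ok, Op.exec, Function.update_self]
    exact ⟨Nat.zero_le _, trivial⟩
  intro s₃ hF₃ hi₃
  have ein₁ : s₁.arr .input = fun i => (G.encode root).getD i 0 := hF₁.2 .input rfl
  have ein : s₃.arr .input = fun i => (G.encode root).getD i 0 :=
    (hF₃.2 _ rfl).trans ((hF₂.2 _ rfl).trans ein₁)
  have htl : ∀ a : Fin m, s₃.arr .input (3 + 3 * n + 3 * a) = G.tail a := fun a => by
    rw [ein]
    exact G.encode_arc root a (j := 0) (by omega)
  have r₃ : ∀ r, loadVertices.writes r = false → (set Reg.i 0 : Code Reg Arr).writes r = false →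
      s₃.reg r = s₁.reg r := fun r hr hr' => (hF₃.1 _ hr').trans (hF₂.1 _ hr)
  refine Spec.cons (spec_loadArcs (n := n) (m := m) hlen hbig ((r₃ _ rfl rfl).trans h0)
    ((r₃ _ rfl rfl).trans h1) ((r₃ _ rfl rfl).trans hm) ((hF₃.1 _ rfl).trans hp₂) hi₃ (fun v => ?_)
    (fun a ha => ?_)) (by omega) ?_
  · rw [hF₃.2 .deg rfl, hF₂.2 .deg rfl, hF₁.2 .deg rfl]
    rfl
  · exact (htl ⟨a, ha⟩).symm ▸ (G.tail ⟨a, ha⟩).2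
  rintro s₄ hF₄ ⟨ha₄, hv₄⟩
  refine Spec.nil ⟨?_, fun i => ?_⟩
  swap
  · rw [hF₄.2 .vis rfl, hF₃.2 .vis rfl, hF₂.2 .vis rfl, hF₁.2 .vis rfl]
    rfl
  have r₄ : ∀ r, loadVertices.writes r = false → (set Reg.i 0 : Code Reg Arr).writes r = false →
      loadArcs.writes r = false → s₄.reg r = s₁.reg r :=
    fun r hr hr' hr'' => (hF₄.1 _ hr'').trans (r₃ r hr hr')
  have hcode : ∀ (v : Fin n) (j : ℕ), j < 3 → s₁.arr .input (3 + 3 * v + j) =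
      (G.vertexCode v).getD j 0 := fun v j hj => by
    rw [ein₁]
    exact G.encode_vertex root v hj
  have hk₃ : ∀ v : Fin n, s₃.arr .kind v = (G.vertexCode v).getD 0 0 := fun v => by
    rw [hF₃.2 .kind rfl, (hv₂ v v.2).1, ← hcode v 0 (by omega)]
    rfl
  have hk : ∀ v : Fin n, s₄.arr .kind v = (G.vertexCode v).getD 0 0 := fun v => by
    rw [hF₄.2 .kind rfl, hk₃]
  have hkind : ∀ v : Fin n, (s₄.arr .kind v < 3 ↔ v ∉ G.sinks) ∧
      (v ∉ G.sinks → (s₄.arr .kind v = 1 ↔ v ∈ G.maxVerts)) ∧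
      (v ∉ G.sinks → (s₄.arr .kind v = 0 ↔ v ∈ G.rotorVerts)) := by
    intro v
    have h1 : v ∈ G.maxVerts → v ∉ G.sinks := fun h => Set.disjoint_left.1 G.disjoint_max_sinks h
    have h2 : v ∈ G.minVerts → v ∉ G.sinks := fun h => Set.disjoint_left.1 G.disjoint_min_sinks h
    have h3 : v ∈ G.rotorVerts ↔ ¬ (v ∈ G.maxVerts ∨ v ∈ G.minVerts ∨ v ∈ G.sinks) := by
      simp only [RotorGame.rotorVerts, Set.mem_compl_iff, Set.mem_union, or_assoc]
    rw [hk, h3]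
    simp only [RotorGame.vertexCode, List.getD_cons_zero]
    split_ifs with h4 h5 h6
    · simp [h1 h4, h4]
    · simp [h2 h5, h4, h5]
    · simp [h6]
    · simp [h4, h5, h6]
  have hst : ∀ v : Fin n, v ∉ G.sinks → ∃ a : Fin m, a ∈ G.choices v ∧ s₄.arr .st v = a := by
    intro v hv
    by_cases hr : v ∈ G.rotorVerts
    · refine ⟨(G.rho ⟨v, hr⟩).1, ⟨(G.rho ⟨v, hr⟩).2, fun _ => rfl⟩, ?_⟩
      have hk0 : s₃.arr .kind v = 0 := by
        rw [hk₃, ← hk]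
        exact ((hkind v).2.2 hv).2 hr
      rw [(hv₄ v).2.1 hk0, hF₃.2 .st rfl, (hv₂ v v.2).2.2, hcode v 2 (by omega)]
      exact dif_pos hr
    · have hk0 : 0 < s₃.arr .kind v := by
        rw [hk₃, ← hk]
        exact Nat.pos_of_ne_zero fun h => hr (((hkind v).2.2 hv).1 h)
      obtain ⟨b, hb⟩ := RotorGame.exists_tail_eq hexit hv
      obtain ⟨a, ha, hav, hst⟩ := (hv₄ v).2.2 hk0 ⟨b, b.2, by rw [htl, hb]⟩
      refine ⟨⟨a, ha⟩, ⟨Fin.ext ?_, fun h => absurd h hr⟩, hst⟩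
      rw [← htl ⟨a, ha⟩, ← hav]
  refine ⟨(r₄ _ rfl rfl rfl).trans h0, (r₄ _ rfl rfl rfl).trans h1, (r₄ _ rfl rfl rfl).trans h2,
    (r₄ _ rfl rfl rfl).trans h3, (r₄ _ rfl rfl rfl).trans hn, (r₄ _ rfl rfl rfl).trans hroot,
    fun v => (hkind v).1, fun v hv => ?_, fun v => (hkind v).2.2, fun v hv => ?_, fun a => ?_,
    fun a ha => ?_, hst, fun v => ?_⟩
  · rw [(hkind v).2.1 hv]
    simp [RotorGame.owner]
  · rw [hF₄.2 .val rfl, hF₃.2 .val rfl, (hv₂ v v.2).2.1, hcode v 1 (by omega)]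
    simp [RotorGame.vertexCode, hv]
  · rw [(ha₄ a a.2).1, ein]
    exact G.encode_arc root a (j := 1) (by omega)
  · rw [(ha₄ a a.2).2, ein]
    refine (G.encode_arc root a (j := 2) (by omega)).trans ?_
    simp [RotorGame.arcCode, ha]
  · rw [(hv₄ v).1, outDegree_eq_count (f := fun a => s₃.arr .input (3 + 3 * n + 3 * a)) htl]

end RotorSolver

/-! ### Searching the tree -/

namespace RotorSolver

open RAM RAM.Code RotorGraph

variable {n m : ℕ}

/-- The list `L` of vertices that have been found, and its representation by a number and three
arrays. Parents precede their children in `L`. -/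
structure Found (root : Fin n) (par : Fin n → Fin n) (L : List (Fin n)) (len : ℕ)
    (que pa vis : ℕ → ℕ) : Prop where
  nodup : L.Nodup
  root_mem : root ∈ L
  par_mem : ∀ x ∈ L, par x ∈ L
  order : L.Pairwise fun x y => par x ≠ y
  len_eq : len = L.length
  que_eq : ∀ (k : ℕ) (v : Fin n), L[k]? = some v → que k = (v : ℕ)
  par_eq : ∀ v ∈ L, pa v = (par v : ℕ)
  vis_pos : ∀ v : Fin n, 0 < vis v ↔ v ∈ L

namespace Found

variable {root : Fin n} {par : Fin n → Fin n} {L : List (Fin n)} {len : ℕ} {que pa vis : ℕ → ℕ}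

theorem length_le (h : Found root par L len que pa vis) : L.length ≤ n := by
  have := h.nodup.length_le_card
  simpa using this

theorem length_lt (h : Found root par L len que pa vis) {w : Fin n} (hw : w ∉ L) :
    L.length < n := by
  have h1 : (w :: L).Nodup := List.nodup_cons.2 ⟨hw, h.nodup⟩
  have := h1.length_le_card
  simpa using this

theorem singleton (hp : par root = root) (hvis : ∀ i, vis i = 0) :
    Found root par [root] 1 (Function.update que 0 root) (Function.update pa root root)
      (Function.update vis root 1) where
  nodup := List.nodup_singleton _
  root_mem := List.mem_singleton_self _
  par_mem x hx := by rw [List.mem_singleton] at hx ⊢; rw [hx, hp]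
  order := List.pairwise_singleton _ _
  len_eq := rfl
  que_eq k v hv := by
    rcases k with _ | k
    · simp only [List.getElem?_cons_zero, Option.some.injEq] at hv
      simp [hv]
    · simp at hv
  par_eq v hv := by rw [List.mem_singleton] at hv; simp [hv, hp]
  vis_pos v := by
    by_cases hv : v = root
    · simp [hv]
    · have : (v : ℕ) ≠ root := fun h => hv (Fin.ext h)
      simp [hv, this, hvis]

theorem push (h : Found root par L len que pa vis) {v w : Fin n} (hw : w ∉ L) (hv : v ∈ L)
    (hp : par w = v) :
    Found root par (L ++ [w]) (len + 1) (Function.update que len w) (Function.update pa w v)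
      (Function.update vis w 1) where
  nodup := by
    rw [List.nodup_append]
    refine ⟨h.nodup, List.nodup_singleton _, fun x hx y hy => ?_⟩
    rw [List.mem_singleton] at hy
    rintro rfl
    exact hw (hy ▸ hx)
  root_mem := List.mem_append_left _ h.root_mem
  par_mem x hx := by
    rw [List.mem_append, List.mem_singleton] at hx ⊢
    rcases hx with hx | rfl
    · exact Or.inl (h.par_mem x hx)
    · exact Or.inl (hp ▸ hv)
  order := by
    rw [List.pairwise_append]
    refine ⟨h.order, List.pairwise_singleton _ _, fun x hx y hy => ?_⟩
    rw [List.mem_singleton] at hy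
    rintro rfl
    exact hw (hy ▸ h.par_mem x hx)
  len_eq := by simp [h.len_eq]
  que_eq k x hx := by
    rcases lt_trichotomy k L.length with hk | hk | hk
    · rw [List.getElem?_append_left hk] at hx
      rw [Function.update_of_ne (by rw [h.len_eq]; omega)]
      exact h.que_eq k x hx
    · rw [hk, List.getElem?_append_right le_rfl] at hx
      simp only [Nat.sub_self, List.getElem?_cons_zero, Option.some.injEq] at hx
      rw [hk, ← h.len_eq, Function.update_self, hx]
    · rw [List.getElem?_eq_none (by simp; omega)] at hx
      exact absurd hx (by simp)
  par_eq x hx := by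
    by_cases hxw : x = w
    · subst hxw
      rw [Function.update_self, hp]
    · have hne : (x : ℕ) ≠ w := fun e => hxw (Fin.ext e)
      rw [Function.update_of_ne hne]
      simp only [List.mem_append, List.mem_singleton, hxw, or_false] at hx
      exact h.par_eq x hx
  vis_pos x := by
    by_cases hxw : x = w
    · subst hxw
      simp
    · have hne : (x : ℕ) ≠ w := fun e => hxw (Fin.ext e)
      rw [Function.update_of_ne hne, h.vis_pos]
      simp [hxw]

end Found

/-- A search that visits every vertex at most once takes linear time. -/
theorem sum_outDegree_le {G : RotorGraph (Fin n) (Fin m)} {L : List (Fin n)} (hL : L.Nodup) :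
    (L.map fun v => G.outDegree v + 1).sum ≤ n + m := by
  classical
  rw [← List.sum_toFinset _ hL]
  refine (Finset.sum_le_univ_sum_of_nonneg fun _ => Nat.zero_le _).trans ?_
  rw [Finset.sum_add_distrib]
  have h1 : ∑ v : Fin n, G.outDegree v = m := by
    have := Finset.card_eq_sum_card_fiberwise (s := (Finset.univ : Finset (Fin m))) (f := G.tail)
      (t := Finset.univ) fun _ _ => Finset.mem_coe.2 (Finset.mem_univ _)
    rw [Finset.card_univ, Fintype.card_fin] at this
    refine Eq.trans ?_ this.symm
    refine Finset.sum_congr rfl fun v _ => ?_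
    unfold outDegree
    rw [Set.ncard_eq_toFinset_card']
    congr 1
    ext a
    simp
  rw [h1]
  simp
  omega

variable {G : RotorGame (Fin n) (Fin m)} {root : Fin n} {par : Fin n → Fin n} {depth : Fin n → ℕ}
  {ℓ : Limits}

theorem spec_expand (hR : G.Rooted root par depth) (hlen : n + m ≤ ℓ.len) (hbig : ℓ.len ≤ ℓ.big)
    {s : Store Reg Arr} (hs : Loaded G root s) {v : Fin n} (hv : v ∉ G.sinks)
    (hsv : s.reg .v = v) {a : Fin m} (ha : G.tail a = v) (hse : s.reg .e = a)
    (hsk : s.reg .k = G.outDegree v) {L : List (Fin n)} (hvL : v ∈ L)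
    (hL : Found root par L (s.reg .len) (s.arr .que) (s.arr .par) (s.arr .vis)) :
    Spec ℓ expand s (22 * G.outDegree v + 2) fun s' => ∃ R,
      Found root par (L ++ R) (s'.reg .len) (s'.arr .que) (s'.arr .par) (s'.arr .vis) ∧
      ∀ b, G.tail b = v → G.head b ∈ L ++ R := by
  have hta : G.tail a ∉ G.sinks := ha ▸ hv
  refine Spec.loop (fun K s' => ∃ j ≤ G.outDegree v, ∃ R, s'.reg .k = G.outDegree v - j ∧
    s'.reg .e = (G.next^[j] a : Fin m) ∧
    Found root par (L ++ R) (s'.reg .len) (s'.arr .que) (s'.arr .par) (s'.arr .vis) ∧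
    (∀ i < j, G.heads a i ∈ L ++ R) ∧ K = 22 * (G.outDegree v - j)) (22 * G.outDegree v)
    ⟨0, Nat.zero_le _, [], by simpa using hsk, hse, by rwa [List.append_nil],
      fun i hi => absurd hi (Nat.not_lt_zero i), rfl⟩ ?_ ?_ le_rfl
  · rintro K s' hF ⟨j, hj, R, hk, he, hfound, hheads, rfl⟩ hlt
    have hs' : Loaded G root s' := hs.frame hF (by decide) (by decide)
    have ev : s'.reg .v = v := (hF.1 _ rfl).trans hsv
    rw [hs'.zero, hk] at hlt
    have ehd : s'.arr .hd ((G.next^[j] a : Fin m) : ℕ) = (G.heads a j : Fin n) := hs'.head _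
    have enx : s'.arr .nx ((G.next^[j] a : Fin m) : ℕ) = (G.next^[j + 1] a : Fin m) := by
      rw [hs'.next _ (by rw [tail_iterate hta]; exact hta), Function.iterate_succ_apply']
    have helt := (G.next^[j] a : Fin m).2
    have hwlt := (G.heads a j : Fin n).2
    have hvis := hfound.vis_pos (G.heads a j)
    have hlen_eq := hfound.len_eq
    refine ⟨20, Spec.of_wp ?_ (by decide)⟩
    simp only [block, Code.wp, Op.Ok, Op.exec, Function.update_apply, reduceCtorEq, if_true, if_false,
      he, hk, ehd, enx, ev, hs'.zero, hs'.one]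
    refine ⟨by omega, by omega, fun hx => ⟨by omega, trivial, 22 * (G.outDegree v - (j + 1)),
        ⟨j + 1, by omega, R, by omega, rfl, hfound, fun i hi => ?_, rfl⟩, by omega⟩,
      fun hx => ⟨by omega, by omega, ?_, ?_, by omega, trivial, 22 * (G.outDegree v - (j + 1)),
        ⟨j + 1, by omega, R ++ [G.heads a j], by omega, rfl, ?_, fun i hi => ?_, rfl⟩, by omega⟩⟩
    · rcases Nat.lt_succ_iff_lt_or_eq.1 hi with h | rfl
      · exact hheads i h
      · exact hvis.1 hx
    · have := hfound.length_lt fun h => hx (hvis.2 h)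
      omega
    · have := hfound.length_lt fun h => hx (hvis.2 h)
      omega
    · rw [← List.append_assoc]
      have hwL : G.heads a j ∉ L ++ R := fun h => hx (hvis.2 h)
      have hvL' : v ∈ L ++ R := List.mem_append_left _ hvL
      refine hfound.push hwL hvL' (hR.child_of_hasArc (v := v) ?_ fun h => ?_).2
      · have := hasArc_heads hta j
        rwa [ha] at this
      · exact hwL (h ▸ hfound.par_mem v hvL')
    · rw [← List.append_assoc, List.mem_append, List.mem_singleton]
      rcases Nat.lt_succ_iff_lt_or_eq.1 hi with h | rfl
      · exact Or.inl (hheads i h)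
      · exact Or.inr rfl
  · rintro K s' hF ⟨j, hj, R, hk, he, hfound, hheads, rfl⟩ hlt
    rw [(hF.1 .zero rfl).trans hs.zero, hk] at hlt
    refine ⟨R, hfound, fun b hb => ?_⟩
    obtain ⟨i, hi, rfl⟩ := exists_iterate_eq hta (hb.trans ha.symm)
    rw [ha] at hi
    exact hheads i (by omega)

/-- All vertices that the particle can reach have been found. -/
structure Searched (G : RotorGame (Fin n) (Fin m)) (root : Fin n) (par : Fin n → Fin n)
    (L : List (Fin n)) (s : Store Reg Arr) : Prop where
  found : Found root par L (s.reg .len) (s.arr .que) (s.arr .par) (s.arr .vis)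
  head_mem : ∀ b, G.tail b ∈ L → G.tail b ∉ G.sinks → G.head b ∈ L

theorem Searched.frame {c : Code Reg Arr} {L : List (Fin n)} {s s' : Store Reg Arr}
    (h : Searched G root par L s) (hF : Frame c s s') (hr : c.writes .len = false)
    (hf : ∀ f ∈ [Arr.que, .par, .vis], c.stores f = false) : Searched G root par L s' := by
  refine ⟨?_, h.head_mem⟩
  rw [hF.1 _ hr, hF.2 _ (hf .que (by decide)), hF.2 _ (hf .par (by decide)),
    hF.2 _ (hf .vis (by decide))]
  exact h.found

theorem spec_search (hR : G.Rooted root par depth) (hlen : n + m ≤ ℓ.len) (hbig : ℓ.len ≤ ℓ.big)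
    {s : Store Reg Arr} (hs : Loaded G root s) (hvis : ∀ i, s.arr .vis i = 0) :
    Spec ℓ search s (30 * (n + m) + 14) fun s' => ∃ L, Searched G root par L s' := by
  have hrlt := root.2
  refine Spec.cons (T₁ := 12) (P := fun s => s.reg .i = 0 ∧
    Found root par [root] (s.reg .len) (s.arr .que) (s.arr .par) (s.arr .vis))
    (Spec.of_wp ?_ (by decide)) (by omega) ?_
  · simp only [block, Code.wp, Op.Ok, Op.exec, reduceCtorEq, ne_eq, not_false_eq_true,
      Function.update_of_ne, Function.update_self, hs.zero, hs.one, hs.reg_root]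
    exact ⟨by omega, by omega, by omega, by omega, by omega, trivial,
      Found.singleton hR.par_root hvis⟩
  rintro s₁ hF₁ ⟨hi₁, hfound₁⟩
  have hs₁ : Loaded G root s₁ := hs.frame hF₁ (by decide) (by decide)
  refine Spec.cons (T₁ := 30 * (n + m) + 2) (P := fun s' => ∃ L, Searched G root par L s') ?_
    (by omega) fun s' _ h => Spec.nil h
  -- The vertices in `D` have been expanded, and those in `R` are waiting; the time that is left is
  -- proportional to the number of vertices outside of `D` and of the arcs that leave them.
  refine Spec.loop (fun K s' => ∃ D R, s'.reg .i = D.length ∧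
    Found root par (D ++ R) (s'.reg .len) (s'.arr .que) (s'.arr .par) (s'.arr .vis) ∧
    (∀ b, G.tail b ∈ D → G.tail b ∉ G.sinks → G.head b ∈ D ++ R) ∧
    K = 30 * (n + m - (D.map fun v => G.outDegree v + 1).sum)) (30 * (n + m))
    ?_ ?_ ?_ le_rfl
  · exact ⟨[], [root], hi₁, hfound₁, by simp, by simp⟩
  · rintro K s' hF ⟨D, R, hi, hfound, hhead, rfl⟩ hlt
    have hs' : Loaded G root s' := hs₁.frame hF (by decide) (by decide)
    rw [hi, hfound.len_eq] at hlt
    rcases R with _ | ⟨v, R⟩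
    · simp at hlt
    have hsum := sum_outDegree_le (G := G.toRotorGraph) (L := D ++ [v]) (by
      have := hfound.nodup
      rw [List.append_cons] at this
      exact (List.nodup_append.1 this).1)
    have hque := hfound.que_eq D.length v (by simp)
    have hvlt := v.2
    have hDlt := hfound.length_le
    simp only [List.map_append, List.map_cons, List.map_nil, List.sum_append, List.sum_cons,
      List.sum_nil, List.length_append, List.length_cons] at hsum hDlt
    -- the effect of the test and of the search at `v`
    have hmid : ∀ s'', Frame (block [load .v .que .i, load .x .kind .v] : Code Reg Arr) s' s'' →
        s''.reg .v = v ∧ s''.reg .x = s''.arr .kind v → Spec ℓ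
        (.ite .x .three (block [block [load .e .st .v, load .k .deg .v], expand]) .skip) s''
        (22 * G.outDegree v + 8) (fun s₃ => ∃ R', Found root par (D ++ R') (s₃.reg .len)
          (s₃.arr .que) (s₃.arr .par) (s₃.arr .vis) ∧ (∃ R'', R' = v :: R'') ∧
          ∀ b, G.tail b ∈ D ++ [v] → G.tail b ∉ G.sinks → G.head b ∈ D ++ R') := by
      rintro s'' hF'' ⟨hv, hx⟩
      have hs'' : Loaded G root s'' := hs'.frame hF'' (by decide) (by decide)
      have hfound'' : Found root par (D ++ v :: R) (s''.reg .len) (s''.arr .que) (s''.arr .par)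
          (s''.arr .vis) := by
        rw [hF''.1 .len rfl, hF''.2 .que rfl, hF''.2 .par rfl, hF''.2 .vis rfl]
        exact hfound
      refine Spec.ite (T := 22 * G.outDegree v + 6) (fun hk => ?_) fun hk => ?_
      · rw [hx, hs''.three, hs''.kind_sink] at hk
        obtain ⟨a, ha, hst⟩ := hs''.start v hk
        refine Spec.cons (T₁ := 4) (P := fun s => s.reg .e = a ∧ s.reg .k = G.outDegree v)
          (Spec.of_wp ?_ (by decide)) (by omega) fun s₄ hF₄ h₄ => ?_
        · simp only [block, Code.wp, Op.Ok, Op.exec, Function.update_apply, reduceCtorEq, if_true,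
            if_false, hv, hst, hs''.deg]
          exact ⟨by omega, by omega, trivial, trivial⟩
        have hs₄ : Loaded G root s₄ := hs''.frame hF₄ (by decide) (by decide)
        refine Spec.cons (spec_expand hR hlen hbig hs₄ hk ((hF₄.1 .v rfl).trans hv) ha.1 h₄.1 h₄.2
          (L := D ++ v :: R) (by simp) (by
            rw [hF₄.1 .len rfl, hF₄.2 .que rfl, hF₄.2 .par rfl, hF₄.2 .vis rfl]
            exact hfound'')) (by omega) fun s₅ _ h₅ => Spec.nil ?_
        obtain ⟨R', h5, h6⟩ := h₅
        rw [List.append_assoc, List.cons_append] at h5 h6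
        refine ⟨v :: (R ++ R'), h5, ⟨_, rfl⟩, fun b hb hb' => ?_⟩
        rw [List.mem_append, List.mem_singleton] at hb
        rcases hb with hb | hb
        · have := hhead b hb hb'
          simp only [List.mem_append, List.mem_cons] at this ⊢
          tauto
        · exact h6 b hb
      · rw [hx, hs''.three, hs''.kind_sink] at hk
        refine Spec.of_wp (c := .skip) ⟨v :: R, hfound'', ⟨_, rfl⟩, fun b hb hb' => ?_⟩ (by simp [Code.length])
        rw [List.mem_append, List.mem_singleton] at hb
        rcases hb with hb | hb
        · exact hhead b hb hb'
        · exact absurd (hb ▸ hb') hk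
    refine ⟨22 * G.outDegree v + 14, ?_⟩
    refine Spec.cons (T₁ := 4) (P := fun s => s.reg .v = v ∧ s.reg .x = s.arr .kind v)
      (Spec.of_wp ?_ (by decide)) (by omega) fun s₂ hF₂ h₂ =>
      Spec.cons (hmid s₂ hF₂ h₂) (by omega) fun s₃ hF₃ h₃ => ?_
    · simp only [block, Code.wp, Op.Ok, Op.exec, Function.update_apply, reduceCtorEq, if_true,
        if_false, hi, hque]
      exact ⟨by omega, by omega, trivial, trivial⟩
    obtain ⟨R', h4, ⟨R'', rfl⟩, h5⟩ := h₃
    have hi₃ : s₃.reg .i = D.length := (hF₃.1 .i rfl).trans ((hF₂.1 .i rfl).trans hi)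
    have e1 : s₃.reg .one = 1 := (hF₃.1 .one rfl).trans ((hF₂.1 .one rfl).trans hs'.one)
    refine Spec.of_wp ?_ (show _ ≤ _ by simp only [block, Code.length, Op.time]; omega)
    simp only [block, Code.wp, Op.Ok, Op.exec, Function.update_apply, reduceCtorEq, if_true,
        if_false, hi₃, e1]
    refine ⟨by omega, 30 * (n + m - ((D ++ [v]).map fun v => G.outDegree v + 1).sum),
      ⟨D ++ [v], R'', by simp, ?_, ?_, rfl⟩, ?_⟩
    · rwa [List.append_assoc]
    · intro b hb hb'
      rw [List.append_assoc]
      exact h5 b hb hb'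
    · simp only [List.map_append, List.map_cons, List.map_nil, List.sum_append, List.sum_cons,
        List.sum_nil]
      omega
  · rintro K s' hF ⟨D, R, hi, hfound, hhead, rfl⟩ hlt
    rw [hi, hfound.len_eq, List.length_append] at hlt
    have : R = [] := List.length_eq_zero_iff.1 (by omega)
    subst this
    rw [List.append_nil] at hfound hhead
    exact ⟨D, hfound, hhead⟩

end RotorSolver

/-! ### Outcomes for periodic rotors -/

section Periodic

variable {V : Type*} [DecidableEq V] {u : V} {h : ℕ → V} {X : V → Outcome} {d : ℕ}

theorem visits_shift (hd : ∀ j, h (j + d) = h j) (s : ℕ) (w : V) :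
    visits (fun j => h (s + j)) w d = visits h w d := by
  have h1 := visits_add h w s d
  rw [visits_add_period w hd] at h1
  omega

theorem visits_pos_iff {w : V} {t : ℕ} : 0 < visits h w t ↔ ∃ j < t, h j = w := by
  unfold visits
  rw [Nat.pos_iff_ne_zero, Nat.count_ne_iff_exists]

/-- If each turn of the rotor sends the particle to every child `w` as often as the first `d`
departures do, the number of the turn during which `w` captures it; this is `0` for the
vertices that do not capture it. -/
def turns (u : V) (h : ℕ → V) (X : V → Outcome) (d : ℕ) (w : V) : ℕ :=
  if w ≠ u ∧ 0 < (X w).flow then ((X w).flow - 1) / visits h w d + 1 else 0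

/-- The number of visits to `w` during the turn of its capture that do not capture the
particle. -/
def offset (h : ℕ → V) (X : V → Outcome) (d : ℕ) (w : V) : ℕ := ((X w).flow - 1) % visits h w d

/-- Only the children with the least number of turns can be the first to capture the particle, for
all possible starts of the rotor. -/
theorem captured_iff (hd : ∀ j, h (j + d) = h j) {q : ℕ} (hq : 0 < q)
    (hmin : ∀ w, 0 < visits h w d → 0 < turns u h X d w → q ≤ turns u h X d w) (s : ℕ) {k : ℕ}
    (hk : k ≤ d) : Captured u (fun j => h (s + j)) X (k + (q - 1) * d) ↔
      ∃ w, 0 < visits h w d ∧ turns u h X d w = q ∧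
        offset h X d w < visits (fun j => h (s + j)) w k := by
  have hg : ∀ j, (fun j => h (s + j)) (j + d) = (fun j => h (s + j)) j := fun j => by
    show h (s + (j + d)) = h (s + j)
    rw [← add_assoc, hd]
  have hv : ∀ w, visits (fun j => h (s + j)) w (k + (q - 1) * d) =
      visits (fun j => h (s + j)) w k + (q - 1) * visits h w d := fun w => by
    rw [visits_add_mul_period w hg, visits_shift hd]
  have hle : ∀ w, visits (fun j => h (s + j)) w k ≤ visits h w d := fun w =>
    (visits_mono _ w hk).trans_eq (visits_shift hd s w)
  have hflow : ∀ w, 0 < (X w).flow → (X w).flow =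
      visits h w d * (((X w).flow - 1) / visits h w d) + offset h X d w + 1 := fun w hw => by
    have := Nat.div_add_mod ((X w).flow - 1) (visits h w d)
    unfold offset
    omega
  constructor
  · rintro ⟨w, h1, h2, h3⟩
    rw [hv] at h3
    have hw := hle w
    have hpos : 0 < visits h w d := by
      by_contra h0
      rw [Nat.eq_zero_of_not_pos h0] at h3 hw
      omega
    have ht : turns u h X d w = ((X w).flow - 1) / visits h w d + 1 := if_pos ⟨h1, h2⟩
    have hq' := hmin w hpos (ht ▸ Nat.succ_pos _)
    have hf := hflow w h2
    -- a child whose turn comes after `q` has not received the particle often enough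
    have : turns u h X d w ≤ q := by
      by_contra hlt
      have := Nat.mul_le_mul_left (visits h w d)
        (show q - 1 + 1 ≤ ((X w).flow - 1) / visits h w d by omega)
      rw [Nat.mul_add, mul_one, mul_comm] at this
      omega
    have he : turns u h X d w = q := le_antisymm this hq'
    refine ⟨w, hpos, he, ?_⟩
    rw [show ((X w).flow - 1) / visits h w d = q - 1 by omega, mul_comm] at hf
    omega
  · rintro ⟨w, h1, h2, h3⟩
    unfold turns at h2
    split_ifs at h2 with h4
    · refine ⟨w, h4.1, h4.2, ?_⟩
      have hf := hflow w h4.2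
      rw [show ((X w).flow - 1) / visits h w d = q - 1 by omega, mul_comm] at hf
      rw [hv]
      omega
    · omega

/-- The outcome for the start `s`, if the departure number `k` in the turn `q` is the first one to
capture the particle: all previous turns return the particle equally often to `u`. -/
theorem nodeOutcome_of_window (hd : ∀ j, h (j + d) = h j) {q : ℕ} (hq : 0 < q)
    (hmin : ∀ w, 0 < visits h w d → 0 < turns u h X d w → q ≤ turns u h X d w) {s k : ℕ}
    (hk : k < d) (h0 : ∀ w, 0 < visits h w d → turns u h X d w = q →
      visits (fun j => h (s + j)) w k ≤ offset h X d w)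
    (h1 : turns u h X d (h (s + k)) = q)
    (h2 : offset h X d (h (s + k)) < visits (fun j => h (s + j)) (h (s + k)) (k + 1)) :
    nodeOutcome u (fun j => h (s + j)) X = ⟨(X (h (s + k))).win,
      (q - 1) * visits h u d + visits (fun j => h (s + j)) u (k + 1) + 1⟩ := by
  have hg : ∀ j, (fun j => h (s + j)) (j + d) = (fun j => h (s + j)) j := fun j => by
    show h (s + (j + d)) = h (s + j)
    rw [← add_assoc, hd]
  have hw : 0 < visits h (h (s + k)) d := by
    rw [← visits_shift hd s]
    exact (Nat.zero_le _).trans_lt (h2.trans_le (visits_mono _ _ hk))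
  have hc0 : ¬ Captured u (fun j => h (s + j)) X (k + (q - 1) * d) := by
    rw [captured_iff hd hq hmin s hk.le]
    rintro ⟨w, hw1, hw2, hw3⟩
    exact absurd (h0 w hw1 hw2) (not_le.2 hw3)
  have hc1 : Captured u (fun j => h (s + j)) X (k + (q - 1) * d + 1) := by
    rw [show k + (q - 1) * d + 1 = k + 1 + (q - 1) * d by omega, captured_iff hd hq hmin s hk]
    exact ⟨_, hw, h1, h2⟩
  have hper : ∀ t, h (s + (k + t * d)) = h (s + k) := fun t => by
    induction t with
    | zero => simp
    | succ t ih => rw [Nat.succ_mul, ← add_assoc, ← add_assoc, hd, add_assoc, ih]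
  rw [nodeOutcome_of_first hc0 hc1, hper,
    show k + (q - 1) * d + 1 = k + 1 + (q - 1) * d by omega, visits_add_mul_period u hg,
    visits_shift hd]
  congr 1
  omega

theorem nodeOutcome_of_turns (hd : ∀ j, h (j + d) = h j) (hd0 : 0 < d)
    (h0 : ∀ w, 0 < visits h w d → turns u h X d w = 0) (s : ℕ) :
    nodeOutcome u (fun j => h (s + j)) X = ⟨false, 0⟩ := by
  refine nodeOutcome_of_not ?_
  rintro ⟨t, w, h1, h2, h3⟩
  have hpos : 0 < visits h w d := by
    obtain ⟨j, -, hj⟩ := visits_pos_iff.1 (h2.trans_le h3)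
    refine visits_pos_iff.2 ⟨(s + j) % d, Nat.mod_lt _ hd0, ?_⟩
    rw [← hj]
    exact (Function.Periodic.map_mod_nat (f := h) hd _)
  have := h0 w hpos
  rw [turns, if_pos ⟨h1, h2⟩] at this
  exact Nat.succ_ne_zero _ this

theorem Outcome.score_lt_iff {β : Bool} {x y : Outcome} (hx : 0 < x.flow) (hy : 0 < y.flow) :
    x.score β < y.score β ↔
      if x.win = y.win then (if y.win = β then y.flow < x.flow else x.flow < y.flow)
      else y.win = β := by
  have hx' : (0 : ℚ) < x.flow := by exact_mod_cast hx
  have hy' : (0 : ℚ) < y.flow := by exact_mod_cast hy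
  have hx1 := one_div_pos.2 hx'
  have hy1 := one_div_pos.2 hy'
  unfold score
  by_cases h1 : x.win = y.win
  · rw [if_pos h1, h1]
    by_cases h2 : y.win = β
    · rw [if_pos h2, if_pos h2, if_pos h2, one_div_lt_one_div hx' hy']
      exact_mod_cast Iff.rfl
    · rw [if_neg h2, if_neg h2, if_neg h2, neg_lt_neg_iff, one_div_lt_one_div hy' hx']
      exact_mod_cast Iff.rfl
  · rw [if_neg h1]
    by_cases h2 : y.win = β
    · have h3 : x.win ≠ β := fun h => h1 (h.trans h2.symm)
      rw [if_neg h3, if_pos h2]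
      simp only [h2, iff_true]
      linarith
    · have h3 : x.win = β := by
        cases hxw : x.win <;> cases hyw : y.win <;> cases β <;> simp_all
      rw [if_pos h3, if_neg h2]
      simp only [h2, iff_false, not_lt]
      linarith

end Periodic

/-! ### Dividing the flows by the multiplicities of the arcs -/

namespace RotorSolver

open RAM RAM.Code RotorGraph

variable {n m : ℕ} {G : RotorGame (Fin n) (Fin m)} {root : Fin n} {ℓ : Limits} {v u : Fin n}
  {a : Fin m}

/-- The current vertex `v`, its parent `u`, its chosen arc `a` and its degree are in the
registers. -/
structure AtVertex (G : RotorGame (Fin n) (Fin m)) (root v u : Fin n) (a : Fin m)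
    (s : Store Reg Arr) : Prop extends Loaded G root s where
  reg_v : s.reg .v = v
  reg_u : s.reg .u = u
  reg_a : s.reg .a = a
  reg_d : s.reg .d = G.outDegree v

theorem AtVertex.frame {c : Code Reg Arr} {s s' : Store Reg Arr} (h : AtVertex G root v u a s)
    (hF : Frame c s s')
    (hr : ∀ r ∈ [Reg.zero, .one, .two, .three, .n, .root, .v, .u, .a, .d], c.writes r = false)
    (hf : ∀ f ∈ [Arr.kind, .val, .hd, .nx, .st, .deg], c.stores f = false) :
    AtVertex G root v u a s' where
  toLoaded := h.toLoaded.frame hF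
    (fun r hr' => hr r (by simp only [List.mem_cons, List.not_mem_nil, or_false] at hr' ⊢; tauto)) hf
  reg_v := (hF.1 _ (hr .v (by decide))).trans h.reg_v
  reg_u := (hF.1 _ (hr .u (by decide))).trans h.reg_u
  reg_a := (hF.1 _ (hr .a (by decide))).trans h.reg_a
  reg_d := (hF.1 _ (hr .d (by decide))).trans h.reg_d

/-- The neighbours of `v` that play a role for the outcome of `v`. -/
def Neighbour (G : RotorGame (Fin n) (Fin m)) (v u : Fin n) (a : Fin m) (w : Fin n) : Prop :=
  w = u ∨ ∃ j < G.outDegree v, G.heads a j = w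

theorem outDegree_le (v : Fin n) : G.outDegree v ≤ m := by
  have := Set.ncard_le_card {a | G.tail a = v}
  rwa [Nat.card_eq_fintype_card, Fintype.card_fin] at this

theorem spec_cycle (hlen : n + m ≤ ℓ.len) (hbig : ℓ.len ≤ ℓ.big) (hv : v ∉ G.sinks)
    (ha : G.tail a = v) {body : Code Reg Arr} {s : Store Reg Arr} (hs : AtVertex G root v u a s)
    {I : ℕ → Store Reg Arr → Prop} {T : ℕ}
    (hr : ∀ r ∈ [Reg.zero, .one, .two, .three, .n, .root, .v, .u, .a, .d, .e, .k],
      body.writes r = false)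
    (hf : ∀ f ∈ [Arr.kind, .val, .hd, .nx, .st, .deg], body.stores f = false)
    (hI : ∀ j s₁ s₂, s₂.arr = s₁.arr → (∀ r, r ≠ .w → r ≠ .e → r ≠ .k → s₂.reg r = s₁.reg r) →
      I j s₁ → I j s₂) (h0 : I 0 s)
    (hstep : ∀ j < G.outDegree v, ∀ s', (∀ r ∉ [Reg.w, .e, .k], body.writes r = false →
        s'.reg r = s.reg r) → (∀ f, body.stores f = false → s'.arr f = s.arr f) →
      AtVertex G root v u a s' → s'.reg .w = (G.heads a j : Fin n) → I j s' →
      Spec ℓ body s' T (I (j + 1))) :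
    Spec ℓ (cycle body) s ((T + 9) * G.outDegree v + 4) (I (G.outDegree v)) := by
  have hta : G.tail a ∉ G.sinks := ha ▸ hv
  have hdm : G.outDegree v ≤ m := outDegree_le v
  have halt := a.2
  refine Spec.cons (T₁ := 2) (P := fun s' => s'.reg .e = a ∧ s'.reg .k = G.outDegree v ∧
    I 0 s') (Spec.of_wp ?_ (by decide)) (by omega) ?_
  · simp only [block, Code.wp, Op.Ok, Op.exec, Function.update_apply, reduceCtorEq, if_true,
      if_false, hs.reg_a, hs.reg_d, hs.zero]
    exact ⟨by omega, by omega, rfl, rfl, hI 0 s _ rfl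
      (fun r _ h1 h2 => by simp [h1, h2]) h0⟩
  rintro s₁ hF₁ ⟨he, hk, hI₁⟩
  have hs₁ : AtVertex G root v u a s₁ := hs.frame hF₁ (by decide) (by decide)
  refine Spec.cons (T₁ := (T + 9) * G.outDegree v + 2) (P := I (G.outDegree v)) ?_ (by omega)
    fun s' _ h => Spec.nil h
  refine Spec.loop (fun K s' => ∃ j ≤ G.outDegree v, s'.reg .k = G.outDegree v - j ∧
    s'.reg .e = (G.next^[j] a : Fin m) ∧ I j s' ∧ K = (T + 9) * (G.outDegree v - j))
    ((T + 9) * G.outDegree v) ⟨0, Nat.zero_le _, hk, he, hI₁, rfl⟩ ?_ ?_ le_rfl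
  · rintro K s' hF ⟨j, hj, hk', he', hI', rfl⟩ hlt
    have hs' : AtVertex G root v u a s' := by
      refine hs₁.frame hF ?_ ?_
      · intro r hr'
        have h1 := hr r (by simp only [List.mem_cons, List.not_mem_nil, or_false] at hr' ⊢; tauto)
        have h2 : r ≠ .w ∧ r ≠ .e ∧ r ≠ .k := by
          refine ⟨?_, ?_, ?_⟩ <;> rintro rfl <;> simp at hr'
        simp [Code.writes, block, h1, h2.1.symm, h2.2.1.symm, h2.2.2.symm]
      · intro f hf'
        simp [Code.stores, block, hf f hf']
    have hregs : ∀ r ∉ [Reg.w, .e, .k], body.writes r = false → s'.reg r = s.reg r := by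
      intro r hr' hb
      simp only [List.mem_cons, List.not_mem_nil, or_false, not_or] at hr'
      obtain ⟨h1, h2, h3⟩ := hr'
      rw [hF.1 r, hF₁.1 r]
      · simp [Code.writes, block, Ne.symm h2, Ne.symm h3]
      · simp [Code.writes, block, hb, Ne.symm h1, Ne.symm h2, Ne.symm h3]
    have harrs : ∀ f, body.stores f = false → s'.arr f = s.arr f := by
      intro f hb
      rw [hF.2 f, hF₁.2 f]
      · simp [Code.stores, block]
      · simp [Code.stores, block, hb]
    rw [hs'.zero, hk'] at hlt
    have helt := (G.next^[j] a : Fin m).2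
    have ehd : s'.arr .hd ((G.next^[j] a : Fin m) : ℕ) = (G.heads a j : Fin n) := hs'.head _
    refine ⟨T + 7, Spec.cons (T₁ := 2) (P := fun s'' => s''.reg .w = (G.heads a j : Fin n) ∧
      I j s'' ∧ s''.arr = s'.arr ∧ ∀ r ≠ .w, s''.reg r = s'.reg r) (Spec.of_wp ?_ (by decide))
      (by omega) ?_⟩
    · simp only [Code.wp, Op.Ok, Op.exec, he']
      refine ⟨by omega, by simp [ehd], hI j s' _ rfl (fun r h1 _ _ => by simp [h1]) hI', trivial,
        fun r hr => by simp [hr]⟩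
    rintro s₂ hF₂ ⟨hw₂, hI₂, harr₂, hreg₂⟩
    have hs₂ : AtVertex G root v u a s₂ := hs'.frame hF₂ (by decide) (by decide)
    refine Spec.cons (hstep j (by omega) s₂ (fun r hr' hb => ?_) (fun f hb => ?_) hs₂ hw₂ hI₂)
      (by omega) ?_
    · rw [hreg₂ r (by rintro rfl; simp at hr'), hregs r hr' hb]
    · rw [harr₂, harrs f hb]
    intro s₃ hF₃ hI₃
    have hs₃ : AtVertex G root v u a s₃ := hs₂.frame hF₃
      (fun r h => hr r (by simp only [List.mem_cons, List.not_mem_nil, or_false] at h ⊢; tauto)) hf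
    have he₃ : s₃.reg .e = (G.next^[j] a : Fin m) := by
      rw [hF₃.1 .e (hr .e (by decide)), hreg₂ .e (by decide), he']
    have hk₃ : s₃.reg .k = G.outDegree v - j := by
      rw [hF₃.1 .k (hr .k (by decide)), hreg₂ .k (by decide), hk']
    have enx : s₃.arr .nx ((G.next^[j] a : Fin m) : ℕ) = (G.next^[j + 1] a : Fin m) := by
      rw [hs₃.next _ (by rw [tail_iterate hta]; exact hta), Function.iterate_succ_apply']
    refine Spec.of_wp ?_ (show _ ≤ _ by simp only [block, Code.length, Op.time]; omega)
    simp only [block, Code.wp, Op.Ok, Op.exec, Function.update_apply, reduceCtorEq, if_true,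
      if_false, he₃, hk₃, enx, hs₃.one]
    refine ⟨by omega, trivial, (T + 9) * (G.outDegree v - (j + 1)), ⟨j + 1, by omega, by omega, rfl,
      hI _ s₃ _ rfl (fun r _ h1 h2 => by simp [h1, h2]) hI₃, rfl⟩, ?_⟩
    obtain ⟨b, hb⟩ : ∃ b, G.outDegree v - j = b + 1 := ⟨G.outDegree v - j - 1, by omega⟩
    rw [hb, show G.outDegree v - (j + 1) = b by omega, Nat.mul_add]
    omega
  · rintro K s' hF ⟨j, hj, hk', he', hI', rfl⟩ hlt
    have hz : s'.reg .zero = 0 := by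
      rw [hF.1 .zero, hs₁.zero]
      simp [Code.writes, block, hr .zero (by decide)]
    rw [hz, hk'] at hlt
    obtain rfl : j = G.outDegree v := by omega
    exact hI'

theorem spec_countArcs (hlen : n + m ≤ ℓ.len) (hbig : 20 * ℓ.len ≤ ℓ.big) (hv : v ∉ G.sinks)
    (ha : G.tail a = v) {s : Store Reg Arr} (hs : AtVertex G root v u a s) :
    Spec ℓ countArcs s (29 * G.outDegree v + 14) fun s' => ∀ w, Neighbour G v u a w →
      s'.arr .cnt w = visits (G.heads a) w (G.outDegree v) ∧ s'.arr .rcv w = 0 ∧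
      s'.arr .quo w = 0 := by
  have hult := u.2
  have hne : ∀ {x y : Fin n}, x ≠ y → (x : ℕ) ≠ y := fun h e => h (Fin.ext e)
  refine Spec.cons (T₁ := 6) (P := fun s' => s'.arr .cnt u = 0 ∧ s'.arr .rcv u = 0 ∧
    s'.arr .quo u = 0) (Spec.of_wp ?_ (by decide)) (by omega) ?_
  · simp only [block, Code.wp, Op.Ok, Op.exec, Function.update_apply, reduceCtorEq, if_true,
      if_false, hs.reg_u, hs.zero]
    exact ⟨by omega, by omega, by omega, trivial, trivial, trivial⟩
  intro s₁ hF₁ h₁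
  have hs₁ : AtVertex G root v u a s₁ := hs.frame hF₁ (by decide) (by decide)
  refine Spec.cons (spec_cycle (T := 6) hlen (by omega) hv ha hs₁ (I := fun j s' =>
    ∀ w : Fin n, w = u ∨ (∃ i < j, G.heads a i = w) → s'.arr .cnt w = 0 ∧ s'.arr .rcv w = 0 ∧
      s'.arr .quo w = 0) (by decide) (by decide) ?_ ?_ ?_) (by omega) ?_
  · intro j s₁ s₂ harr _ h
    rwa [harr]
  · rintro w (rfl | ⟨i, hi, -⟩)
    · exact h₁
    · omega
  · intro j hj s' _ _ hs' hw hI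
    have hwlt := (G.heads a j : Fin n).2
    refine Spec.of_wp ?_ (by decide)
    simp only [block, Code.wp, Op.Ok, Op.exec, Function.update_apply, reduceCtorEq, if_true,
      if_false, hw, hs'.zero]
    refine ⟨by omega, by omega, by omega, fun w hw' => ?_⟩
    by_cases hwj : w = G.heads a j
    · subst hwj
      simp
    · simp only [hne hwj, if_false]
      refine hI w (hw'.imp_right ?_)
      rintro ⟨i, hi, rfl⟩
      rcases Nat.lt_succ_iff_lt_or_eq.1 hi with h | rfl
      · exact ⟨i, h, rfl⟩
      · exact absurd rfl hwj
  intro s₂ hF₂ h₂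
  have hs₂ : AtVertex G root v u a s₂ := hs₁.frame hF₂ (by decide) (by decide)
  refine Spec.cons (spec_cycle (T := 5) hlen (by omega) hv ha hs₂ (I := fun j s' =>
    ∀ w, Neighbour G v u a w → s'.arr .cnt w = visits (G.heads a) w j ∧ s'.arr .rcv w = 0 ∧
      s'.arr .quo w = 0) (by decide) (by decide) ?_ ?_ ?_) (by omega) fun s₃ _ h₃ => Spec.nil h₃
  · intro j s₁ s₂ harr _ h
    rwa [harr]
  · intro w hw
    rw [visits_zero]
    exact h₂ w hw
  · intro j hj s' _ _ hs' hw hI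
    have hwlt := (G.heads a j : Fin n).2
    have hdm := outDegree_le (G := G) v
    have hcnt := (hI _ (Or.inr ⟨j, hj, rfl⟩)).1
    have hle : visits (G.heads a) (G.heads a j) j ≤ j := Nat.count_le _
    refine Spec.of_wp ?_ (by decide)
    simp only [block, Code.wp, Op.Ok, Op.exec, Function.update_apply, reduceCtorEq, if_true,
      if_false, hw, hs'.one, hcnt]
    refine ⟨by omega, by omega, by omega, fun w hw' => ?_⟩
    rw [visits_succ]
    by_cases hwj : w = G.heads a j
    · subst hwj
      simpa using (hI _ hw').2
    · simp only [hne hwj, if_false, Ne.symm hwj, add_zero]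
      exact hI w hw'

end RotorSolver

namespace RotorSolver

open RAM RAM.Code RotorGraph

variable {n m : ℕ} {G : RotorGame (Fin n) (Fin m)} {root : Fin n} {ℓ : Limits} {v u : Fin n}
  {a : Fin m}

/-- `q` is the least positive value among the first `j` values of `f`, or `0` if there is none. -/
def Least (f : ℕ → ℕ) (j q : ℕ) : Prop :=
  (∀ i < j, 0 < f i → 0 < q ∧ q ≤ f i) ∧ (0 < q → ∃ i < j, f i = q)

theorem Least.keep {f : ℕ → ℕ} {j q : ℕ} (h : Least f j q) (hq : 0 < f j → 0 < q ∧ q ≤ f j) :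
    Least f (j + 1) q := by
  refine ⟨fun i hi hf => ?_, fun hq => ?_⟩
  · rcases Nat.lt_succ_iff_lt_or_eq.1 hi with h' | rfl
    · exact h.1 i h' hf
    · exact hq hf
  · obtain ⟨i, hi, hfi⟩ := h.2 hq
    exact ⟨i, by omega, hfi⟩

theorem Least.replace {f : ℕ → ℕ} {j q : ℕ} (h : Least f j q) (hf : 0 < f j)
    (hq : 0 < q → f j ≤ q) : Least f (j + 1) (f j) := by
  refine ⟨fun i hi hfi => ⟨hf, ?_⟩, fun _ => ⟨j, by omega, rfl⟩⟩
  rcases Nat.lt_succ_iff_lt_or_eq.1 hi with h' | rfl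
  · obtain ⟨h1, h2⟩ := h.1 i h' hfi
    exact (hq h1).trans h2
  · exact le_rfl

theorem spec_divideFlows (hlen : n + m ≤ ℓ.len) (hbig : 20 * ℓ.len + ℓ.fst * m ≤ ℓ.big)
    (hsnd : m ≤ ℓ.snd) (hv : v ∉ G.sinks) (ha : G.tail a = v) {s : Store Reg Arr}
    (hs : AtVertex G root v u a s) {X : Fin n → Outcome}
    (hflow : ∀ w, Neighbour G v u a w → w ≠ u →
      s.arr .flow w = (X w).flow ∧ (X w).flow ≤ ℓ.fst)
    (hcnt : ∀ w, Neighbour G v u a w →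
      s.arr .cnt w = visits (G.heads a) w (G.outDegree v) ∧ s.arr .quo w = 0) :
    Spec ℓ divideFlows s (45 * G.outDegree v + 6) fun s' =>
      (∀ w, Neighbour G v u a w →
        s'.arr .quo w = turns u (G.heads a) X (G.outDegree v) w ∧
        (0 < turns u (G.heads a) X (G.outDegree v) w →
          s'.arr .rem w = offset (G.heads a) X (G.outDegree v) w)) ∧
      Least (fun j => turns u (G.heads a) X (G.outDegree v) (G.heads a j)) (G.outDegree v)
        (s'.reg .qs) := by
  have hne : ∀ {x y : Fin n}, x ≠ y → (x : ℕ) ≠ y := fun h e => h (Fin.ext e)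
  have hm : 0 < m := Fin.pos a
  have hdm := outDegree_le (G := G) v
  have hu0 : turns u (G.heads a) X (G.outDegree v) u = 0 := if_neg fun h => h.1 rfl
  refine Spec.cons (T₁ := 1) (P := fun s' => s'.reg .qs = 0) (Spec.of_wp ?_ (by decide))
    (by omega) ?_
  · simp only [Code.wp, Op.Ok, Op.exec, Function.update_self]
    exact ⟨Nat.zero_le _, trivial⟩
  intro s₁ hF₁ hqs₁
  have hs₁ : AtVertex G root v u a s₁ := hs.frame hF₁ (by decide) (by decide)
  refine Spec.cons (spec_cycle (T := 36) hlen (by omega) hv ha hs₁ (I := fun j s' =>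
    ((∀ w, Neighbour G v u a w →
        (s'.arr .quo w = 0 ∨ s'.arr .quo w = turns u (G.heads a) X (G.outDegree v) w) ∧
        ((w = u ∨ ∃ i < j, G.heads a i = w) →
          s'.arr .quo w = turns u (G.heads a) X (G.outDegree v) w ∧
          (0 < turns u (G.heads a) X (G.outDegree v) w →
            s'.arr .rem w = offset (G.heads a) X (G.outDegree v) w))) ∧
      Least (fun j => turns u (G.heads a) X (G.outDegree v) (G.heads a j)) j (s'.reg .qs)))
    (by decide) (by decide) ?_ ?_ ?_) (by omega) fun s₂ _ h₂ => Spec.nil ⟨fun w hw => ?_, h₂.2⟩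
  · intro j s₁ s₂ harr hreg h
    rw [harr, hreg .qs (by decide) (by decide) (by decide)]
    exact h
  · refine ⟨fun w hw => ?_, fun i hi => absurd hi (Nat.not_lt_zero i), fun h => ?_⟩
    · have h0 : s₁.arr .quo w = 0 := by
        rw [hF₁.2 .quo rfl]
        exact (hcnt w hw).2
      refine ⟨Or.inl h0, ?_⟩
      rintro (rfl | ⟨i, hi, -⟩)
      · rw [hu0, h0]
        exact ⟨rfl, fun h => absurd h (lt_irrefl 0)⟩
      · omega
    · rw [hqs₁] at h
      exact absurd h (lt_irrefl 0)
  · intro j hj s' _ harr' hs' hw hI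
    obtain ⟨hI1, hI2⟩ := hI
    set w := G.heads a j with hwdef
    have hnb : Neighbour G v u a w := Or.inr ⟨j, hj, rfl⟩
    have hwlt := w.2
    have hult := u.2
    have ecnt : s'.arr .cnt w = visits (G.heads a) w (G.outDegree v) := by
      rw [harr' .cnt rfl, hF₁.2 .cnt rfl]
      exact (hcnt w hnb).1
    have hcle : visits (G.heads a) w (G.outDegree v) ≤ G.outDegree v := Nat.count_le _
    -- without a capture, the entries for `w` remain zero
    have hskip : turns u (G.heads a) X (G.outDegree v) w = 0 →
        (∀ w, Neighbour G v u a w →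
          (s'.arr .quo w = 0 ∨ s'.arr .quo w = turns u (G.heads a) X (G.outDegree v) w) ∧
          ((w = u ∨ ∃ i < j + 1, G.heads a i = w) →
            s'.arr .quo w = turns u (G.heads a) X (G.outDegree v) w ∧
            (0 < turns u (G.heads a) X (G.outDegree v) w →
              s'.arr .rem w = offset (G.heads a) X (G.outDegree v) w))) ∧
        Least (fun j => turns u (G.heads a) X (G.outDegree v) (G.heads a j)) (j + 1)
          (s'.reg .qs) := by
      intro ht
      refine ⟨fun w' hw' => ⟨(hI1 w' hw').1, fun h => ?_⟩, hI2.keep fun h => ?_⟩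
      · by_cases hww : w' = w
        · subst hww
          refine ⟨?_, fun h => absurd ht h.ne'⟩
          rcases (hI1 w hw').1 with h | h
          · rw [h, ht]
          · exact h
        · refine (hI1 w' hw').2 (h.imp_right ?_)
          rintro ⟨i, hi, rfl⟩
          rcases Nat.lt_succ_iff_lt_or_eq.1 hi with h | rfl
          · exact ⟨i, h, rfl⟩
          · exact absurd rfl hww
      · exact absurd ht h.ne'
    by_cases hwu : w = u
    · have ht : turns u (G.heads a) X (G.outDegree v) w = 0 := by rw [hwu, hu0]
      refine Spec.of_wp ?_ (by decide)
      simp only [block, Code.wp, Op.Ok, Op.exec, Function.update_apply, reduceCtorEq, if_true,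
        if_false, hw, hs'.reg_u, hs'.zero]
      exact ⟨by omega, trivial, trivial, by omega, fun h => absurd h (by rw [hwu]; omega),
        fun _ => hskip ht⟩
    · have eflow : s'.arr .flow w = (X w).flow ∧ (X w).flow ≤ ℓ.fst := by
        rw [harr' .flow rfl, hF₁.2 .flow rfl]
        exact hflow w hnb hwu
      have hne' := hne hwu
      have hfst : ℓ.fst ≤ ℓ.fst * m := Nat.le_mul_of_pos_right _ hm
      have hq1 : ((X w).flow - 1) / visits (G.heads a) w (G.outDegree v) ≤ (X w).flow - 1 :=
        Nat.div_le_self _ _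
      have hq2 : ((X w).flow - 1) / visits (G.heads a) w (G.outDegree v) *
          visits (G.heads a) w (G.outDegree v) ≤ (X w).flow - 1 := Nat.div_mul_le_self _ _
      refine Spec.of_wp ?_ (by decide)
      simp only [block, Code.wp, Op.Ok, Op.exec, Function.update_apply, reduceCtorEq, if_true,
        if_false, hw, hs'.reg_u, hs'.zero, hs'.one, eflow.1, ecnt]
      refine ⟨by omega, trivial, trivial, by omega, fun _ => ⟨fun hpos => ?_, fun h0 => ?_⟩,
        fun h => absurd h (by omega)⟩
      · have ht : turns u (G.heads a) X (G.outDegree v) w =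
          ((X w).flow - 1) / visits (G.heads a) w (G.outDegree v) + 1 := if_pos ⟨hwu, hpos⟩
        have ho : offset (G.heads a) X (G.outDegree v) w = (X w).flow - 1 -
            ((X w).flow - 1) / visits (G.heads a) w (G.outDegree v) *
              visits (G.heads a) w (G.outDegree v) := by
          rw [mul_comm]
          exact Nat.mod_eq_sub_mul_div
        rw [← ht, ← ho]
        have harr : ∀ w', Neighbour G v u a w' →
            ((if (w' : ℕ) = w then turns u (G.heads a) X (G.outDegree v) w else s'.arr .quo w') = 0 ∨
            (if (w' : ℕ) = w then turns u (G.heads a) X (G.outDegree v) w else s'.arr .quo w') =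
              turns u (G.heads a) X (G.outDegree v) w') ∧
            ((w' = u ∨ ∃ i < j + 1, G.heads a i = w') →
              (if (w' : ℕ) = w then turns u (G.heads a) X (G.outDegree v) w else s'.arr .quo w') =
                turns u (G.heads a) X (G.outDegree v) w' ∧
              (0 < turns u (G.heads a) X (G.outDegree v) w' →
                (if (w' : ℕ) = w then offset (G.heads a) X (G.outDegree v) w
                  else s'.arr .rem w') = offset (G.heads a) X (G.outDegree v) w')) := by
          intro w' hw'
          by_cases hww : w' = w
          · subst hww
            simp
          · simp only [hne hww, if_false]
            refine ⟨(hI1 w' hw').1, fun h => (hI1 w' hw').2 (h.imp_right ?_)⟩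
            rintro ⟨i, hi, rfl⟩
            rcases Nat.lt_succ_iff_lt_or_eq.1 hi with h | rfl
            · exact ⟨i, h, rfl⟩
            · exact absurd rfl hww
        have htp : 0 < turns u (G.heads a) X (G.outDegree v) w := ht ▸ Nat.succ_pos _
        have htb : turns u (G.heads a) X (G.outDegree v) w ≤ ℓ.big := by
          rw [ht]
          omega
        refine ⟨trivial, by omega, ⟨by omega, by omega⟩, ⟨by omega, by omega, by omega⟩, trivial,
          by omega, by omega, by omega, fun hqs => ⟨fun hlt => ⟨by omega, harr, ?_⟩,
            fun hge => ⟨harr, ?_⟩⟩, fun hqs => ⟨by omega, harr, ?_⟩⟩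
        · exact hI2.replace htp fun _ => hlt.le
        · exact hI2.keep fun _ => ⟨hqs, not_lt.1 hge⟩
        · exact hI2.replace htp fun h => absurd h hqs
      · refine hskip (if_neg ?_)
        rintro ⟨-, h⟩
        exact h0 h
  · refine (h₂.1 w hw).2 (hw.imp_right ?_)
    exact fun h => h

end RotorSolver

/-! ### Comparing the outcomes of a vertex -/

namespace RotorSolver

open RAM RAM.Code RotorGraph

variable {n m : ℕ} {G : RotorGame (Fin n) (Fin m)} {root : Fin n} {ℓ : Limits} {v u : Fin n}
  {a : Fin m}

theorem spec_testWindow {s : Store Reg Arr} (h0 : s.reg .zero = 0) (hlw : s.reg .lw < ℓ.len)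
    (hbig : 1 ≤ ℓ.big) :
    Spec ℓ testWindow s 20 fun s' => 0 < s'.reg .f ↔ 0 < s.arr .quo (s.reg .lw) ∧
      s.arr .quo (s.reg .lw) ≤ s.reg .qs ∧ s.arr .rem (s.reg .lw) < s.arr .rcv (s.reg .lw) := by
  refine Spec.of_wp ?_ (by decide)
  simp only [testWindow, block, Code.wp, Op.Ok, Op.exec, Function.update_apply, reduceCtorEq,
    if_true, if_false, h0]
  refine ⟨hlw, Nat.zero_le _, fun h1 => ⟨fun h2 => ?_, fun h2 => ⟨hlw, hlw, fun h3 => ⟨hbig, ?_⟩,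
    fun h3 => ?_⟩⟩, fun h1 => ?_⟩
  · simp only [lt_irrefl, false_iff]
    exact fun h => absurd h.2.1 (not_le.2 h2)
  · simp only [Nat.lt_one_iff, pos_of_gt, true_iff]
    exact ⟨h1, not_lt.1 h2, h3⟩
  · simp only [lt_irrefl, false_iff]
    exact fun h => h3 h.2.2
  · simp only [lt_irrefl, false_iff]
    exact fun h => h1 h.1

/-- The current outcome `C` replaces the best outcome `B` found before if it is better. -/
theorem spec_recordOutcome {s : Store Reg Arr} (h0 : s.reg .zero = 0) (h1 : s.reg .one = 1)
    {lw y : ℕ} (hlw : s.reg .lw = lw) (hu : s.reg .u = y) (hlen : lw < ℓ.len ∧ y < ℓ.len)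
    {β : Bool} {B C : Outcome} (hown : s.reg .own = β.toNat) (hbr : s.reg .br = B.flow)
    (hbb : s.reg .bb = B.win.toNat) (hwin : s.arr .win lw = C.win.toNat)
    (hflow : s.reg .base + s.arr .rcv y + 1 = C.flow) (hbig : C.flow + 1 ≤ ℓ.big) :
    Spec ℓ recordOutcome s 60 fun s' => ∃ B' : Outcome, s'.reg .br = B'.flow ∧
      s'.reg .bb = B'.win.toNat ∧ C.score β ≤ B'.score β ∧
      (B' = C ∨ 0 < B.flow ∧ B' = B) ∧ (0 < B.flow → B.score β ≤ B'.score β) := by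
  have hC : 0 < C.flow := by omega
  have hb : ∀ b : Bool, b.toNat ≤ 1 := Bool.toNat_le
  have hnew : (0 < B.flow → B.score β ≤ C.score β) → ∃ B' : Outcome, C.flow = B'.flow ∧
      C.win.toNat = B'.win.toNat ∧ C.score β ≤ B'.score β ∧
      (B' = C ∨ 0 < B.flow ∧ B' = B) ∧ (0 < B.flow → B.score β ≤ B'.score β) :=
    fun h => ⟨C, rfl, rfl, le_rfl, Or.inl rfl, h⟩
  have hold : 0 < B.flow → ¬ B.score β < C.score β → ∃ B' : Outcome, B.flow = B'.flow ∧
      B.win.toNat = B'.win.toNat ∧ C.score β ≤ B'.score β ∧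
      (B' = C ∨ 0 < B.flow ∧ B' = B) ∧ (0 < B.flow → B.score β ≤ B'.score β) :=
    fun h h' => ⟨B, rfl, rfl, not_lt.1 h', Or.inr ⟨h, rfl⟩, fun _ => le_rfl⟩
  refine Spec.of_wp ?_ (by decide)
  simp only [recordOutcome, block, Code.wp, Op.Ok, Op.exec, Function.update_apply, reduceCtorEq,
    if_true, if_false, h0, h1, hlw, hu, hown, hbr, hbb, hwin, hflow]
  have hbβ := hb β
  have hbC := hb C.win
  refine ⟨hlen.1, hlen.2, by omega, by omega, by omega, fun hB => ?_, fun hB => ?_⟩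
  · have hlt := Outcome.score_lt_iff (β := β) hB hC
    rcases B with ⟨bw, bf⟩
    rcases C with ⟨cw, cf⟩
    simp only at hB hlt hC hbig hnew hold ⊢
    have hn : Outcome.score β ⟨bw, bf⟩ < Outcome.score β ⟨cw, cf⟩ → ∃ B' : Outcome, cf = B'.flow ∧
      cw.toNat = B'.win.toNat ∧ Outcome.score β ⟨cw, cf⟩ ≤ B'.score β ∧
      (B' = ⟨cw, cf⟩ ∨ 0 < bf ∧ B' = ⟨bw, bf⟩) ∧
      (0 < bf → Outcome.score β ⟨bw, bf⟩ ≤ B'.score β) := fun h => hnew fun _ => h.le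
    have ho := hold hB
    rw [hlt] at hn ho
    clear hlt hnew hold
    have b1 : 1 ≤ ℓ.big := by omega
    have b2 : cf ≤ ℓ.big := by omega
    cases bw <;> cases cw <;> cases β <;> simp [b1, b2] at hn ho ⊢ <;>
      first
        | exact ⟨hn, ho⟩
        | exact hn
        | exact ho
  · refine ⟨by omega, fun _ => ⟨by omega, by omega, hnew fun h => absurd h hB⟩, fun h => ?_⟩
    exact absurd Nat.one_pos h

open Classical in
/-- The number of arcs at which the rotor of `v` can be when the walk starts. -/
noncomputable def starts (G : RotorGame (Fin n) (Fin m)) (v : Fin n) : ℕ :=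
  if v ∈ G.rotorVerts then 1 else G.outDegree v

theorem starts_le (ha : G.tail a = v) : starts G v ≤ G.outDegree v := by
  unfold starts
  split_ifs
  · have := outDegree_pos (G := G.toRotorGraph) a
    rw [ha] at this
    exact this
  · exact le_rfl

theorem mem_choices_iff (hv : v ∉ G.sinks) (ha : a ∈ G.choices v) {b : Fin m} :
    b ∈ G.choices v ↔ ∃ i < starts G v, G.next^[i] a = b := by
  have hta : G.tail a ∉ G.sinks := ha.1.symm ▸ hv
  unfold starts
  split_ifs with h
  · constructor
    · intro hb
      exact ⟨0, Nat.one_pos, RotorGame.eq_of_mem_choices h ha hb⟩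
    · rintro ⟨i, hi, rfl⟩
      obtain rfl : i = 0 := by omega
      exact ha
  · constructor
    · intro hb
      have := exists_iterate_eq hta (hb.1.trans ha.1.symm)
      rwa [ha.1] at this
    · rintro ⟨i, -, rfl⟩
      exact ⟨(tail_iterate hta i).trans ha.1, fun h' => absurd h' h⟩

/-- `B` is the best of the outcomes for the first `i` starts. -/
def Best (β : Bool) (O : ℕ → Outcome) (i : ℕ) (B : Outcome) : Prop :=
  (∀ j < i, (O j).score β ≤ B.score β) ∧ (0 < B.flow → ∃ j < i, B = O j) ∧ (0 < i → 0 < B.flow)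

theorem Best.succ {β : Bool} {O : ℕ → Outcome} {i : ℕ} {B B' : Outcome} (h : Best β O i B)
    (hO : 0 < (O i).flow) (h1 : (O i).score β ≤ B'.score β)
    (h2 : B' = O i ∨ 0 < B.flow ∧ B' = B) (h3 : 0 < B.flow → B.score β ≤ B'.score β) :
    Best β O (i + 1) B' := by
  have hB' : 0 < B'.flow := by
    rcases h2 with rfl | ⟨h, rfl⟩
    · exact hO
    · exact h
  refine ⟨fun j hj => ?_, fun _ => ?_, fun _ => hB'⟩
  · rcases Nat.lt_succ_iff_lt_or_eq.1 hj with h' | rfl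
    · exact (h.1 j h').trans (h3 (h.2.2 (by omega)))
    · exact h1
  · rcases h2 with rfl | ⟨hB, rfl⟩
    · exact ⟨i, by omega, rfl⟩
    · obtain ⟨j, hj, he⟩ := h.2.1 hB
      exact ⟨j, by omega, he⟩

/-- The best outcome is the one that satisfies the optimality equation. -/
theorem Best.eq {c : Fin n → Bool} {par : Fin n → Fin n} {X : Fin n → Outcome}
    (hX : G.IsOpt par c X) (hv : v ∉ G.sinks) (ha : a ∈ G.choices v) {B : Outcome}
    (h : Best (G.owner v)
      (fun i => nodeOutcome (par v) (fun j => G.heads a (i + j)) X) (starts G v) B) : B = X v := by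
  obtain ⟨⟨b, hb, hXv⟩, hmax⟩ := (hX v).2 hv
  obtain ⟨i, hi, rfl⟩ := (mem_choices_iff hv ha).1 hb
  have hheads : ∀ i, G.heads (G.next^[i] a) = fun j => G.heads a (i + j) := fun i =>
    funext fun j => heads_iterate a i j
  have hB := h.2.2 (by omega)
  obtain ⟨i', hi', he⟩ := h.2.1 hB
  refine Outcome.eq_of_score_eq (β := G.owner v) (le_antisymm ?_ ?_) hB
  · have he' : B = nodeOutcome (par v) (G.heads (G.next^[i'] a)) X := by
      rw [hheads]
      exact he
    rw [he']
    exact hmax _ ((mem_choices_iff hv ha).2 ⟨i', hi', rfl⟩)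
  · rw [hXv, hheads]
    exact h.1 i hi

end RotorSolver

/-! ### The sliding window -/

namespace RotorSolver

open RAM RAM.Code RotorGraph

variable {n m : ℕ} {G : RotorGame (Fin n) (Fin m)} {root : Fin n} {ℓ : Limits} {v u : Fin n}
  {a : Fin m}

/-- The window consists of the departures `i, …, p - 1`; no child captures the particle during
the departures `i, …, p - 2`. -/
structure Window (G : RotorGame (Fin n) (Fin m)) (v u : Fin n) (a : Fin m) (X : Fin n → Outcome)
    (q i p : ℕ) (s : Store Reg Arr) : Prop where
  reg_c : s.reg .c = starts G v - i
  reg_es : s.reg .es = (G.next^[i] a : Fin m)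
  reg_ep : s.reg .ep = (G.next^[p] a : Fin m)
  reg_lw : s.reg .lw = (if p = 0 then u else G.heads a (p - 1) : Fin n)
  le_left : i ≤ p
  le_right : p ≤ i + G.outDegree v
  rcv : ∀ w, Neighbour G v u a w →
    s.arr .rcv w = visits (G.heads a) w p - visits (G.heads a) w i
  not_captured : ∀ w, Neighbour G v u a w → turns u (G.heads a) X (G.outDegree v) w = q →
    visits (G.heads a) w (p - 1) - visits (G.heads a) w i ≤
      offset (G.heads a) X (G.outDegree v) w

theorem neighbour_heads (hv : v ∉ G.sinks) (ha : G.tail a = v) (j : ℕ) :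
    Neighbour G v u a (G.heads a j) := by
  have hd : ∀ j, G.heads a (j + G.outDegree v) = G.heads a j := fun j => by
    have := heads_add_outDegree (G := G.toRotorGraph) (a := a) (by rwa [ha]) j
    rwa [ha] at this
  have hpos := outDegree_pos (G := G.toRotorGraph) a
  rw [ha] at hpos
  exact Or.inr ⟨j % G.outDegree v, Nat.mod_lt _ hpos,
    Function.Periodic.map_mod_nat (f := G.heads a) hd j⟩

/-- The sliding window finds the best outcome of `v` in time linear in the number of arcs at `v`. -/
theorem spec_slideWindow (hlen : n + m ≤ ℓ.len) (hbig : 20 * ℓ.len + ℓ.fst * m ≤ ℓ.big)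
    (hsnd : m ≤ ℓ.snd) (hv : v ∉ G.sinks) (ha : a ∈ G.choices v) {s : Store Reg Arr}
    (hs : AtVertex G root v u a s) {X : Fin n → Outcome}
    (hflow : ∀ w, Neighbour G v u a w → w ≠ u → (X w).flow ≤ ℓ.fst ∧
      s.arr .win w = (X w).win.toNat)
    (hcnt : s.arr .cnt u = visits (G.heads a) u (G.outDegree v))
    (hrcv : ∀ w, Neighbour G v u a w → s.arr .rcv w = 0)
    (hquo : ∀ w, Neighbour G v u a w →
      s.arr .quo w = turns u (G.heads a) X (G.outDegree v) w ∧
      (0 < turns u (G.heads a) X (G.outDegree v) w →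
        s.arr .rem w = offset (G.heads a) X (G.outDegree v) w))
    (hqs : Least (fun j => turns u (G.heads a) X (G.outDegree v) (G.heads a j)) (G.outDegree v)
      (s.reg .qs)) (hqs0 : 0 < s.reg .qs) :
    Spec ℓ slideWindow s (400 * G.outDegree v + 30) fun s' => ∃ B : Outcome,
      Best (G.owner v) (fun i => nodeOutcome u (fun j => G.heads a (i + j)) X) (starts G v) B ∧
      s'.arr .flow = Function.update (s.arr .flow) v B.flow ∧
      s'.arr .win = Function.update (s.arr .win) v B.win.toNat := by
  have hta : G.tail a ∉ G.sinks := ha.1.symm ▸ hv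
  have hd : ∀ j, G.heads a (j + G.outDegree v) = G.heads a j := fun j => by
    have := heads_add_outDegree (G := G.toRotorGraph) hta j
    rwa [ha.1] at this
  have hdpos := outDegree_pos (G := G.toRotorGraph) a
  rw [ha.1] at hdpos
  have hne : ∀ {x y : Fin n}, x ≠ y → (x : ℕ) ≠ y := fun h e => h (Fin.ext e)
  have hdm := outDegree_le (G := G) v
  have hvlt := v.2
  have hult := u.2
  have halt := a.2
  have hm : 0 < m := Fin.pos a
  have hNd := starts_le (G := G) ha.1
  have hnb := neighbour_heads (u := u) hv ha.1
  have hcle : ∀ w t, visits (G.heads a) w t ≤ t := fun w t => Nat.count_le _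
  set q := s.reg .qs with hq
  set N := starts G v with hN
  have hmin : ∀ w, 0 < visits (G.heads a) w (G.outDegree v) →
      0 < turns u (G.heads a) X (G.outDegree v) w →
      q ≤ turns u (G.heads a) X (G.outDegree v) w := by
    intro w hw hw'
    obtain ⟨j, hj, rfl⟩ := visits_pos_iff.1 hw
    exact (hqs.1 j hj hw').2
  have hu0 : turns u (G.heads a) X (G.outDegree v) u = 0 := if_neg fun h => h.1 rfl
  obtain ⟨j₀, hj₀, hj₀q⟩ := hqs.2 hqs0
  have hq1 : q - 1 ≤ ℓ.fst := by
    by_cases hwu : G.heads a j₀ = u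
    · simp only [hwu, hu0] at hj₀q
      omega
    · have h1 := (hflow _ (hnb j₀) hwu).1
      simp only [turns] at hj₀q
      split_ifs at hj₀q
      · have := Nat.div_le_self ((X (G.heads a j₀)).flow - 1)
          (visits (G.heads a) (G.heads a j₀) (G.outDegree v))
        rw [← hj₀q]
        omega
      · omega
  -- the operands of the multiplication are within the bounds for the flows and for the arcs
  have hmul : (q - 1) * visits (G.heads a) u (G.outDegree v) ≤ ℓ.fst * m :=
    Nat.mul_le_mul hq1 ((hcle _ _).trans hdm)
  have hfst : ℓ.fst ≤ ℓ.fst * m := Nat.le_mul_of_pos_right _ hm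
  refine Spec.cons (T₁ := 22) (P := fun s' => s'.reg .qs = q ∧
    s'.reg .base = (q - 1) * visits (G.heads a) u (G.outDegree v) ∧
    s'.reg .own = (G.owner v).toNat ∧ s'.reg .br = 0 ∧ s'.reg .bb = 0 ∧
    s'.reg .c = N ∧ s'.reg .es = a ∧ s'.reg .ep = a ∧ s'.reg .lw = u) (Spec.of_wp ?_ (by decide))
    (by omega) ?_
  · have hk1 := hs.kind_max v hv
    have hk0 := hs.kind_rotor v hv
    have hkb := (hs.kind_sink v).2 hv
    simp only [block, Code.wp, Op.Ok, Op.exec, Function.update_apply, reduceCtorEq, if_true,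
      if_false, hs.reg_u, hs.reg_v, hs.reg_a, hs.reg_d, hs.zero, hs.one, hs.two, hcnt, ← hq]
    have h2 : (¬ s.arr .kind v < 2) → (G.owner v).toNat = 0 := fun h => by
      cases ho : G.owner v
      · rfl
      · have := hk1.2 ho
        omega
    have h1 : 0 < s.arr .kind v → N = G.outDegree v := fun h => by
      rw [hN, starts, if_neg fun h' => ?_]
      have := hk0.2 h'
      omega
    have h3 : 0 < s.arr .kind v → s.arr .kind v < 2 → s.arr .kind v = (G.owner v).toNat :=
      fun h h' => by
        have h4 : s.arr .kind v = 1 := by omega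
        rw [h4, hk1.1 h4]
        rfl
    have h5 : ¬ 0 < s.arr .kind v → N = 1 ∧ s.arr .kind v = (G.owner v).toNat := fun h => by
      have h4 : s.arr .kind v = 0 := by omega
      refine ⟨by rw [hN, starts, if_pos (hk0.1 h4)], ?_⟩
      cases ho : G.owner v
      · exact h4
      · have := hk1.2 ho
        omega
    have hcm := (hcle u (G.outDegree v)).trans hdm
    refine ⟨trivial, by omega, ⟨hq1, by omega, by omega⟩, by omega, fun h => ⟨by omega,
        fun h' => ?_, fun h' => ?_⟩, fun h => ⟨by omega, fun h' => ?_, fun h' => ?_⟩⟩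
    · exact ⟨by omega, by omega, by omega, by omega, by omega, trivial, trivial, h3 h h',
        trivial, trivial,
        (h1 h).symm, rfl, rfl, rfl⟩
    · exact ⟨by omega, by omega, by omega, by omega, by omega, by omega, trivial, trivial,
        (h2 h').symm, trivial, trivial, (h1 h).symm, rfl, rfl, rfl⟩
    · exact ⟨by omega, by omega, by omega, by omega, by omega, trivial, trivial, (h5 h).2,
        trivial, trivial,
        (h5 h).1.symm, rfl, rfl, rfl⟩
    · omega
  rintro s₁ hF₁ ⟨hq₁, hbase₁, hown₁, hbr₁, hbb₁, hc₁, hes₁, hep₁, hlw₁⟩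
  have hs₁ : AtVertex G root v u a s₁ := hs.frame hF₁ (by decide) (by decide)
  refine Spec.cons (T₁ := 400 * G.outDegree v + 2) (P := fun s' => ∃ B : Outcome,
    Best (G.owner v) (fun i => nodeOutcome u (fun j => G.heads a (i + j)) X) N B ∧
    s'.reg .br = B.flow ∧ s'.reg .bb = B.win.toNat ∧ B.flow ≤ ℓ.big) ?_ (by omega) ?_
  swap
  · rintro s₂ hF₂ ⟨B, hB, hbr, hbb, -⟩
    have hs₂ : AtVertex G root v u a s₂ := hs₁.frame hF₂ (by decide) (by decide)
    have hf2 : s₂.arr .flow = s.arr .flow := (hF₂.2 .flow rfl).trans (hF₁.2 .flow rfl)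
    have hw2 : s₂.arr .win = s.arr .win := (hF₂.2 .win rfl).trans (hF₁.2 .win rfl)
    refine Spec.of_wp ?_ (show _ ≤ _ by simp only [block, Code.length, Op.time]; omega)
    simp only [block, Code.wp, Op.Ok, Op.exec, ne_eq, not_false_eq_true, Function.update_of_ne,
      Function.update_self, reduceCtorEq, hs₂.reg_v, hbr, hbb, hf2, hw2]
    exact ⟨by omega, by omega, B, hB, rfl, rfl⟩
  -- Every round increases `i ≤ N` or `p ≤ 2 * outDegree`.
  refine Spec.loop (fun K s' => ∃ i p B, i ≤ N ∧ Window G v u a X q i p s' ∧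
    Best (G.owner v) (fun i => nodeOutcome u (fun j => G.heads a (i + j)) X) i B ∧
    s'.reg .br = B.flow ∧ s'.reg .bb = B.win.toNat ∧ B.flow ≤ ℓ.big ∧
    K = 120 * (N - i) + 120 * (2 * G.outDegree v - p)) (120 * N + 120 * (2 * G.outDegree v))
    ⟨0, 0, ⟨false, 0⟩, Nat.zero_le _, ⟨hc₁, hes₁, hep₁, hlw₁, le_rfl, Nat.zero_le _,
      fun w hw => ?_, fun w _ _ => ?_⟩, ⟨fun j hj => absurd hj (Nat.not_lt_zero j),
        fun h => absurd h (lt_irrefl 0), fun h => absurd h (lt_irrefl 0)⟩, hbr₁, hbb₁,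
        Nat.zero_le _, rfl⟩ ?_ ?_ (by omega)
  · rw [Nat.sub_self, hF₁.2 .rcv rfl]
    exact hrcv w hw
  · simp
  · rintro K s' hF ⟨i, p, B, hi, hW, hB, hbr, hbb, hBbig, rfl⟩ hlt
    have hs' : AtVertex G root v u a s' := hs₁.frame hF (by decide) (by decide)
    have hqs' : s'.reg .qs = q := (hF.1 .qs rfl).trans hq₁
    have hbase' := (hF.1 .base rfl).trans hbase₁
    have hown' := (hF.1 .own rfl).trans hown₁
    have hwin' : s'.arr .win = s.arr .win := (hF.2 .win rfl).trans (hF₁.2 .win rfl)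
    have hquo' : s'.arr .quo = s.arr .quo := (hF.2 .quo rfl).trans (hF₁.2 .quo rfl)
    have hrem' : s'.arr .rem = s.arr .rem := (hF.2 .rem rfl).trans (hF₁.2 .rem rfl)
    rw [hs'.zero, hW.reg_c, ← hN] at hlt
    have hil := hW.le_left
    have hir := hW.le_right
    obtain ⟨w, hw⟩ : ∃ w, w = if p = 0 then u else G.heads a (p - 1) := ⟨_, rfl⟩
    have hlw : s'.reg .lw = w := by rw [hW.reg_lw, hw]
    have hnbw : Neighbour G v u a w := by
      rw [hw]
      split_ifs
      · exact Or.inl rfl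
      · exact hnb _
    have hwlt := w.2
    refine ⟨118, Spec.cons (spec_testWindow hs'.zero (by omega) (by omega)) (by omega) ?_⟩
    intro s₂ hF₂ htest
    rw [hlw, hquo', hrem', hqs', (hquo w hnbw).1, hW.rcv w hnbw] at htest
    have hs₂ : AtVertex G root v u a s₂ := hs'.frame hF₂ (by decide) (by decide)
    have hlw₂ : s₂.reg .lw = w := (hF₂.1 .lw rfl).trans hlw
    have hrcv₂ : s₂.arr .rcv = s'.arr .rcv := hF₂.2 .rcv rfl
    -- the last vertex of the window captures the particle
    have htest' : 0 < s₂.reg .f ↔ turns u (G.heads a) X (G.outDegree v) w = q ∧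
        offset (G.heads a) X (G.outDegree v) w <
          visits (G.heads a) w p - visits (G.heads a) w i := by
      rw [htest]
      constructor
      · rintro ⟨h1, h2, h3⟩
        rw [(hquo w hnbw).2 h1] at h3
        refine ⟨le_antisymm h2 (hmin w ?_ h1), h3⟩
        rcases hnbw with rfl | hj
        · omega
        · exact visits_pos_iff.2 hj
      · rintro ⟨h1, h2⟩
        have h3 : 0 < turns u (G.heads a) X (G.outDegree v) w := by omega
        exact ⟨h3, h1.le, by rwa [(hquo w hnbw).2 h3]⟩
    refine Spec.cons (T₁ := 92) (P := fun s'' => ∃ n', (∃ i p B, i ≤ N ∧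
      Window G v u a X q i p s'' ∧
      Best (G.owner v) (fun i => nodeOutcome u (fun j => G.heads a (i + j)) X) i B ∧
      s''.reg .br = B.flow ∧ s''.reg .bb = B.win.toNat ∧ B.flow ≤ ℓ.big ∧
      n' = 120 * (N - i) + 120 * (2 * G.outDegree v - p)) ∧
      n' + 118 + 2 ≤ 120 * (N - i) + 120 * (2 * G.outDegree v - p))
      (Spec.ite (T := 90) (fun hf => ?_) fun hf => ?_) (by omega) fun s₃ _ h₃ => Spec.nil h₃
    · rw [hs₂.zero, htest'] at hf
      obtain ⟨hwq, hwo⟩ := hf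
      have hip : i < p := by
        by_contra h
        rw [show p = i by omega] at hwo
        omega
      rw [if_neg (by omega)] at hw
      have hshift : ∀ w' t, visits (G.heads a) w' (i + t) - visits (G.heads a) w' i =
          visits (fun j => G.heads a (i + j)) w' t := fun w' t => by
        rw [visits_add]
        omega
      obtain ⟨k, rfl⟩ : ∃ k, p = i + k + 1 := ⟨p - i - 1, by omega⟩
      have hwk : w = G.heads a (i + k) := hw
      have hwu : w ≠ u := by
        rintro rfl
        omega
      have hO := nodeOutcome_of_window (u := u) (X := X) hd hqs0 hmin (s := i) (k := k) (by omega)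
        (fun w' hw' ht => by
          rw [← hshift]
          refine hW.not_captured w' ?_ ht
          obtain ⟨j, hj, rfl⟩ := visits_pos_iff.1 hw'
          exact hnb j) (by rw [← hwk]; exact hwq) (by
          rw [← hwk, ← hshift]
          exact hwo)
      rw [← hwk] at hO
      have hvu : visits (fun j => G.heads a (i + j)) u (k + 1) ≤ k + 1 := Nat.count_le _
      refine Spec.cons (spec_recordOutcome (y := u) hs₂.zero hs₂.one hlw₂ hs₂.reg_u ⟨by omega,
        by omega⟩ (β := G.owner v) (B := B)
        (C := nodeOutcome u (fun j => G.heads a (i + j)) X) ((hF₂.1 .own rfl).trans hown')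
        ((hF₂.1 .br rfl).trans hbr) ((hF₂.1 .bb rfl).trans hbb) ?_ ?_ ?_) (by omega) ?_
      · rw [hF₂.2 .win rfl, hwin', (hflow w hnbw hwu).2, hO]
      · rw [hF₂.1 .base rfl, hbase', hrcv₂, hW.rcv u (Or.inl rfl), hO, add_assoc i, hshift]
      · rw [hO]
        simp only
        omega
      rintro s₃ hF₃ ⟨B', hbr₃, hbb₃, h1, h2, h3⟩
      have hs₃ : AtVertex G root v u a s₃ := hs₂.frame hF₃ (by decide) (by decide)
      have hbest := hB.succ (B' := B') (by rw [hO]; exact Nat.succ_pos _) h1 h2 h3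
      have hB'big : B'.flow ≤ ℓ.big := by
        rcases h2 with rfl | ⟨-, rfl⟩
        · rw [hO]
          simp only
          omega
        · exact hBbig
      have hes : s₃.reg .es = (G.next^[i] a : Fin m) :=
        (hF₃.1 .es rfl).trans ((hF₂.1 .es rfl).trans hW.reg_es)
      have hep : s₃.reg .ep = (G.next^[i + k + 1] a : Fin m) :=
        (hF₃.1 .ep rfl).trans ((hF₂.1 .ep rfl).trans hW.reg_ep)
      have hlw₃ : s₃.reg .lw = w := (hF₃.1 .lw rfl).trans hlw₂
      have hc₃ : s₃.reg .c = N - i := (hF₃.1 .c rfl).trans ((hF₂.1 .c rfl).trans hW.reg_c)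
      have hrcv₃ : s₃.arr .rcv = s'.arr .rcv := (hF₃.2 .rcv rfl).trans hrcv₂
      have ehd : s₃.arr .hd ((G.next^[i] a : Fin m) : ℕ) = (G.heads a i : Fin n) := hs₃.head _
      have enx : s₃.arr .nx ((G.next^[i] a : Fin m) : ℕ) = (G.next^[i + 1] a : Fin m) := by
        rw [hs₃.next _ (by rw [tail_iterate hta]; exact hta), Function.iterate_succ_apply']
      have helt := (G.next^[i] a : Fin m).2
      have hhlt := (G.heads a i : Fin n).2
      refine Spec.cons (T₁ := 12) (P := fun s'' => ∃ n', (∃ i p B, i ≤ N ∧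
        Window G v u a X q i p s'' ∧
        Best (G.owner v) (fun i => nodeOutcome u (fun j => G.heads a (i + j)) X) i B ∧
        s''.reg .br = B.flow ∧ s''.reg .bb = B.win.toNat ∧ B.flow ≤ ℓ.big ∧
        n' = 120 * (N - i) + 120 * (2 * G.outDegree v - p)) ∧
        n' + 118 + 2 ≤ 120 * (N - i) + 120 * (2 * G.outDegree v - (i + k + 1)))
        (Spec.of_wp ?_ (by decide)) (by omega) fun s₄ _ h₄ => Spec.nil h₄
      simp only [shrinkWindow, block, Code.wp, Op.Ok, Op.exec, reduceCtorEq, ne_eq,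
        not_false_eq_true, Function.update_of_ne, Function.update_self, hs₃.one, hes, ehd, enx,
        hc₃, hrcv₃]
      refine ⟨by omega, by omega, trivial, by omega, by omega, trivial,
        120 * (N - (i + 1)) + 120 * (2 * G.outDegree v - (i + k + 1)), ⟨i + 1, i + k + 1, B',
        by omega, ⟨?_, ?_, ?_, ?_, by omega, by omega, fun w' hw' => ?_, fun w' hw' ht => ?_⟩,
        hbest, hbr₃, hbb₃, hB'big, rfl⟩, by omega⟩
      · simp
        omega
      · simp
      · simp [hep]
      · simp [hlw₃, hwk]
      · simp only [Function.update_apply, if_true]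
        rw [visits_succ _ _ i]
        by_cases h : w' = G.heads a i
        · subst h
          simp only [if_true]
          rw [hW.rcv _ hw']
          omega
        · rw [if_neg (hne h), if_neg (Ne.symm h), add_zero]
          exact hW.rcv _ hw'
      · refine le_trans ?_ (hW.not_captured w' hw' ht)
        have := visits_mono (G.heads a) w' (show i ≤ i + 1 by omega)
        omega
    · rw [hs₂.zero, htest'] at hf
      -- no child captures the particle in the window
      have hnot : ∀ w', Neighbour G v u a w' → turns u (G.heads a) X (G.outDegree v) w' = q →
          visits (G.heads a) w' p - visits (G.heads a) w' i ≤
            offset (G.heads a) X (G.outDegree v) w' := by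
        intro w' hw' ht
        by_cases hww : w' = w
        · subst hww
          by_contra h
          exact hf ⟨ht, not_le.1 h⟩
        · refine le_trans ?_ (hW.not_captured w' hw' ht)
          rcases Nat.eq_zero_or_pos p with rfl | hp
          · exact le_rfl
          · rw [if_neg hp.ne'] at hw
            obtain ⟨p, rfl⟩ : ∃ p', p = p' + 1 := ⟨p - 1, by omega⟩
            simp only [Nat.add_sub_cancel] at hw ⊢
            rw [visits_succ, if_neg (by rw [← hw]; exact Ne.symm hww), add_zero]
      -- a full turn contains the capture by the child that attains the least number of turns
      have hplt : p < i + G.outDegree v := by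
        by_contra h
        have hp : p = i + G.outDegree v := by omega
        have h1 := hnot _ (hnb j₀) hj₀q
        rw [hp, visits_add_period _ hd, Nat.add_sub_cancel_left] at h1
        have h2 : 0 < visits (G.heads a) (G.heads a j₀) (G.outDegree v) :=
          visits_pos_iff.2 ⟨j₀, hj₀, rfl⟩
        exact absurd (Nat.mod_lt _ h2) (not_lt.2 h1)
      have hes : s₂.reg .es = (G.next^[i] a : Fin m) := (hF₂.1 .es rfl).trans hW.reg_es
      have hep : s₂.reg .ep = (G.next^[p] a : Fin m) := (hF₂.1 .ep rfl).trans hW.reg_ep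
      have hc₂ : s₂.reg .c = N - i := (hF₂.1 .c rfl).trans hW.reg_c
      have ehd : s₂.arr .hd ((G.next^[p] a : Fin m) : ℕ) = (G.heads a p : Fin n) := hs₂.head _
      have enx : s₂.arr .nx ((G.next^[p] a : Fin m) : ℕ) = (G.next^[p + 1] a : Fin m) := by
        rw [hs₂.next _ (by rw [tail_iterate hta]; exact hta), Function.iterate_succ_apply']
      have helt := (G.next^[p] a : Fin m).2
      have hhlt := (G.heads a p : Fin n).2
      have hrc : s'.arr .rcv (G.heads a p) ≤ p := by
        rw [hW.rcv _ (hnb p)]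
        exact (Nat.sub_le _ _).trans (hcle _ _)
      refine Spec.of_wp ?_ (by decide)
      simp only [growWindow, block, Code.wp, Op.Ok, Op.exec, reduceCtorEq, ne_eq,
        not_false_eq_true, Function.update_of_ne, Function.update_self, hs₂.one, hep, ehd, enx,
        hrcv₂]
      refine ⟨by omega, by omega, by omega, by omega, by omega,
        120 * (N - i) + 120 * (2 * G.outDegree v - (p + 1)), ⟨i, p + 1, B,
        by omega, ⟨?_, ?_, ?_, ?_, by omega, by omega, fun w' hw' => ?_, fun w' hw' ht => ?_⟩,
        hB, (hF₂.1 .br rfl).trans hbr, (hF₂.1 .bb rfl).trans hbb, hBbig, rfl⟩, by omega⟩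
      · simp [hc₂, hN]
      · simp [hes]
      · simp
      · simp
      · simp only [Function.update_apply, if_true]
        rw [visits_succ]
        have := visits_mono (G.heads a) w' hil
        by_cases h : w' = G.heads a p
        · subst h
          simp only [if_true]
          rw [hW.rcv _ hw']
          omega
        · rw [if_neg (hne h), if_neg (Ne.symm h), add_zero]
          exact hW.rcv _ hw'
      · exact hnot w' hw' ht
  · rintro K s' hF ⟨i, p, B, hi, hW, hB, hbr, hbb, hBbig, rfl⟩ hlt
    rw [(hF.1 .zero rfl).trans hs₁.zero, hW.reg_c, ← hN] at hlt
    obtain rfl : i = N := by omega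
    exact ⟨B, hB, hbr, hbb, hBbig⟩

end RotorSolver

/-! ### Outcomes of all vertices -/

namespace RotorSolver

open RAM RAM.Code RotorGraph

variable {n m : ℕ} {G : RotorGame (Fin n) (Fin m)} {root : Fin n} {par : Fin n → Fin n}
  {depth : Fin n → ℕ} {c : Fin n → Bool} {X : Fin n → Outcome} {ℓ : Limits}

/-- The outcome of `v` is computed from those of its children. -/
theorem spec_evalNode (hlen : n + m ≤ ℓ.len) (hbig : 20 * ℓ.len + ℓ.fst * m ≤ ℓ.big)
    (hsnd : m ≤ ℓ.snd) (hX : G.IsOpt par c X) {v : Fin n} (hv : v ∉ G.sinks)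
    {s : Store Reg Arr} (hs : Loaded G root s) (hsv : s.reg .v = v) (hpar : s.arr .par v = par v)
    (hflow : ∀ w, G.HasArc v w → w ≠ par v → (X w).flow ≤ ℓ.fst ∧ s.arr .flow w = (X w).flow ∧
      s.arr .win w = (X w).win.toNat) :
    Spec ℓ evalNode s (474 * G.outDegree v + 70) fun s' =>
      s'.arr .flow = Function.update (s.arr .flow) v (X v).flow ∧
      s'.arr .win = Function.update (s.arr .win) v (X v).win.toNat := by
  obtain ⟨a, ha, hst⟩ := hs.start v hv
  have hvlt := v.2
  have hta : G.tail a ∉ G.sinks := ha.1.symm ▸ hv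
  refine Spec.cons (T₁ := 6) (P := fun s => s.reg .u = par v ∧ s.reg .a = a ∧
    s.reg .d = G.outDegree v) (Spec.of_wp ?_ (by decide)) (by omega) ?_
  · simp only [block, Code.wp, Op.Ok, Op.exec, Function.update_apply, reduceCtorEq, if_true,
      if_false, hsv, hpar, hst, hs.deg]
    exact ⟨by omega, by omega, by omega, trivial, trivial, trivial⟩
  rintro s₁ hF₁ ⟨hu, hsa, hd⟩
  have hs₁ : AtVertex G root v (par v) a s₁ :=
    ⟨hs.frame hF₁ (by decide) (by decide), (hF₁.1 .v rfl).trans hsv, hu, hsa, hd⟩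
  have hchild : ∀ w, Neighbour G v (par v) a w → w ≠ par v → (X w).flow ≤ ℓ.fst ∧
      s.arr .flow w = (X w).flow ∧ s.arr .win w = (X w).win.toNat := by
    rintro w (rfl | ⟨j, -, rfl⟩) hw
    · exact absurd rfl hw
    · refine hflow _ ?_ hw
      have := hasArc_heads hta j
      rwa [ha.1] at this
  refine Spec.cons (spec_countArcs hlen (by omega) hv ha.1 hs₁) (by omega) fun s₂ hF₂ hcnt => ?_
  have hs₂ : AtVertex G root v (par v) a s₂ := hs₁.frame hF₂ (by decide) (by decide)
  have eflow₂ : s₂.arr .flow = s.arr .flow := (hF₂.2 .flow rfl).trans (hF₁.2 .flow rfl)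
  refine Spec.cons (spec_divideFlows hlen hbig hsnd hv ha.1 hs₂ (X := X)
    (fun w hw hwu => by
      rw [eflow₂]
      exact ⟨(hchild w hw hwu).2.1, (hchild w hw hwu).1⟩)
    fun w hw => ⟨(hcnt w hw).1, (hcnt w hw).2.2⟩) (by omega) ?_
  rintro s₃ hF₃ ⟨hquo, hqs⟩
  have hs₃ : AtVertex G root v (par v) a s₃ := hs₂.frame hF₃ (by decide) (by decide)
  have eflow : s₃.arr .flow = s.arr .flow := (hF₃.2 .flow rfl).trans eflow₂
  have ewin : s₃.arr .win = s.arr .win :=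
    (hF₃.2 .win rfl).trans ((hF₂.2 .win rfl).trans (hF₁.2 .win rfl))
  refine Spec.cons (T₁ := 400 * G.outDegree v + 32) (P := fun s' =>
      s'.arr .flow = Function.update (s.arr .flow) v (X v).flow ∧
      s'.arr .win = Function.update (s.arr .win) v (X v).win.toNat)
      (Spec.ite (T := 400 * G.outDegree v + 30) (fun h => ?_) fun h => ?_) (by omega)
      fun s₄ _ h₄ => Spec.nil h₄
  · rw [hs₃.zero] at h
    refine (spec_slideWindow hlen hbig hsnd hv ha hs₃ (X := X) (fun w hw hwu => ?_) ?_ ?_ hquo hqs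
      h).mono le_rfl ?_
    · rw [ewin]
      exact ⟨(hchild w hw hwu).1, (hchild w hw hwu).2.2⟩
    · rw [hF₃.2 .cnt rfl]
      exact (hcnt _ (Or.inl rfl)).1
    · intro w hw
      rw [hF₃.2 .rcv rfl]
      exact (hcnt w hw).2.1
    · rintro s₄ _ ⟨B, hB, h1, h2⟩
      rw [hB.eq hX hv ha] at h1 h2
      rw [← eflow, ← ewin]
      exact ⟨h1, h2⟩
  · -- no child captures the particle
    rw [hs₃.zero] at h
    have hper : ∀ j, G.heads a (j + G.outDegree v) = G.heads a j := fun j => by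
      have := heads_add_outDegree (G := G.toRotorGraph) hta j
      rwa [ha.1] at this
    have hpos := outDegree_pos (G := G.toRotorGraph) a
    rw [ha.1] at hpos
    have hXv : X v = ⟨false, 0⟩ := by
      obtain ⟨⟨b, hb, hXv⟩, -⟩ := (hX v).2 hv
      obtain ⟨i, hi, rfl⟩ := (mem_choices_iff hv ha).1 hb
      rw [hXv, show G.heads (G.next^[i] a) = fun j => G.heads a (i + j) from
        funext fun j => heads_iterate a i j]
      refine nodeOutcome_of_turns hper hpos (fun w hw => ?_) i
      obtain ⟨j, hj, rfl⟩ := visits_pos_iff.1 hw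
      exact Nat.eq_zero_of_not_pos fun h' => h (hqs.1 j hj h').1
    refine Spec.of_wp ?_ (show _ ≤ _ by simp only [block, Code.length, Op.time]; omega)
    simp only [block, Code.wp, Op.Ok, Op.exec, ne_eq, not_false_eq_true, Function.update_of_ne,
      Function.update_self, reduceCtorEq, hs₃.reg_v, hs₃.zero, eflow, ewin, hXv]
    exact ⟨by omega, by omega, trivial, rfl⟩

/-- The solution of the optimality equations is computed from the leaves to the root; only the
vertices found by the search are evaluated, and the bound on the time is a sum over these vertices.
-/
theorem spec_solve (hR : G.Rooted root par depth) (hlen : n + m ≤ ℓ.len)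
    (hbig : 20 * ℓ.len + ℓ.fst * m ≤ ℓ.big) (hsnd : m ≤ ℓ.snd) {t : ℕ}
    (hX : G.IsOpt par (G.reaches t) X)
    (hfst : ∀ v ∉ G.sinks, ∀ w, G.HasArc v w → w ≠ par v → (X w).flow ≤ ℓ.fst)
    {L : List (Fin n)} {s : Store Reg Arr} (hs : Loaded G root s) (hL : Searched G root par L s)
    (ht : s.reg .t = t) :
    Spec ℓ solve s (500 * (n + m) + 3) fun s' => s'.arr .win root = (X root).win.toNat := by
  have hnodup := hL.found.nodup
  have hLn := hL.found.length_le
  refine Spec.cons (T₁ := 1) (P := fun s => s.reg .rest = L.length) (Spec.of_wp ?_ (by decide))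
    (by omega) ?_
  · simp only [Code.wp, Op.Ok, Op.exec, Function.update_self, hs.zero, hL.found.len_eq]
    exact ⟨by omega, rfl⟩
  intro s₁ hF₁ hrest₁
  have hs₁ : Loaded G root s₁ := hs.frame hF₁ (by decide) (by decide)
  have hL₁ : Searched G root par L s₁ := hL.frame hF₁ (by decide) (by decide)
  have ht₁ : s₁.reg .t = t := (hF₁.1 .t rfl).trans ht
  have hsum := sum_outDegree_le (G := G.toRotorGraph) hnodup
  refine Spec.cons (T₁ := 500 * (n + m) + 2)
    (P := fun s' => s'.arr .win root = (X root).win.toNat) ?_ (by omega) fun s₄ _ h₄ => Spec.nil h₄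
  refine Spec.loop (fun K s' => ∃ j ≤ L.length, s'.reg .rest = j ∧
    (∀ k w, j ≤ k → L[k]? = some w → s'.arr .flow w = (X w).flow ∧
      s'.arr .win w = (X w).win.toNat) ∧
    K = 500 * ((L.take j).map fun v => G.outDegree v + 1).sum)
    (500 * (L.map fun v => G.outDegree v + 1).sum)
    ⟨L.length, le_rfl, hrest₁, fun k w hk hw => ?_, by rw [List.take_length]⟩ ?_ ?_ (by omega)
  · rw [List.getElem?_eq_none hk] at hw
    exact absurd hw (by simp)
  · rintro K s' hF ⟨j, hj, hrest, hinv, rfl⟩ hlt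
    have hs' : Loaded G root s' := hs₁.frame hF (by decide) (by decide)
    have hL' : Searched G root par L s' := hL₁.frame hF (by decide) (by decide)
    have ht' : s'.reg .t = t := (hF.1 .t rfl).trans ht₁
    rw [hs'.zero, hrest] at hlt
    obtain ⟨j, rfl⟩ : ∃ j', j = j' + 1 := ⟨j - 1, by omega⟩
    obtain ⟨v, hv⟩ : ∃ v, L[j]? = some v := ⟨L[j], List.getElem?_eq_getElem (by omega)⟩
    have hvL : v ∈ L := List.mem_of_getElem? hv
    have hque := hL'.found.que_eq j v hv
    have hvlt := v.2
    have htake : L.take (j + 1) = L.take j ++ [v] := by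
      rw [List.take_add_one, hv]
      rfl
    refine ⟨474 * G.outDegree v + 90, ?_⟩
    refine Spec.cons (T₁ := 5) (P := fun s => s.reg .rest = j ∧ s.reg .v = v ∧
      s.reg .x = s.arr .kind v) (Spec.of_wp ?_ (by decide)) (by omega) ?_
    · simp only [block, Code.wp, Op.Ok, Op.exec, Function.update_apply, reduceCtorEq, if_true,
        if_false, hrest, hs'.one, Nat.add_sub_cancel, hque]
      exact ⟨trivial, by omega, by omega, trivial, trivial, trivial⟩
    rintro s₂ hF₂ ⟨hrest₂, hv₂, hx₂⟩
    have hs₂ : Loaded G root s₂ := hs'.frame hF₂ (by decide) (by decide)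
    have hL₂ : Searched G root par L s₂ := hL'.frame hF₂ (by decide) (by decide)
    have ht₂ : s₂.reg .t = t := (hF₂.1 .t rfl).trans ht'
    have hflow₂ : s₂.arr .flow = s'.arr .flow := hF₂.2 .flow rfl
    have hwin₂ : s₂.arr .win = s'.arr .win := hF₂.2 .win rfl
    refine Spec.cons (T₁ := 474 * G.outDegree v + 72) (P := fun s'' =>
      s''.arr .flow = Function.update (s'.arr .flow) v (X v).flow ∧
      s''.arr .win = Function.update (s'.arr .win) v (X v).win.toNat)
      (Spec.ite (T := 474 * G.outDegree v + 70) (fun h => ?_) fun h => ?_) (by omega) ?_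
    · rw [hx₂, hs₂.three, hs₂.kind_sink] at h
      rw [← hflow₂, ← hwin₂]
      refine spec_evalNode hlen hbig hsnd hX h hs₂ hv₂ (hL₂.found.par_eq v hvL) ?_
      rintro w hw hwp
      obtain ⟨b, hb, hbw⟩ := hw
      have hwL : w ∈ L := by
        have := hL.head_mem b (by rw [hb]; exact hvL) (by rw [hb]; exact h)
        rwa [hbw] at this
      have hpw := (hR.child_of_hasArc ⟨b, hb, hbw⟩ hwp).2
      obtain ⟨k, hk, hkw⟩ := List.getElem_of_mem hwL
      have hjlt : j < L.length := by omega
      have hjv : L[j] = v := by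
        rw [List.getElem?_eq_getElem hjlt] at hv
        exact Option.some.inj hv
      -- children come after their parents in the list, and have already been evaluated
      have hjk : j + 1 ≤ k := by
        rcases lt_trichotomy k j with hkj | hkj | hkj
        · exact absurd (by rw [hkw, hpw, hjv])
            (List.pairwise_iff_getElem.1 hL.found.order k j hk hjlt hkj)
        · subst hkj
          exact absurd (hb.trans (hjv.symm.trans (hkw.trans hbw.symm))) (G.tail_ne_head b)
        · exact hkj
      have := hinv k w hjk (by rw [List.getElem?_eq_getElem hk, hkw])
      rw [hflow₂, hwin₂]
      exact ⟨hfst v h w ⟨b, hb, hbw⟩ hwp, this⟩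
    · rw [hx₂, hs₂.three, hs₂.kind_sink, not_not] at h
      have hXv : X v = ⟨G.reaches t v, 1⟩ := (hX v).1 h
      have hr : G.reaches t v = true ↔ t ≤ G.val ⟨v, h⟩ := by
        unfold RotorGame.reaches
        simp [h]
      refine Spec.of_wp ?_ (show _ ≤ _ by simp only [block, Code.length, Op.time]; omega)
      simp only [block, Code.wp, Op.Ok, Op.exec, ne_eq, not_false_eq_true, Function.update_of_ne,
        Function.update_self, reduceCtorEq, hv₂, hs₂.zero, hs₂.one, hs₂.val v h, ht₂, hflow₂,
        hwin₂, hXv]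
      refine ⟨by omega, by omega, fun h' => ⟨by omega, trivial, ?_⟩,
        fun h' => ⟨by omega, trivial, ?_⟩⟩
      · have : G.reaches t v = false := Bool.eq_false_iff.2 fun h'' => by
          have := hr.1 h''
          omega
        rw [this]
        rfl
      · rw [hr.2 (by omega)]
        rfl
    rintro s₃ hF₃ ⟨hflow₃, hwin₃⟩
    refine Spec.nil ⟨500 * ((L.take j).map fun v => G.outDegree v + 1).sum, ⟨j, by omega,
      (hF₃.1 .rest rfl).trans hrest₂, fun k w hk hw => ?_, rfl⟩, ?_⟩
    · rw [hflow₃, hwin₃]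
      by_cases hwv : w = v
      · subst hwv
        simp
      · have hne : (w : ℕ) ≠ v := fun e => hwv (Fin.ext e)
        rw [Function.update_of_ne hne, Function.update_of_ne hne]
        refine hinv k w ?_ hw
        rcases Nat.lt_or_eq_of_le hk with h | rfl
        · exact h
        · rw [hv] at hw
          exact absurd (Option.some.inj hw).symm hwv
    · rw [htake, List.map_append, List.sum_append]
      simp only [List.map_cons, List.map_nil, List.sum_cons, List.sum_nil]
      omega
  · rintro K s' hF ⟨j, hj, hrest, hinv, rfl⟩ hlt
    rw [(hF.1 .zero rfl).trans hs₁.zero, hrest] at hlt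
    obtain ⟨k, hk, hkw⟩ := List.getElem_of_mem hL.found.root_mem
    exact (hinv k root (by omega) (by rw [List.getElem?_eq_getElem hk, hkw])).2

end RotorSolver

/-! ### Sorting the values of the sinks -/

namespace RotorSolver

open RAM RAM.Code RotorGraph

variable {ℓ : Limits}

/-- `f` is increasing from `i` to `j - 1`. -/
def Increasing (f : ℕ → ℕ) (i j : ℕ) : Prop := ∀ x y, i ≤ x → x ≤ y → y < j → f x ≤ f y

/-- Merging reads the sorted blocks from `lo` to `mid` and from `mid` to `hi` in the array `srt`,
and writes to the array `tmp`. -/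
theorem spec_mergeBlocks {s : Store Reg Arr} {lo mid hi : ℕ} (h0 : s.reg .zero = 0)
    (h1 : s.reg .one = 1) (hia : s.reg .ia = lo) (hja : s.reg .ja = mid) (hka : s.reg .ka = lo)
    (hmid : s.reg .mid = mid) (hhi : s.reg .hi = hi) (hlm : lo ≤ mid) (hmh : mid ≤ hi)
    (hlen : hi ≤ ℓ.len) (hbig : ℓ.len + 1 ≤ ℓ.big) (hs₁ : Increasing (s.arr .srt) lo mid)
    (hs₂ : Increasing (s.arr .srt) mid hi) :
    Spec ℓ mergeBlocks s (40 * (hi - lo) + 2) fun s' => Increasing (s'.arr .tmp) lo hi ∧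
      (∀ y, lo ≤ y → y < hi → ∃ x, lo ≤ x ∧ x < hi ∧ s'.arr .tmp y = s.arr .srt x) ∧
      (∀ x, lo ≤ x → x < hi → ∃ y, lo ≤ y ∧ y < hi ∧ s'.arr .tmp y = s.arr .srt x) ∧
      ∀ y, y < lo → s'.arr .tmp y = s.arr .tmp y := by
  refine Spec.loop (fun K s' => ∃ i j k, lo ≤ i ∧ i ≤ mid ∧ mid ≤ j ∧ j ≤ hi ∧ k + mid = i + j ∧
    s'.reg .ia = i ∧ s'.reg .ja = j ∧ s'.reg .ka = k ∧ Increasing (s'.arr .tmp) lo k ∧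
    (∀ y, lo ≤ y → y < k → ∃ x, lo ≤ x ∧ x < hi ∧ s'.arr .tmp y = s.arr .srt x) ∧
    (∀ x, (lo ≤ x ∧ x < i) ∨ (mid ≤ x ∧ x < j) →
      ∃ y, lo ≤ y ∧ y < k ∧ s'.arr .tmp y = s.arr .srt x) ∧
    (∀ y x, lo ≤ y → y < k → (i ≤ x ∧ x < mid) ∨ (j ≤ x ∧ x < hi) →
      s'.arr .tmp y ≤ s.arr .srt x) ∧
    (∀ y, y < lo → s'.arr .tmp y = s.arr .tmp y) ∧ K = 40 * (hi - k)) (40 * (hi - lo))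
    ⟨lo, mid, lo, le_rfl, hlm, le_rfl, hmh, rfl, hia, hja, hka, fun x y _ _ _ => by omega,
      fun y _ _ => by omega, fun x _ => by omega, fun y x _ _ => by omega, fun y _ => rfl, rfl⟩
    ?_ ?_ le_rfl
  · rintro K s' hF ⟨i, j, k, hi1, hi2, hj1, hj2, hk, eia, eja, eka, hinc, hfrom, hto, hle, hlow, rfl⟩
      hlt
    have e0 : s'.reg .zero = 0 := (hF.1 _ rfl).trans h0
    have e1 : s'.reg .one = 1 := (hF.1 _ rfl).trans h1
    have emid : s'.reg .mid = mid := (hF.1 _ rfl).trans hmid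
    have ehi : s'.reg .hi = hi := (hF.1 _ rfl).trans hhi
    have esrt : s'.arr .srt = s.arr .srt := hF.2 _ rfl
    rw [eka, ehi] at hlt
    refine ⟨38, Spec.cons (T₁ := 1) (P := fun s => s.reg .f = 0) (Spec.of_wp ?_ (by decide))
      (by omega) ?_⟩
    · simp only [Code.wp, Op.Ok, Op.exec, Function.update_self]
      exact ⟨Nat.zero_le _, trivial⟩
    intro s₂ hF₂ hf₂
    have r₂ : ∀ r, r ≠ .f → s₂.reg r = s'.reg r := fun r hr =>
      hF₂.1 r (by simp [Code.writes, hr.symm])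
    refine Spec.cons (T₁ := 14) (P := fun s₃ =>
      (0 < s₃.reg .f → i < mid ∧ ∀ x, (i ≤ x ∧ x < mid) ∨ (j ≤ x ∧ x < hi) →
        s.arr .srt i ≤ s.arr .srt x) ∧
      (¬ 0 < s₃.reg .f → j < hi ∧ ∀ x, (i ≤ x ∧ x < mid) ∨ (j ≤ x ∧ x < hi) →
        s.arr .srt j ≤ s.arr .srt x)) (Spec.of_wp ?_ (by decide)) (by omega) ?_
    · simp only [block, Code.wp, Op.Ok, Op.exec, Function.update_apply, reduceCtorEq, if_true,
        if_false, hf₂, r₂, ne_eq, not_false_eq_true, eia, eja, emid, ehi, hF₂.2 .srt rfl, esrt]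
      refine ⟨fun h2 => ⟨fun h3 => ⟨by omega, by omega, fun h4 => ⟨fun h => absurd h (lt_irrefl 0),
        fun _ => ⟨h3, ?_⟩⟩, fun h4 => ⟨by omega, fun _ => ⟨h2, ?_⟩, fun h => absurd Nat.one_pos h⟩⟩,
        fun h3 => ⟨by omega, fun _ => ⟨h2, ?_⟩, fun h => absurd Nat.one_pos h⟩⟩,
        fun h2 => ⟨fun h => absurd h (lt_irrefl 0), fun _ => ⟨by omega, ?_⟩⟩⟩
      · rintro x (h | h)
        · exact h4.le.trans (hs₁ i x hi1 h.1 h.2)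
        · exact hs₂ j x hj1 h.1 h.2
      · rintro x (h | h)
        · exact hs₁ i x hi1 h.1 h.2
        · exact (not_lt.1 h4).trans (hs₂ j x hj1 h.1 h.2)
      · rintro x (h | h)
        · exact hs₁ i x hi1 h.1 h.2
        · omega
      · rintro x (h | h)
        · omega
        · exact hs₂ j x hj1 h.1 h.2
    rintro s₃ hF₃ ⟨hpos, hneg⟩
    have r₃ : ∀ r, r ≠ .f → r ≠ .x → r ≠ .y → s₃.reg r = s'.reg r := fun r hr hr' hr'' => by
      rw [hF₃.1 r (by simp [Code.writes, block, hr.symm, hr'.symm, hr''.symm]), r₂ r hr]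
    have esrt₃ : s₃.arr .srt = s.arr .srt := (hF₃.2 .srt rfl).trans ((hF₂.2 .srt rfl).trans esrt)
    refine Spec.cons (T₁ := 8) (P := fun s₄ => ∃ z i' j', s₄.reg .x = s.arr .srt z ∧
      s₄.reg .ia = i' ∧ s₄.reg .ja = j' ∧ i ≤ i' ∧ i' ≤ mid ∧ j ≤ j' ∧ j' ≤ hi ∧
      i' + j' = i + j + 1 ∧ lo ≤ z ∧ z < hi ∧
      (∀ x, (lo ≤ x ∧ x < i') ∨ (mid ≤ x ∧ x < j') →
        ((lo ≤ x ∧ x < i) ∨ (mid ≤ x ∧ x < j)) ∨ x = z) ∧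
      (∀ x, (i ≤ x ∧ x < mid) ∨ (j ≤ x ∧ x < hi) → s.arr .srt z ≤ s.arr .srt x) ∧
      ((i ≤ z ∧ z < mid) ∨ (j ≤ z ∧ z < hi))) (Spec.of_wp ?_ (by decide)) (by omega) ?_
    · simp only [block, Code.wp, Op.Ok, Op.exec, Function.update_apply, reduceCtorEq, if_true,
        if_false, r₃, ne_eq, not_false_eq_true, eia, eja, e0, e1, esrt₃]
      refine ⟨fun h => ?_, fun h => ?_⟩
      · obtain ⟨h2, h3⟩ := hpos h
        exact ⟨by omega, by omega, i, i + 1, j, rfl, rfl, rfl, by omega, by omega, by omega,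
          by omega, by omega, by omega, by omega, fun x hx => by omega, h3, by omega⟩
      · obtain ⟨h2, h3⟩ := hneg h
        exact ⟨by omega, by omega, j, i, j + 1, rfl, rfl, rfl, by omega, by omega, by omega,
          by omega, by omega, by omega, by omega, fun x hx => by omega, h3, by omega⟩
    rintro s₄ hF₄ ⟨z, i', j', hx, hia', hja', hii, him, hjj, hjh, hij, hz1, hz2, hmem, hzle, hz⟩
    have eka₄ : s₄.reg .ka = k := by rw [hF₄.1 .ka rfl, r₃ .ka (by decide) (by decide) (by decide), eka]
    have e1₄ : s₄.reg .one = 1 := by rw [hF₄.1 .one rfl, r₃ .one (by decide) (by decide) (by decide), e1]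
    have etmp : s₄.arr .tmp = s'.arr .tmp :=
      (hF₄.2 .tmp rfl).trans ((hF₃.2 .tmp rfl).trans (hF₂.2 .tmp rfl))
    refine Spec.of_wp ?_ (by decide)
    simp only [block, Code.wp, Op.Ok, Op.exec, Function.update_self, reduceCtorEq, ne_eq,
      not_false_eq_true, Function.update_of_ne, eka₄, e1₄, hx, etmp, hia', hja']
    refine ⟨by omega, by omega, 40 * (hi - (k + 1)), ⟨i', j', k + 1, by omega, him, by omega, hjh,
      by omega, rfl, rfl, rfl, fun x y h1 h2 h3 => ?_, fun y h1 h2 => ?_, fun x h => ?_,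
      fun y x h1 h2 h3 => ?_, fun y h => ?_, rfl⟩, by omega⟩
    · rcases Nat.lt_succ_iff_lt_or_eq.1 h3 with h | rfl
      · rw [Function.update_of_ne (by omega), Function.update_of_ne (by omega)]
        exact hinc x y h1 h2 h
      · rw [Function.update_self]
        rcases Nat.lt_or_eq_of_le h2 with h | rfl
        · rw [Function.update_of_ne (by omega)]
          exact hle x z h1 h hz
        · rw [Function.update_self]
    · rcases Nat.lt_succ_iff_lt_or_eq.1 h2 with h | rfl
      · rw [Function.update_of_ne (by omega)]
        exact hfrom y h1 h
      · rw [Function.update_self]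
        exact ⟨z, hz1, hz2, rfl⟩
    · rcases hmem x h with h | rfl
      · obtain ⟨y, hy1, hy2, hy3⟩ := hto x h
        exact ⟨y, hy1, by omega, by rw [Function.update_of_ne (by omega), hy3]⟩
      · exact ⟨k, by omega, by omega, Function.update_self _ _ _⟩
    · rcases Nat.lt_succ_iff_lt_or_eq.1 h2 with h | rfl
      · rw [Function.update_of_ne (by omega)]
        exact hle y x h1 h (by omega)
      · rw [Function.update_self]
        exact hzle x (by omega)
    · rw [Function.update_of_ne (by omega)]
      exact hlow y h
  · rintro K s' hF ⟨i, j, k, hi1, hi2, hj1, hj2, hk, eia, eja, eka, hinc, hfrom, hto, hle, hlow, rfl⟩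
      hlt
    rw [eka, (hF.1 _ rfl).trans hhi] at hlt
    obtain rfl : i = mid := by omega
    obtain rfl : j = hi := by omega
    obtain rfl : k = j := by omega
    refine ⟨hinc, hfrom, fun x h h' => hto x ?_, hlow⟩
    omega

/-- Each block of length `w` among the first `N` entries is sorted. -/
def Blocks (f : ℕ → ℕ) (w N : ℕ) : Prop :=
  ∀ x y, x ≤ y → y < N → x / w = y / w → f x ≤ f y

/-- The first `N` values of `f` and `g` are the same, up to order and multiplicity. -/
def SameValues (f g : ℕ → ℕ) (N : ℕ) : Prop :=
  (∀ y < N, ∃ x < N, f y = g x) ∧ ∀ x < N, ∃ y < N, f y = g x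

theorem spec_mergePass {s : Store Reg Arr} {N w : ℕ} (h0 : s.reg .zero = 0)
    (h1 : s.reg .one = 1) (hnum : s.reg .num = N) (hwd : s.reg .wd = w) (hw : 0 < w) (hwN : w < N)
    (hlen : N ≤ ℓ.len) (hbig : 4 * ℓ.len + 1 ≤ ℓ.big) (hs : Blocks (s.arr .srt) w N) :
    Spec ℓ mergePass s (100 * N + 10) fun s' => Blocks (s'.arr .srt) (2 * w) N ∧
      SameValues (s'.arr .srt) (s.arr .srt) N := by
  refine Spec.cons (T₁ := 1) (P := fun s => s.reg .lo = 0) (Spec.of_wp ?_ (by decide))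
      (by omega) ?_
  · simp only [Code.wp, Op.Ok, Op.exec, Function.update_self]
    exact ⟨Nat.zero_le _, trivial⟩
  intro s₁ hF₁ hlo₁
  have esrt₁ : s₁.arr .srt = s.arr .srt := hF₁.2 _ rfl
  refine Spec.cons (T₁ := 80 * N + 2) (P := fun s' => Blocks (s'.arr .tmp) (2 * w) N ∧
    SameValues (s'.arr .tmp) (s.arr .srt) N) (Spec.loop (fun K s' => ∃ lo ≤ N,
      ((∃ b, lo = b * (2 * w)) ∨ lo = N) ∧ s'.reg .lo = lo ∧ Blocks (s'.arr .tmp) (2 * w) lo ∧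
      SameValues (s'.arr .tmp) (s.arr .srt) lo ∧ K = 80 * (N - lo)) (80 * N)
      ⟨0, Nat.zero_le _, Or.inl ⟨0, by simp⟩, hlo₁, fun x y _ h => by omega,
        ⟨fun y h => by omega, fun x h => by omega⟩, rfl⟩ ?_ ?_ le_rfl) (by omega) ?_
  · rintro K s' hF ⟨lo, hloN, hb, hlo, hblocks, hsame, rfl⟩ hlt
    have e0 : s'.reg .zero = 0 := (hF.1 _ rfl).trans ((hF₁.1 _ rfl).trans h0)
    have e1 : s'.reg .one = 1 := (hF.1 _ rfl).trans ((hF₁.1 _ rfl).trans h1)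
    have enum : s'.reg .num = N := (hF.1 _ rfl).trans ((hF₁.1 _ rfl).trans hnum)
    have ewd : s'.reg .wd = w := (hF.1 _ rfl).trans ((hF₁.1 _ rfl).trans hwd)
    have esrt : s'.arr .srt = s.arr .srt := (hF.2 _ rfl).trans esrt₁
    rw [hlo, enum] at hlt
    obtain ⟨b, rfl⟩ : ∃ b, lo = b * (2 * w) := by
      rcases hb with hb | hb
      · exact hb
      · omega
    obtain ⟨lo, hlodef⟩ : ∃ lo, lo = b * (2 * w) := ⟨_, rfl⟩
    have hdiv : ∀ x, lo ≤ x → x < lo + 2 * w → x / (2 * w) = b := fun x hx hx' => by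
      rw [Nat.div_eq_iff (by omega), ← hlodef]
      omega
    have hdiv₁ : ∀ x, lo ≤ x → x < lo + w → x / w = 2 * b := fun x hx hx' => by
      have : 2 * b * w = lo := by rw [hlodef]; ring
      rw [Nat.div_eq_iff hw, this]
      omega
    have hdiv₂ : ∀ x, lo + w ≤ x → x < lo + 2 * w → x / w = 2 * b + 1 := fun x hx hx' => by
      have : (2 * b + 1) * w = lo + w := by rw [hlodef]; ring
      rw [Nat.div_eq_iff hw, this]
      omega
    rw [← hlodef] at hloN hlo hblocks hsame hlt ⊢
    obtain ⟨mid, hmid⟩ : ∃ mid, mid = min (lo + w) N := ⟨_, rfl⟩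
    obtain ⟨hi, hhi⟩ : ∃ hi, hi = min (lo + 2 * w) N := ⟨_, rfl⟩
    refine ⟨40 * (hi - lo) + 30, Spec.cons (T₁ := 14) (P := fun s'' => s''.reg .mid = mid ∧
      s''.reg .hi = hi ∧ s''.reg .ia = lo ∧ s''.reg .ja = mid ∧ s''.reg .ka = lo)
      (Spec.of_wp ?_ (by decide)) (by omega) ?_⟩
    · simp only [block, Code.wp, Op.Ok, Op.exec, Function.update_apply, reduceCtorEq, if_true,
        if_false, hlo, ewd, enum, e0]
      refine ⟨by omega, fun h2 => ⟨by omega, by omega, fun h3 => ?_, fun h3 => ?_⟩,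
        fun h2 => ⟨by omega, fun h3 => ?_, fun h3 => ?_⟩⟩ <;>
        refine ⟨?_, ?_, ?_, ?_⟩ <;> omega
    rintro s₂ hF₂ ⟨hmid₂, hhi₂, hia₂, hja₂, hka₂⟩
    have esrt₂ : s₂.arr .srt = s.arr .srt := (hF₂.2 _ rfl).trans esrt
    refine Spec.cons (spec_mergeBlocks ((hF₂.1 _ rfl).trans e0) ((hF₂.1 _ rfl).trans e1) hia₂ hja₂
      hka₂ hmid₂ hhi₂ (by omega) (by omega) (by omega) (by omega) ?_ ?_) (by omega) ?_
    · rw [esrt₂]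
      intro x y h2 h3 h4
      exact hs x y h3 (by omega) (by rw [hdiv₁ x (by omega) (by omega), hdiv₁ y (by omega) (by omega)])
    · rw [esrt₂]
      intro x y h2 h3 h4
      exact hs x y h3 (by omega) (by rw [hdiv₂ x (by omega) (by omega), hdiv₂ y (by omega) (by omega)])
    rintro s₃ hF₃ ⟨hinc, hfrom, hto, hlow⟩
    rw [esrt₂] at hfrom hto
    have e0₃ : s₃.reg .zero = 0 := (hF₃.1 _ rfl).trans ((hF₂.1 _ rfl).trans e0)
    have ehi₃ : s₃.reg .hi = hi := (hF₃.1 _ rfl).trans hhi₂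
    have hlow' : ∀ y < lo, s₃.arr .tmp y = s'.arr .tmp y := fun y hy => by
      rw [hlow y hy, hF₂.2 .tmp rfl]
    refine Spec.of_wp ?_ (show _ ≤ _ by simp only [block, Code.length, Op.time]; omega)
    simp only [block, Code.wp, Op.Ok, Op.exec, Function.update_self, ehi₃, e0₃]
    refine ⟨by omega, 80 * (N - hi), ⟨hi, by omega, ?_, rfl, fun x y h2 h3 h4 => ?_,
      ⟨fun y h2 => ?_, fun x h2 => ?_⟩, rfl⟩, by omega⟩
    · by_cases h : lo + 2 * w ≤ N
      · exact Or.inl ⟨b + 1, by rw [hhi, min_eq_left h, hlodef]; ring⟩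
      · exact Or.inr (by omega)
    · by_cases hx : lo ≤ x
      · exact hinc x y hx h2 h3
      · have hxb : x / (2 * w) < b := by
          rw [Nat.div_lt_iff_lt_mul (by omega), ← hlodef]
          omega
        have hy : y < lo := by
          by_contra hy
          rw [hdiv y (by omega) (by omega)] at h4
          omega
        rw [hlow' x (by omega), hlow' y hy]
        exact hblocks x y h2 hy h4
    · by_cases hy : y < lo
      · obtain ⟨x, hx, he⟩ := hsame.1 y hy
        exact ⟨x, by omega, by rw [hlow' y hy, he]⟩
      · obtain ⟨x, -, hx, he⟩ := hfrom y (by omega) h2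
        exact ⟨x, hx, he⟩
    · by_cases hx : x < lo
      · obtain ⟨y, hy, he⟩ := hsame.2 x hx
        exact ⟨y, by omega, by rw [hlow' y hy, he]⟩
      · obtain ⟨y, -, hy, he⟩ := hto x (by omega) h2
        exact ⟨y, hy, he⟩
  · rintro K s' hF ⟨lo, hloN, hb, hlo, hblocks, hsame, rfl⟩ hlt
    rw [hlo, (hF.1 _ rfl).trans ((hF₁.1 _ rfl).trans hnum)] at hlt
    obtain rfl : lo = N := by omega
    exact ⟨hblocks, hsame⟩
  rintro s₂ hF₂ ⟨hblocks, hsame⟩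
  refine Spec.cons (T₁ := 1) (P := fun s => s.reg .i = 0) (Spec.of_wp ?_ (by decide))
      (by omega) ?_
  · simp only [Code.wp, Op.Ok, Op.exec, Function.update_self]
    exact ⟨Nat.zero_le _, trivial⟩
  intro s₃ hF₃ hi₃
  have e1 : s₃.reg .one = 1 := (hF₃.1 _ rfl).trans ((hF₂.1 _ rfl).trans ((hF₁.1 _ rfl).trans h1))
  have enum : s₃.reg .num = N :=
    (hF₃.1 _ rfl).trans ((hF₂.1 _ rfl).trans ((hF₁.1 _ rfl).trans hnum))
  have etmp : s₃.arr .tmp = s₂.arr .tmp := hF₃.2 _ rfl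
  refine Spec.cons (T₁ := 12 * N + 2) (P := fun s' => ∀ x < N, s'.arr .srt x = s₂.arr .tmp x)
    (Spec.loop (fun K s' => ∃ j ≤ N, s'.reg .i = j ∧ (∀ x < j, s'.arr .srt x = s₂.arr .tmp x) ∧
      K = 12 * (N - j)) (12 * N) ⟨0, Nat.zero_le _, hi₃, fun x h => by omega, rfl⟩ ?_ ?_ le_rfl)
      (by omega) ?_
  · rintro K s' hF ⟨j, hj, hi, hinv, rfl⟩ hlt
    rw [hi, (hF.1 _ rfl).trans enum] at hlt
    refine ⟨10, Spec.of_wp ?_ (by decide)⟩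
    simp only [block, Code.wp, Op.Ok, Op.exec, Function.update_apply, reduceCtorEq, if_true,
        if_false, hi, (hF.1 _ rfl).trans e1, (hF.2 .tmp rfl).trans etmp]
    refine ⟨by omega, by omega, by omega, 12 * (N - (j + 1)), ⟨j + 1, by omega, rfl,
      fun x hx => ?_, rfl⟩, by omega⟩
    split_ifs with h
    · rw [h]
    · exact hinv x (by omega)
  · rintro K s' hF ⟨j, hj, hi, hinv, rfl⟩ hlt
    rw [hi, (hF.1 _ rfl).trans enum] at hlt
    obtain rfl : j = N := by omega
    exact hinv
  intro s₄ hF₄ h₄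
  refine Spec.nil ⟨fun x y h2 h3 h4 => ?_, fun y h2 => ?_, fun x h2 => ?_⟩
  · rw [h₄ x (by omega), h₄ y h3]
    exact hblocks x y h2 h3 h4
  · rw [h₄ y h2]
    exact hsame.1 y h2
  · obtain ⟨y, hy, he⟩ := hsame.2 x h2
    exact ⟨y, hy, by rw [h₄ y hy, he]⟩

theorem SameValues.trans {f g h : ℕ → ℕ} {N : ℕ} (h₁ : SameValues f g N) (h₂ : SameValues g h N) :
    SameValues f h N := by
  refine ⟨fun y hy => ?_, fun x hx => ?_⟩
  · obtain ⟨x, hx, e⟩ := h₁.1 y hy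
    obtain ⟨z, hz, e'⟩ := h₂.1 x hx
    exact ⟨z, hz, e.trans e'⟩
  · obtain ⟨y, hy, e⟩ := h₂.2 x hx
    obtain ⟨z, hz, e'⟩ := h₁.2 y hy
    exact ⟨z, hz, e'.trans e⟩

/-- The array is sorted, and the powers of two that are needed for a binary search are stored. -/
theorem spec_sort {s : Store Reg Arr} {N : ℕ} (h0 : s.reg .zero = 0) (h1 : s.reg .one = 1)
    (hnum : s.reg .num = N) (hN : 0 < N) (hlen : N ≤ ℓ.len) (hbig : 4 * ℓ.len + 1 ≤ ℓ.big) :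
    Spec ℓ sort s ((100 * N + 20) * (Nat.log 2 N + 1) + 5) fun s' =>
      Increasing (s'.arr .srt) 0 N ∧ SameValues (s'.arr .srt) (s.arr .srt) N ∧
      ∃ k, s'.reg .kt = k ∧ N ≤ 2 ^ k ∧ (∀ j < k, s'.arr .pow j = 2 ^ j ∧ 2 ^ j < N) := by
  refine Spec.cons (T₁ := 2) (P := fun s => s.reg .wd = 1 ∧ s.reg .kt = 0)
    (Spec.of_wp ?_ (by decide)) (by omega) ?_
  · simp only [block, Code.wp, Op.Ok, Op.exec, Function.update_apply, reduceCtorEq, if_true,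
        if_false]
    exact ⟨by omega, Nat.zero_le _, trivial, trivial⟩
  rintro s₁ hF₁ ⟨hwd₁, hkt₁⟩
  have esrt₁ : s₁.arr .srt = s.arr .srt := hF₁.2 _ rfl
  refine Spec.cons (T₁ := (100 * N + 20) * (Nat.log 2 N + 1) + 2) (Spec.loop (Q := fun s' =>
      Increasing (s'.arr .srt) 0 N ∧ SameValues (s'.arr .srt) (s.arr .srt) N ∧
      ∃ k, s'.reg .kt = k ∧ N ≤ 2 ^ k ∧ (∀ j < k, s'.arr .pow j = 2 ^ j ∧ 2 ^ j < N))
    (fun K s' => ∃ k, s'.reg .kt = k ∧ s'.reg .wd = 2 ^ k ∧ Blocks (s'.arr .srt) (2 ^ k) N ∧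
      SameValues (s'.arr .srt) (s.arr .srt) N ∧
      (∀ j < k, s'.arr .pow j = 2 ^ j ∧ 2 ^ j < N) ∧
      K = (100 * N + 20) * (Nat.log 2 N + 1 - k)) ((100 * N + 20) * (Nat.log 2 N + 1)) ?_ ?_ ?_
      le_rfl) (by omega) fun s₄ _ h₄ => Spec.nil h₄
  · refine ⟨0, hkt₁, hwd₁, fun x y _ _ h => ?_, ?_, fun j h => by omega, rfl⟩
    · rw [pow_zero, Nat.div_one, Nat.div_one] at h
      rw [h]
    · rw [esrt₁]
      exact ⟨fun y h => ⟨y, h, rfl⟩, fun y h => ⟨y, h, rfl⟩⟩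
  · rintro K s' hF ⟨k, hkt, hwd, hblocks, hsame, hpow, rfl⟩ hlt
    have e0 : s'.reg .zero = 0 := (hF.1 _ rfl).trans ((hF₁.1 _ rfl).trans h0)
    have e1 : s'.reg .one = 1 := (hF.1 _ rfl).trans ((hF₁.1 _ rfl).trans h1)
    have enum : s'.reg .num = N := (hF.1 _ rfl).trans ((hF₁.1 _ rfl).trans hnum)
    rw [hwd, enum] at hlt
    have hk : k ≤ Nat.log 2 N := Nat.le_log_of_pow_le (by omega) hlt.le
    have hkN : k < N := Nat.lt_two_pow_self.trans hlt
    refine ⟨100 * N + 18, Spec.cons (T₁ := 3) (P := fun s'' => s''.reg .kt = k + 1 ∧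
      ∀ j < k + 1, s''.arr .pow j = 2 ^ j ∧ 2 ^ j < N) (Spec.of_wp ?_ (by decide)) (by omega) ?_⟩
    · simp only [block, Code.wp, Op.Ok, Op.exec, Function.update_apply, if_true, hkt, hwd, e1]
      refine ⟨by omega, by omega, trivial, fun j hj => ?_⟩
      split_ifs with h
      · rw [h]
        exact ⟨rfl, hlt⟩
      · exact hpow j (by omega)
    rintro s₂ hF₂ ⟨hkt₂, hpow₂⟩
    have esrt₂ : s₂.arr .srt = s'.arr .srt := hF₂.2 _ rfl
    refine Spec.cons (spec_mergePass (w := 2 ^ k) ((hF₂.1 _ rfl).trans e0) ((hF₂.1 _ rfl).trans e1)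
      ((hF₂.1 _ rfl).trans enum) ((hF₂.1 _ rfl).trans hwd) (by positivity) hlt hlen hbig
      (by rw [esrt₂]; exact hblocks)) (by omega) ?_
    rintro s₃ hF₃ ⟨hblocks₃, hsame₃⟩
    have hwd₃ : s₃.reg .wd = 2 ^ k := (hF₃.1 _ rfl).trans ((hF₂.1 _ rfl).trans hwd)
    have hkt₃ : s₃.reg .kt = k + 1 := (hF₃.1 _ rfl).trans hkt₂
    have hpow₃ : s₃.arr .pow = s₂.arr .pow := hF₃.2 _ rfl
    have h2k : 2 ^ k + 2 ^ k = 2 ^ (k + 1) := by ring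
    refine Spec.of_wp ?_ (show _ ≤ _ by simp only [block, Code.length, Op.time]; omega)
    simp only [block, Code.wp, Op.Ok, Op.exec, Function.update_apply, reduceCtorEq, if_true,
        if_false, hkt₃, hwd₃, hpow₃, h2k]
    refine ⟨by omega, (100 * N + 20) * (Nat.log 2 N + 1 - (k + 1)), ⟨k + 1, rfl, rfl, ?_, ?_, hpow₂,
      rfl⟩, ?_⟩
    · rw [pow_succ, mul_comm]
      exact hblocks₃
    · rw [esrt₂] at hsame₃
      exact hsame₃.trans hsame
    · obtain ⟨b, hb⟩ : ∃ b, Nat.log 2 N + 1 - k = b + 1 := ⟨Nat.log 2 N - k, by omega⟩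
      rw [hb, show Nat.log 2 N + 1 - (k + 1) = b by omega, Nat.mul_add]
      omega
  · rintro K s' hF ⟨k, hkt, hwd, hblocks, hsame, hpow, rfl⟩ hlt
    rw [hwd, (hF.1 _ rfl).trans ((hF₁.1 _ rfl).trans hnum)] at hlt
    refine ⟨fun x y _ h2 h3 => hblocks x y h2 h3 ?_, hsame, k, hkt, not_lt.1 hlt, hpow⟩
    rw [Nat.div_eq_of_lt (by omega), Nat.div_eq_of_lt (by omega)]

end RotorSolver

/-! ### The value of the game -/

namespace RotorSolver

open RAM RAM.Code RotorGraph

variable {n m : ℕ} {G : RotorGame (Fin n) (Fin m)} {root : Fin n} {par : Fin n → Fin n}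
  {depth : Fin n → ℕ} {ℓ : Limits}

/-- The first `N` entries of `f` are the values of the sinks. -/
def SinkValues (G : RotorGame (Fin n) (Fin m)) (f : ℕ → ℕ) (N : ℕ) : Prop :=
  (∀ k < N, ∃ s, f k = G.val s) ∧ ∀ s, ∃ k < N, f k = G.val s

theorem SameValues.sinkValues {f g : ℕ → ℕ} {N : ℕ} (h : SameValues f g N)
    (hg : SinkValues G g N) : SinkValues G f N := by
  refine ⟨fun k hk => ?_, fun s => ?_⟩
  · obtain ⟨x, hx, e⟩ := h.1 k hk
    obtain ⟨s, hs⟩ := hg.1 x hx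
    exact ⟨s, e.trans hs⟩
  · obtain ⟨x, hx, e⟩ := hg.2 s
    obtain ⟨y, hy, e'⟩ := h.2 x hx
    exact ⟨y, hy, e'.trans e⟩

theorem spec_collect (hlen : n + m ≤ ℓ.len) (hbig : ℓ.len + 1 ≤ ℓ.big) {s : Store Reg Arr}
    (hs : Loaded G root s) :
    Spec ℓ collect s (20 * n + 6) fun s' => s'.reg .num = G.sinks.ncard ∧
      SinkValues G (s'.arr .srt) G.sinks.ncard ∧ (0 < s'.reg .flag ↔ ¬ G.IsBinary) := by
  classical
  let P : ℕ → Prop := fun i => ∃ h : i < n, (⟨i, h⟩ : Fin n) ∈ G.sinks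
  have hcard : Nat.count P n = G.sinks.ncard := by
    rw [Nat.count_eq_card_filter_range, Set.ncard_eq_toFinset_card',
      ← Finset.card_map Fin.valEmbedding]
    congr 1
    ext i
    simp only [Finset.mem_filter, Finset.mem_range, Finset.mem_map, Set.mem_toFinset,
      Fin.valEmbedding_apply]
    constructor
    · rintro ⟨-, h, h'⟩
      exact ⟨⟨i, h⟩, h', rfl⟩
    · rintro ⟨v, hv, rfl⟩
      exact ⟨v.2, v.2, hv⟩
  refine Spec.cons (T₁ := 3) (P := fun s => s.reg .i = 0 ∧ s.reg .num = 0 ∧ s.reg .flag = 0)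
    (Spec.of_wp ?_ (by decide)) (by omega) ?_
  · simp only [block, Code.wp, Op.Ok, Op.exec, Function.update_apply, reduceCtorEq, if_true,
        if_false]
    exact ⟨Nat.zero_le _, Nat.zero_le _, Nat.zero_le _, trivial, trivial, trivial⟩
  rintro s₁ hF₁ ⟨hi₁, hnum₁, hflag₁⟩
  have hs₁ : Loaded G root s₁ := hs.frame hF₁ (by decide) (by decide)
  refine Spec.cons (T₁ := 20 * n + 2) (Spec.loop (Q := fun s' => s'.reg .num = G.sinks.ncard ∧
      SinkValues G (s'.arr .srt) G.sinks.ncard ∧ (0 < s'.reg .flag ↔ ¬ G.IsBinary))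
    (fun K s' => ∃ j ≤ n, s'.reg .i = j ∧ s'.reg .num = Nat.count P j ∧
      (∀ k < Nat.count P j, ∃ s, s'.arr .srt k = G.val s) ∧
      (∀ s : G.sinks, s.1.val < j → ∃ k < Nat.count P j, s'.arr .srt k = G.val s) ∧
      (0 < s'.reg .flag ↔ ∃ s : G.sinks, s.1.val < j ∧ 1 < G.val s) ∧ K = 20 * (n - j)) (20 * n)
      ⟨0, Nat.zero_le _, hi₁, by simpa using hnum₁, by simp, by simp, by simp [hflag₁], rfl⟩
      ?_ ?_ le_rfl) (by omega) fun s₂ _ h₂ => Spec.nil h₂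
  · rintro K s' hF ⟨j, hj, hi, hnum, hfrom, hto, hflag, rfl⟩ hlt
    have hs' : Loaded G root s' := hs₁.frame hF (by decide) (by decide)
    rw [hi, hs'.reg_n] at hlt
    obtain ⟨v, rfl⟩ : ∃ v : Fin n, j = v := ⟨⟨j, hlt⟩, rfl⟩
    have hkind := hs'.kind_sink v
    have hPv : P v ↔ v ∈ G.sinks := ⟨fun ⟨_, h⟩ => h, fun h => ⟨v.2, h⟩⟩
    have hcle : Nat.count P v ≤ v := Nat.count_le _
    have hlt_iff : ∀ s : G.sinks, s.1.val < v + 1 ↔ s.1.val < v ∨ s.1 = v := fun s => by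
      rw [Nat.lt_succ_iff_lt_or_eq, Fin.ext_iff]
    by_cases hv : v ∈ G.sinks
    · have hcount : Nat.count P (v + 1) = Nat.count P v + 1 := by
        rw [Nat.count_succ, if_pos (hPv.2 hv)]
      have hk : ¬ s'.arr .kind v < 3 := fun h => hkind.1 h hv
      have hval := hs'.val v hv
      have hfrom' : ∀ k < Nat.count P v + 1, ∃ s, (if k = Nat.count P v then G.val ⟨v, hv⟩
          else s'.arr .srt k) = G.val s := fun k hk => by
        split_ifs with h
        · exact ⟨_, rfl⟩
        · exact hfrom k (by omega)
      have hto' : ∀ s : G.sinks, s.1.val < v + 1 → ∃ k < Nat.count P v + 1,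
          (if k = Nat.count P v then G.val ⟨v, hv⟩ else s'.arr .srt k) = G.val s := fun s h => by
        rcases (hlt_iff s).1 h with h | h
        · obtain ⟨k, hk, e⟩ := hto s h
          exact ⟨k, by omega, by rw [if_neg (by omega), e]⟩
        · refine ⟨Nat.count P v, by omega, ?_⟩
          rw [if_pos rfl]
          congr 1
          exact Subtype.ext h.symm
      refine ⟨18, Spec.of_wp ?_ (by decide)⟩
      simp only [block, Code.wp, Op.Ok, Op.exec, Function.update_apply, reduceCtorEq, if_true,
        if_false, hi, hs'.one, hs'.three, hval, hnum, hk, not_false_eq_true, false_implies,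
        true_and, true_implies, ← hcount]
      rw [← hcount] at hfrom' hto'
      refine ⟨by omega, by omega, by omega, by omega, fun h => ⟨by omega, by omega,
        20 * (n - (v + 1)), ⟨v + 1, by omega, rfl, rfl, hfrom', hto', ?_, rfl⟩, by omega⟩,
        fun h => ⟨by omega, 20 * (n - (v + 1)), ⟨v + 1, by omega, rfl, rfl, hfrom', hto', ?_, rfl⟩,
          by omega⟩⟩
      · exact ⟨fun _ => ⟨⟨v, hv⟩, Nat.lt_succ_self _, h⟩, fun _ => Nat.one_pos⟩
      · rw [hflag]
        refine exists_congr fun s => and_congr_left fun h' => ?_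
        rw [hlt_iff]
        refine ⟨Or.inl, fun h'' => h''.resolve_right fun e => h ?_⟩
        have : s = ⟨v, hv⟩ := Subtype.ext e
        rwa [this] at h'
    · have hcount : Nat.count P (v + 1) = Nat.count P v := by
        rw [Nat.count_succ, if_neg (fun h => hv (hPv.1 h)), add_zero]
      have hk : s'.arr .kind v < 3 := hkind.2 hv
      have hlt_iff' : ∀ s : G.sinks, s.1.val < v + 1 ↔ s.1.val < v := fun s => by
        rw [hlt_iff, or_iff_left fun e : s.1 = v => hv (e ▸ s.2)]
      refine ⟨18, Spec.of_wp ?_ (by decide)⟩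
      simp only [block, Code.wp, Op.Ok, Op.exec, Function.update_apply, reduceCtorEq, if_true,
        if_false, hi, hs'.one, hs'.three, hk, not_true_eq_false, false_implies, and_true,
        true_implies]
      refine ⟨by omega, by omega, 20 * (n - (v + 1)), ⟨v + 1, by omega, rfl, ?_⟩, by omega⟩
      rw [hcount]
      refine ⟨hnum, hfrom, fun s h => hto s ((hlt_iff' s).1 h), ?_, rfl⟩
      rw [hflag]
      exact exists_congr fun s => and_congr_left fun _ => (hlt_iff' s).symm
  · rintro K s' hF ⟨j, hj, hi, hnum, hfrom, hto, hflag, rfl⟩ hlt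
    rw [hi, (hF.1 _ rfl).trans hs₁.reg_n] at hlt
    obtain rfl : j = n := by omega
    rw [hcard] at hnum hfrom hto
    refine ⟨hnum, ⟨hfrom, fun s => hto s s.1.2⟩, ?_⟩
    rw [hflag]
    unfold RotorGame.IsBinary
    push Not
    exact exists_congr fun s => and_iff_right s.1.2

/-- The thresholds below the value of the game are those for which MAX wins, and the flows of the
children are within the bounds. -/
def Solvable (G : RotorGame (Fin n) (Fin m)) (root : Fin n) (par : Fin n → Fin n) (ℓ : Limits)
    (v : ℕ) : Prop :=
  ∀ t, ∃ X, G.IsOpt par (G.reaches t) X ∧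
    (∀ v ∉ G.sinks, ∀ w, G.HasArc v w → w ≠ par v → (X w).flow ≤ ℓ.fst) ∧
    ((X root).win = true ↔ t ≤ v)

theorem spec_binarySearch (hR : G.Rooted root par depth) (hlen : n + m ≤ ℓ.len)
    (hbig : 20 * ℓ.len + ℓ.fst * m ≤ ℓ.big) (hsnd : m ≤ ℓ.snd) {v : ℕ}
    (hopt : Solvable G root par ℓ v) {L : List (Fin n)} {s : Store Reg Arr}
    (hs : Loaded G root s) (hL : Searched G root par L s) {N k : ℕ} (hN : N ≤ n)
    (hnum : s.reg .num = N) (hinc : Increasing (s.arr .srt) 0 N)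
    (hv : ∃ i < N, s.arr .srt i = v) (hkt : s.reg .kt = k) (hk : N ≤ 2 ^ k)
    (hpow : ∀ j < k, s.arr .pow j = 2 ^ j ∧ 2 ^ j < N) :
    Spec ℓ binarySearch s ((500 * (n + m) + 40) * k + 8) fun s' => s'.reg .out = v := by
  obtain ⟨i₀, hi₀, hiv⟩ := hv
  have hrlt := root.2
  refine Spec.cons (T₁ := 1) (P := fun s => s.reg .lo = 0) (Spec.of_wp ?_ (by decide))
    (by omega) ?_
  · simp only [Code.wp, Op.Ok, Op.exec, Function.update_self]
    exact ⟨Nat.zero_le _, trivial⟩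
  intro s₁ hF₁ hlo₁
  have hs₁ : Loaded G root s₁ := hs.frame hF₁ (by decide) (by decide)
  have hL₁ : Searched G root par L s₁ := hL.frame hF₁ (by decide) (by decide)
  have hsrt₁ : s₁.arr .srt = s.arr .srt := hF₁.2 _ rfl
  have hpow₁ : s₁.arr .pow = s.arr .pow := hF₁.2 _ rfl
  refine Spec.cons (T₁ := (500 * (n + m) + 40) * k + 2) (P := fun s' => ∃ l < N, s'.reg .lo = l ∧
    s.arr .srt l = v ∧ s'.arr .srt = s.arr .srt) ?_ (by omega) ?_
  swap
  · rintro s₂ hF₂ ⟨l, hl, hlo, hlv, hsrt⟩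
    refine Spec.of_wp ?_ (show _ ≤ _ by simp only [block, Code.length, Op.time]; omega)
    simp only [block, Code.wp, Op.Ok, Op.exec, Function.update_self, hlo, hsrt, hlv]
    exact ⟨by omega, trivial⟩
  -- The value of the game is among the entries from `l` to `l + 2 ^ j - 1`.
  refine Spec.loop (fun K s' => ∃ j l, j ≤ k ∧ l < N ∧ s'.reg .kt = j ∧ s'.reg .lo = l ∧
    s.arr .srt l ≤ v ∧ (∀ i, l + 2 ^ j ≤ i → i < N → v < s.arr .srt i) ∧
    K = (500 * (n + m) + 40) * j) ((500 * (n + m) + 40) * k)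
    ⟨k, 0, le_rfl, by omega, (hF₁.1 _ rfl).trans hkt, hlo₁,
      (hinc 0 i₀ le_rfl (Nat.zero_le _) hi₀).trans_eq hiv, fun i h h' => by omega, rfl⟩ ?_ ?_ le_rfl
  · rintro K s' hF ⟨j, l, hj, hl, hkt', hlo', hle, hgt, rfl⟩ hlt
    have hs' : Loaded G root s' := hs₁.frame hF (by decide) (by decide)
    have hL' : Searched G root par L s' := hL₁.frame hF (by decide) (by decide)
    have hnum' : s'.reg .num = N := (hF.1 _ rfl).trans ((hF₁.1 _ rfl).trans hnum)
    have hsrt' : s'.arr .srt = s.arr .srt := (hF.2 _ rfl).trans hsrt₁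
    have hpow' : s'.arr .pow = s.arr .pow := (hF.2 _ rfl).trans hpow₁
    rw [hs'.zero, hkt'] at hlt
    obtain ⟨j, rfl⟩ : ∃ j', j = j' + 1 := ⟨j - 1, by omega⟩
    obtain ⟨hpj, hpN⟩ := hpow j (by omega)
    have hjN : j < N := Nat.lt_two_pow_self.trans hpN
    have h2j : 2 ^ (j + 1) = 2 ^ j + 2 ^ j := by ring
    have hsucc : (500 * (n + m) + 40) * (j + 1) = (500 * (n + m) + 40) * j + (500 * (n + m) + 40) :=
      Nat.mul_succ _ _
    refine ⟨500 * (n + m) + 38, Spec.cons (T₁ := 4) (P := fun s'' => s''.reg .kt = j ∧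
      s''.reg .hi = l + 2 ^ j) (Spec.of_wp ?_ (by decide)) (by omega) ?_⟩
    · simp only [block, Code.wp, Op.Ok, Op.exec, Function.update_apply, reduceCtorEq, if_true,
        if_false, hkt', hlo', hs'.one, hpow', Nat.add_sub_cancel, hpj]
      exact ⟨trivial, by omega, by omega, trivial, trivial⟩
    rintro s₂ hF₂ ⟨hkt₂, hhi₂⟩
    have hs₂ : Loaded G root s₂ := hs'.frame hF₂ (by decide) (by decide)
    have hL₂ : Searched G root par L s₂ := hL'.frame hF₂ (by decide) (by decide)
    have hlo₂ : s₂.reg .lo = l := (hF₂.1 _ rfl).trans hlo'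
    have hsrt₂ : s₂.arr .srt = s.arr .srt := (hF₂.2 _ rfl).trans hsrt'
    have hnum₂ : s₂.reg .num = N := (hF₂.1 _ rfl).trans hnum'
    refine Spec.cons (T₁ := 500 * (n + m) + 32) (P := fun s'' => ∃ K', (∃ j l, j ≤ k ∧ l < N ∧
      s''.reg .kt = j ∧ s''.reg .lo = l ∧
      s.arr .srt l ≤ v ∧ (∀ i, l + 2 ^ j ≤ i → i < N → v < s.arr .srt i) ∧
      K' = (500 * (n + m) + 40) * j) ∧ K' + (500 * (n + m) + 38) + 2 ≤
        (500 * (n + m) + 40) * (j + 1))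
      (Spec.ite (T := 500 * (n + m) + 30) (fun h => ?_) fun h => ?_) (by omega)
      fun s₃ _ h₃ => Spec.nil h₃
    · rw [hhi₂, hnum₂] at h
      refine Spec.cons (T₁ := 2) (P := fun s'' => s''.reg .t = s.arr .srt (l + 2 ^ j))
        (Spec.of_wp ?_ (by decide)) (by omega) ?_
      · simp only [Code.wp, Op.Ok, Op.exec, Function.update_self, hhi₂, hsrt₂]
        exact ⟨by omega, trivial⟩
      intro s₃ hF₃ ht₃
      have hs₃ : Loaded G root s₃ := hs₂.frame hF₃ (by decide) (by decide)
      have hL₃ : Searched G root par L s₃ := hL₂.frame hF₃ (by decide) (by decide)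
      obtain ⟨X, hX, hfst, hXv⟩ := hopt (s.arr .srt (l + 2 ^ j))
      refine Spec.cons (spec_solve hR hlen hbig hsnd hX hfst hs₃ hL₃ ht₃) (by omega) ?_
      intro s₄ hF₄ hwin
      have hs₄ : Loaded G root s₄ := hs₃.frame hF₄ (by decide) (by decide)
      have hkt₄ : s₄.reg .kt = j := (hF₄.1 _ rfl).trans ((hF₃.1 _ rfl).trans hkt₂)
      have hlo₄ : s₄.reg .lo = l := (hF₄.1 _ rfl).trans ((hF₃.1 _ rfl).trans hlo₂)
      have hhi₄ : s₄.reg .hi = l + 2 ^ j := (hF₄.1 _ rfl).trans ((hF₃.1 _ rfl).trans hhi₂)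
      refine Spec.of_wp ?_ (show _ ≤ _ by simp only [block, Code.length, Op.time]; omega)
      simp only [block, Code.wp, Op.Ok, Op.exec, Function.update_apply, reduceCtorEq, if_true,
        if_false, hs₄.reg_root, hs₄.zero, hwin, hkt₄, hlo₄, hhi₄]
      refine ⟨by omega, fun hpos => ⟨by omega, (500 * (n + m) + 40) * j, ⟨j, l + 2 ^ j, by omega, h,
        rfl, rfl, ?_, fun i h1 h2 => hgt i (by omega) h2, rfl⟩, by omega⟩,
        fun hneg => ⟨(500 * (n + m) + 40) * j, ⟨j, l, by omega, hl,
        rfl, rfl, hle, fun i h1 h2 => ?_, rfl⟩, by omega⟩⟩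
      · exact hXv.1 (by cases hb : (X root).win <;> simp_all)
      · have : ¬ s.arr .srt (l + 2 ^ j) ≤ v := fun h' => hneg (by rw [hXv.2 h']; exact Nat.one_pos)
        exact (not_le.1 this).trans_le (hinc _ _ (Nat.zero_le _) h1 h2)
    · rw [hhi₂, hnum₂] at h
      refine Spec.of_wp (c := .skip) ⟨(500 * (n + m) + 40) * j, ⟨j, l, by omega, hl, hkt₂, hlo₂, hle,
        fun i h1 h2 => by omega, rfl⟩, by omega⟩ (by simp [Code.length])
  · rintro K s' hF ⟨j, l, hj, hl, hkt', hlo', hle, hgt, rfl⟩ hlt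
    rw [(hF.1 .zero rfl).trans hs₁.zero, hkt'] at hlt
    obtain rfl : j = 0 := by omega
    refine ⟨l, hl, hlo', le_antisymm hle ?_, (hF.2 .srt rfl).trans hsrt₁⟩
    by_contra h
    have hlt' : l + 2 ^ 0 ≤ i₀ := by
      rw [pow_zero]
      by_contra h'
      have := hinc i₀ l (Nat.zero_le _) (by omega) hl
      omega
    have := hgt i₀ hlt' hi₀
    omega

/-- The program computes the value of the game. -/
theorem spec_main (hR : G.Rooted root par depth) (hexit : G.toRotorGraph.Stopping)
    (hlen : ℓ.len = 3 + 3 * (n + m)) (hbig : 20 * ℓ.len + ℓ.fst * m ≤ ℓ.big) (hsnd : m ≤ ℓ.snd)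
    {v : ℕ} (hopt : Solvable G root par ℓ v) (hv : ∃ s, G.val s = v) {T : ℕ}
    (hT : G.IsBinary → 700 * (n + m) + 100 ≤ T)
    (hT' : ¬ G.IsBinary → (1000 * (n + m) + 100) * (Nat.log 2 G.sinks.ncard + 1) ≤ T) :
    Spec ℓ main (Store.initial .input (G.encode root)) T fun s => s.reg .out = v := by
  have hrlt := root.2
  have hNn : G.sinks.ncard ≤ n := by
    have := Set.ncard_le_card G.sinks
    rwa [Nat.card_eq_fintype_card, Fintype.card_fin] at this
  have hN0 : 0 < G.sinks.ncard := (Set.ncard_pos (Set.toFinite _)).2 G.sinks_nonempty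
  have hsucc : (1000 * (n + m) + 100) * (Nat.log 2 G.sinks.ncard + 1) =
      (1000 * (n + m) + 100) * Nat.log 2 G.sinks.ncard + (1000 * (n + m) + 100) := Nat.mul_succ _ _
  have hT₀ : 82 * (n + m) + 66 ≤ T := by
    by_cases hb : G.IsBinary
    · have := hT hb
      omega
    · have := hT' hb
      omega
  refine Spec.cons (spec_loadGame hexit hlen (by omega)) (by omega) ?_
  rintro s₁ hF₁ ⟨hs₁, hvis⟩
  refine Spec.cons (spec_search hR (by omega) (by omega) hs₁ hvis) (by omega) ?_
  rintro s₂ hF₂ ⟨L, hL₂⟩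
  have hs₂ : Loaded G root s₂ := hs₁.frame hF₂ (by decide) (by decide)
  refine Spec.cons (spec_collect (by omega) (by omega) hs₂) (by omega) ?_
  rintro s₃ hF₃ ⟨hnum, hvals, hflag⟩
  have hs₃ : Loaded G root s₃ := hs₂.frame hF₃ (by decide) (by decide)
  have hL₃ : Searched G root par L s₃ := hL₂.frame hF₃ (by decide) (by decide)
  refine Spec.cons (T₁ := T - (82 * (n + m) + 62)) (P := fun s => s.reg .out = v)
    ((Spec.ite (T := T - (82 * (n + m) + 64)) (fun h => ?_) fun h => ?_).mono (by omega)
      fun _ _ h => h) (by omega) fun s₄ _ h₄ => Spec.nil h₄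
  · rw [hs₃.zero, hflag] at h
    have hT'' := hT' h
    have hsucc₁ : (100 * G.sinks.ncard + 20) * (Nat.log 2 G.sinks.ncard + 1) =
        (100 * G.sinks.ncard + 20) * Nat.log 2 G.sinks.ncard + (100 * G.sinks.ncard + 20) :=
      Nat.mul_succ _ _
    have hmono₁ : (100 * G.sinks.ncard + 20) * Nat.log 2 G.sinks.ncard ≤
        (100 * (n + m) + 20) * Nat.log 2 G.sinks.ncard := Nat.mul_le_mul_right _ (by omega)
    have hadd : (1000 * (n + m) + 100) * Nat.log 2 G.sinks.ncard =
        (100 * (n + m) + 20) * Nat.log 2 G.sinks.ncard +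
        (500 * (n + m) + 40) * Nat.log 2 G.sinks.ncard +
        (400 * (n + m) + 40) * Nat.log 2 G.sinks.ncard := by ring
    refine Spec.cons (spec_sort hs₃.zero hs₃.one hnum hN0 (by omega) (by omega)) (by omega) ?_
    rintro s₄ hF₄ ⟨hinc, hsame, k, hkt, hk, hpow⟩
    have hs₄ : Loaded G root s₄ := hs₃.frame hF₄ (by decide) (by decide)
    have hL₄ : Searched G root par L s₄ := hL₃.frame hF₄ (by decide) (by decide)
    have hklog : k ≤ Nat.log 2 G.sinks.ncard + 1 := by
      rcases Nat.eq_zero_or_pos k with rfl | hk0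
      · exact Nat.zero_le _
      · have := Nat.le_log_of_pow_le (by omega) (hpow (k - 1) (by omega)).2.le
        omega
    have hmul := Nat.mul_le_mul_left (500 * (n + m) + 40) hklog
    rw [Nat.mul_add_one] at hmul
    obtain ⟨sk, hsk⟩ := hv
    obtain ⟨i, hi, hiv⟩ := (hsame.sinkValues hvals).2 sk
    refine Spec.cons (spec_binarySearch hR (by omega) hbig hsnd hopt hs₄ hL₄ hNn
      ((hF₄.1 _ rfl).trans hnum) hinc ⟨i, hi, hiv.trans hsk⟩ hkt hk hpow) (by omega)
      fun s₅ _ h₅ => Spec.nil h₅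
  · rw [hs₃.zero, hflag, not_not] at h
    have hT'' := hT h
    obtain ⟨sk, rfl⟩ := hv
    have hle := h sk
    refine Spec.cons (T₁ := 1) (P := fun s => s.reg .t = 1) (Spec.of_wp ?_ (by decide))
      (by omega) ?_
    · simp only [Code.wp, Op.Ok, Op.exec, Function.update_self, hs₃.one, hs₃.zero]
      exact ⟨by omega, trivial⟩
    intro s₄ hF₄ ht
    have hs₄ : Loaded G root s₄ := hs₃.frame hF₄ (by decide) (by decide)
    have hL₄ : Searched G root par L s₄ := hL₃.frame hF₄ (by decide) (by decide)
    obtain ⟨X, hX, hfst, hXv⟩ := hopt 1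
    refine Spec.cons (spec_solve hR (by omega) hbig hsnd hX hfst hs₄ hL₄ ht) (by omega) ?_
    intro s₅ hF₅ hwin
    have hs₅ : Loaded G root s₅ := hs₄.frame hF₅ (by decide) (by decide)
    refine Spec.of_wp ?_ (show _ ≤ _ by simp only [block, Code.length, Op.time]; omega)
    simp only [block, Code.wp, Op.Ok, Op.exec, Function.update_self, hs₅.reg_root, hwin]
    refine ⟨by omega, ?_⟩
    by_cases h1 : 1 ≤ G.val sk
    · rw [hXv.2 h1]
      exact le_antisymm h1 hle
    · rw [Bool.eq_false_iff.2 fun h2 => h1 (hXv.1 h2)]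
      show 0 = _
      omega

end RotorSolver

/-! ### Running times -/

theorem RAM.ComputesWithin.mono {cost : RAM.Instr → RAM.State → ℕ} {P : RAM.Program}
    {input : List ℕ} {output T T' : ℕ} (h : RAM.ComputesWithin cost P input output T)
    (hT : T ≤ T') : RAM.ComputesWithin cost P input output T' := by
  obtain ⟨k, h₁, h₂, h₃⟩ := h
  exact ⟨k, h₁, h₂, h₃.trans hT⟩

namespace RotorGraph.TreeLike

variable {n m : ℕ} {G : RotorGraph (Fin n) (Fin m)}

theorem le_arcs_add_one (htree : G.TreeLike) : n ≤ m + 1 := by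
  classical
  have hsub : G.underlying.edgeFinset ⊆
      Finset.univ.image fun a : Fin m => s(G.tail a, G.head a) := by
    intro e he
    induction e with
    | _ x y =>
      rw [SimpleGraph.mem_edgeFinset, SimpleGraph.mem_edgeSet] at he
      rw [Finset.mem_image]
      rcases he with ⟨a, rfl, rfl⟩ | ⟨a, rfl, rfl⟩
      · exact ⟨a, Finset.mem_univ _, rfl⟩
      · exact ⟨a, Finset.mem_univ _, Sym2.eq_swap⟩
  have hcard := (Finset.card_le_card hsub).trans Finset.card_image_le
  have htree' := htree.1.card_edgeFinset
  rw [Finset.card_univ, Fintype.card_fin] at hcard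
  rw [Fintype.card_fin] at htree'
  omega

theorem arcs_pos (htree : G.TreeLike) : 0 < m := by
  obtain ⟨s, hs⟩ := G.sinks_nonempty
  obtain ⟨x, hx⟩ := Set.nonempty_of_ncard_ne_zero (by rw [htree.2 s hs]; exact one_ne_zero)
  rcases hx with ⟨a, -⟩ | ⟨a, -⟩ <;> exact a.pos

end RotorGraph.TreeLike

namespace RotorSolver

open RAM RAM.Code RotorGame

variable {n m : ℕ} {G : RotorGame (Fin n) (Fin m)}

theorem exists_val_eq_of_isValue (htree : G.toRotorGraph.TreeLike)
    (hexit : G.toRotorGraph.Stopping) {u₀ : Fin n} {v : ℕ} (hv : G.IsValue u₀ v) :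
    ∃ s, G.val s = v := by
  obtain ⟨σ, τ, h⟩ := hv
  obtain ⟨s, hs⟩ := value_mem_range (root := u₀) htree hexit σ τ
  exact ⟨s, hs.symm.trans (le_antisymm (h.min_guarantees σ) (h.max_guarantees τ))⟩

theorem le_maxSinkValue (s : G.sinks) : G.val s ≤ G.maxSinkValue :=
  le_ciSup (Set.finite_range G.val).bddAbove s

/-- The machine program that computes values of games. -/
def program : Program :=
  main.program Reg.ctorIdx Arr.ctorIdx 18

/-- The numbers up to `256 * m * (f + 1)` have at most as many bits as `f` and `m` together, up to a
constant, and hence their handling is not more expensive than a division of `f` by `m`. -/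
theorem cost_le {f b len : ℕ} (hm : 0 < m) (hb : b ≤ 256 * (m * (f + 1))) {c : ℕ → ℕ → ℕ}
    (hc : IsDivisionCost c) :
    (⟨len, b, f, m⟩ : Limits).cost c ≤ 30 * c f m := by
  have hmf : m * (f + 1) < 2 ^ m.size * 2 ^ f.size :=
    Nat.mul_lt_mul_of_lt_of_le (Nat.lt_size_self m) (Nat.lt_size_self f) (by positivity)
  have hsize : b.size ≤ 8 + (m.size + f.size) := by
    rw [Nat.size_le, pow_add, pow_add]
    omega
  have h1 : 0 < m.size := Nat.size_pos.2 hm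
  have h2 := hc.size_le f m
  show 1 + 2 * b.size + c f m ≤ _
  omega

/-- The number of steps is bounded by the one of the structured program, and all numbers that
appear are polynomial in the number of arcs, the bound `f` on the return flows, and the values of
the sinks. -/
theorem program_computesWithin (htree : G.toRotorGraph.TreeLike)
    (hexit : G.toRotorGraph.Stopping) {u₀ : Fin n} {v : ℕ} (hv : G.IsValue u₀ v) {f : ℕ}
    (hf : G.maxReturnFlow ≤ f) (hval : ∀ s, G.val s ≤ f + 1) {T : ℕ}
    (hT : G.IsBinary → 700 * (n + m) + 100 ≤ T)
    (hT' : ¬ G.IsBinary → (1000 * (n + m) + 100) * (Nat.log 2 G.sinks.ncard + 1) ≤ T) :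
    ComputesWithin unitCost program (G.encode u₀) v (26 + T) ∧
    ∀ c, IsDivisionCost c →
      ComputesWithin (bitCost c) program (G.encode u₀) v ((26 + T) * (30 * c f m)) := by
  obtain ⟨par, depth, hR⟩ := G.toRotorGraph.exists_rooted htree.1 u₀
  have hnm := htree.le_arcs_add_one
  have hm := htree.arcs_pos
  have hfm : f ≤ f * m := Nat.le_mul_of_pos_right f hm
  have hmul : m * (f + 1) = f * m + m := by ring
  let ℓ : Limits := ⟨3 + 3 * (n + m), 20 * (3 + 3 * (n + m)) + f * m + 1, f, m⟩
  have hsol : Solvable G u₀ par ℓ v := fun t => by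
    obtain ⟨X, hX⟩ := exists_isOpt hR hexit (G.reaches t)
    exact ⟨X, hX, fun v hv w ha hw =>
      (flow_le_maxReturnFlow hR htree hexit hX hv ha hw).trans hf,
      win_root_iff_le_value hR htree hexit hX hv⟩
  have hspec := spec_main (ℓ := ℓ) hR hexit rfl
    (show 20 * (3 + 3 * (n + m)) + f * m ≤ 20 * (3 + 3 * (n + m)) + f * m + 1 by omega)
    le_rfl hsol (exists_val_eq_of_isValue htree hexit hv) hT hT'
  obtain ⟨hunit, hbit⟩ := hspec.computesWithin (ir := Reg.ctorIdx) (ia := Arr.ctorIdx)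
    (Function.LeftInverse.injective Reg.ofNat_ctorIdx)
    (Function.LeftInverse.injective Arr.ofNat_ctorIdx) (k := 18) (fun a => by cases a <;> decide)
    rfl rfl rfl (length_encode _ _).le
    (fun x hx => le_of_mem_encode _ _ (show n + m + 3 ≤ 20 * (3 + 3 * (n + m)) + f * m + 1 by omega)
      (fun s => (hval s).trans (show f + 1 ≤ 20 * (3 + 3 * (n + m)) + f * m + 1 by omega)) hx)
    (show (18 + 1) * (3 + 3 * (n + m)) ≤ 20 * (3 + 3 * (n + m)) + f * m + 1 by omega)
  exact ⟨hunit, fun c hc => (hbit c hc).mono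
    (Nat.mul_le_mul_left _ (cost_le hm (by rw [hmul]; omega) hc))⟩

theorem binary_time_le (hn : n ≤ m + 1) (hm : 0 < m) :
    26 + (700 * (n + m) + 100) ≤ 4000 * m := by
  omega

theorem general_time_le {l : ℕ} (hn : n ≤ m + 1) (hm : 0 < m) :
    26 + (1000 * (n + m) + 100) * (l + 1) ≤ 4000 * (m * (l + 1)) := by
  have h : (1000 * (n + m) + 100) * (l + 1) ≤ 3100 * m * (l + 1) :=
    Nat.mul_le_mul_right _ (by omega)
  have hpos : 0 < m * (l + 1) := Nat.mul_pos hm l.succ_pos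
  rw [mul_assoc] at h
  omega

end RotorSolver

theorem mainTheorem2 :
    (∀ (V A : Type*) [Finite V] [Finite A] (G : RotorGame V A),
      G.toRotorGraph.TreeLike → G.toRotorGraph.Stopping →
      ∀ u₀ : V, ∃ (v : ℕ) (σ : G.MaxStrategy) (τ : G.MinStrategy),
        G.IsPureEquilibrium u₀ v σ τ) ∧
    (∃ (P : RAM.Program) (C : ℕ),
      ∀ (n m : ℕ) (G : RotorGame (Fin n) (Fin m)),
        G.toRotorGraph.TreeLike → G.toRotorGraph.Stopping →
        ∀ (u₀ : Fin n) (v : ℕ), G.IsValue u₀ v →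
          -- binary games, arithmetic operations in constant time
          (G.IsBinary →
            RAM.ComputesWithin RAM.unitCost P (G.encode u₀) v (C * m)) ∧
          -- binary games, arithmetic operations charged by their bit complexity
          (G.IsBinary → ∀ c : ℕ → ℕ → ℕ, RAM.IsDivisionCost c →
            RAM.ComputesWithin (RAM.bitCost c) P (G.encode u₀) v
              (C * (m * c G.maxReturnFlow m))) ∧
          -- integer games, arithmetic operations in constant time
          RAM.ComputesWithin RAM.unitCost P (G.encode u₀) v
            (C * (m * (Nat.log 2 G.sinks.ncard + 1))) ∧
          -- integer games, arithmetic operations charged by their bit complexity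
          (∀ c : ℕ → ℕ → ℕ, RAM.IsDivisionCost c →
            RAM.ComputesWithin (RAM.bitCost c) P (G.encode u₀) v
              (C * (m * c (max G.maxReturnFlow G.maxSinkValue) m *
                (Nat.log 2 G.sinks.ncard + 1))))) := by
  refine ⟨fun V A _ _ G htree hexit u₀ => G.exists_isPureEquilibrium htree hexit u₀,
    RotorSolver.program, 120000, fun n m G htree hexit u₀ v hv => ?_⟩
  have hn := htree.le_arcs_add_one
  have hm := htree.arcs_pos
  have hbin := fun hb : G.IsBinary => RotorSolver.program_computesWithin htree hexit hv le_rfl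
    (fun s => (hb s).trans (Nat.le_add_left _ _)) (fun _ => le_rfl) (fun h => absurd hb h)
  -- A binary game is within the time limit for general games, as the logarithmic factor is
  -- positive.
  have hgen := RotorSolver.program_computesWithin htree hexit hv
    (le_max_left G.maxReturnFlow G.maxSinkValue)
    (fun s => ((RotorSolver.le_maxSinkValue s).trans (le_max_right _ _)).trans (Nat.le_succ _))
    (T := (1000 * (n + m) + 100) * (Nat.log 2 G.sinks.ncard + 1))
    (fun _ => (by omega : 700 * (n + m) + 100 ≤ 1000 * (n + m) + 100).trans
      (Nat.le_mul_of_pos_right _ (Nat.succ_pos _))) (fun _ => le_rfl)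
  have htime := RotorSolver.general_time_le (l := Nat.log 2 G.sinks.ncard) hn hm
  refine ⟨fun hb => (hbin hb).1.mono ?_, fun hb c hc => ((hbin hb).2 c hc).mono ?_,
    hgen.1.mono ?_, fun c hc => (hgen.2 c hc).mono ?_⟩
  · exact (RotorSolver.binary_time_le hn hm).trans (Nat.mul_le_mul_right _ (by norm_num))
  · refine (Nat.mul_le_mul_right _ (RotorSolver.binary_time_le hn hm)).trans_eq ?_
    ring
  · exact htime.trans (Nat.mul_le_mul_right _ (by norm_num))
  · refine (Nat.mul_le_mul_right _ htime).trans_eq ?_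
    ring
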